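/- Let $n \ge 1$ and let $A$ be an $n$-homogeneous C*-algebra, i.e. a (not necessarily unital) C*-algebra all of whose irreducible representations have dimension $n$. Let $T = \mathrm{Prim}(A)$ be its primitive ideal space with the hull-kernel topology, and let $\mathcal A$ be the $M_n(\mathbb C)$-bundle over $T$ corresponding to $A$: its fibre over $t \in T$ is $A/t \cong M_n$, and its topology is generated by the sets $\{x \in A/t : t \in U,\ \|x - (a+t)\| < \varepsilon\}$ with $a \in A$, $U \subseteq T$ open, $\varepsilon > 0$. Let $\mathrm{Aut}(M_n)$ be the group of *-automorphisms of $M_n$ with the topology of pointwise convergence, $D_n \subseteq M_n$ the diagonal matrices, and $\mathrm{Aut}(M_n,D_n) = \{\varphi \in \mathrm{Aut}(M_n) : \varphi(D_n) = D_n\}$. Let $\alpha$ be the principal $\mathrm{Aut}(M_n)$-bundle of $\mathcal A$: its fibre over $t$ is the set of *-isomorphisms $M_n \to A/t$, its topology is that of pointwise convergence of maps $M_n \to \mathcal A$, and $\mathrm{Aut}(M_n)$ acts from the right by composition. A Cartan subalgebra of $A$ is a maximal abelian sub-C*-algebra $B \subseteq A$ which contains an approximate unit of $A$, is regular (the set $\{m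 \in A : mBm^* \subseteq B,\ m^*Bm \subseteq B\}$ generates $A$ as a C*-algebra), and is the range of a faithful conditional expectation $A \to B$. We say that $\alpha$ reduces to a principal $\mathrm{Aut}(M_n,D_n)$-bundle if there is a (locally trivial) principal $\mathrm{Aut}(M_n,D_n)$-bundle $\beta$ over $T$ such that $\alpha$ is isomorphic over $T$, as a principal $\mathrm{Aut}(M_n)$-bundle, to $\beta \times_{\mathrm{Aut}(M_n,D_n)} \mathrm{Aut}(M_n)$, where $\mathrm{Aut}(M_n,D_n)$ acts on $\mathrm{Aut}(M_n)$ by left multiplication. Then $A$ has a Cartan subalgebra if and only if $\alpha$ reduces to a principal $\mathrm{Aut}(M_n,D_n)$-bundle. -/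

import Mathlib

open Topology

universe u

noncomputable section

/-! ### Homogeneous C*-algebras and the primitive ideal space -/

section Representations

variable {A : Type u} [NonUnitalCStarAlgebra A]

/-- A representation `π` of `A` on a Hilbert space is (topologically) irreducible: it is nonzero and
the only closed invariant subspaces are the trivial ones. -/
def IsIrreducibleRep {H : Type u} [NormedAddCommGroup H] [InnerProductSpace ℂ H] [CompleteSpace H]
    (π : A →⋆ₙₐ[ℂ] (H →L[ℂ] H)) : Prop :=
  π ≠ 0 ∧ ∀ K : Submodule ℂ H, IsClosed (K : Set H) → (∀ a : A, ∀ v ∈ K, π a v ∈ K) →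
    K = ⊥ ∨ K = ⊤

end Representations

/-- `A` is `n`-homogeneous (for `n ≥ 1`): all its irreducible representations have dimension `n`.
Irreducible representations are cyclic, so Hilbert spaces in the universe of `A` suffice. -/
def IsHomogeneous (n : ℕ) (A : Type u) [NonUnitalCStarAlgebra A] : Prop :=
  ∀ (H : Type u) [NormedAddCommGroup H] [InnerProductSpace ℂ H] [CompleteSpace H]
    (π : A →⋆ₙₐ[ℂ] (H →L[ℂ] H)), IsIrreducibleRep π → Module.finrank ℂ H = n

/-- The points of the primitive ideal space `Prim A`: the kernels of irreducible representations. -/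
structure PrimitiveIdeal (A : Type u) [NonUnitalCStarAlgebra A] where
  toSubmodule : Submodule ℂ A
  exists_rep : ∃ (H : Type u) (_ : NormedAddCommGroup H) (_ : InnerProductSpace ℂ H)
    (_ : CompleteSpace H) (π : A →⋆ₙₐ[ℂ] (H →L[ℂ] H)), IsIrreducibleRep π ∧
      ∀ a : A, a ∈ toSubmodule ↔ π a = 0

namespace PrimitiveIdeal

variable {A : Type u} [NonUnitalCStarAlgebra A]

/-- The hull-kernel (Jacobson) topology: the closed sets are the hulls `{t | S ⊆ t}` of subsets
`S` of `A`, so the sets `{t | a ∉ t}` generate it. -/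
instance : TopologicalSpace (PrimitiveIdeal A) :=
  TopologicalSpace.generateFrom {U | ∃ a : A, U = {t | a ∉ t.toSubmodule}}

theorem mul_mem_left (t : PrimitiveIdeal A) (a : A) {b : A} (hb : b ∈ t.toSubmodule) :
    a * b ∈ t.toSubmodule := by
  obtain ⟨H, _, _, _, π, -, h⟩ := t.exists_rep
  rw [h] at hb ⊢
  rw [map_mul, hb, mul_zero]

theorem mul_mem_right (t : PrimitiveIdeal A) {a : A} (b : A) (ha : a ∈ t.toSubmodule) :
    a * b ∈ t.toSubmodule := by
  obtain ⟨H, _, _, _, π, -, h⟩ := t.exists_rep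
  rw [h] at ha ⊢
  rw [map_mul, ha, zero_mul]

theorem star_mem (t : PrimitiveIdeal A) {a : A} (ha : a ∈ t.toSubmodule) :
    star a ∈ t.toSubmodule := by
  obtain ⟨H, _, _, _, π, -, h⟩ := t.exists_rep
  rw [h] at ha ⊢
  rw [map_star, ha, star_zero]

/-! ### The C*-bundle of a C*-algebra over its primitive ideal space -/

/-- The fibre `A / t`, with the quotient norm and the quotient *-algebra structure. -/
def Fibre (t : PrimitiveIdeal A) : Type u := A ⧸ t.toSubmodule

instance (t : PrimitiveIdeal A) : SeminormedAddCommGroup (Fibre t) :=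
  Submodule.Quotient.seminormedAddCommGroup t.toSubmodule

instance (t : PrimitiveIdeal A) : Module ℂ (Fibre t) :=
  Submodule.Quotient.module t.toSubmodule

/-- The value `a(t)` of `a` at `t`, its class in `A / t`. -/
def value (a : A) (t : PrimitiveIdeal A) : Fibre t := t.toSubmodule.mkQ a

instance (t : PrimitiveIdeal A) : Mul (Fibre t) where
  mul := Quotient.map₂ (· * ·) fun a a' h b b' h' => by
    have h₁ : a - a' ∈ t.toSubmodule := (Submodule.quotientRel_def _).1 h
    have h₂ : b - b' ∈ t.toSubmodule := (Submodule.quotientRel_def _).1 h'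
    refine (Submodule.quotientRel_def _).2 ?_
    have e : a * b - a' * b' = (a - a') * b + a' * (b - b') := by
      rw [sub_mul, mul_sub]; abel
    change a * b - a' * b' ∈ t.toSubmodule
    rw [e]
    exact add_mem (t.mul_mem_right b h₁) (t.mul_mem_left a' h₂)

instance (t : PrimitiveIdeal A) : Star (Fibre t) where
  star := Quotient.map star fun a a' h => by
    have h₁ : a - a' ∈ t.toSubmodule := (Submodule.quotientRel_def _).1 h
    refine (Submodule.quotientRel_def _).2 ?_
    rw [← star_sub]
    exact t.star_mem h₁

theorem value_mul (t : PrimitiveIdeal A) (a b : A) :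
    value (a * b) t = value a t * value b t := rfl

theorem value_star (t : PrimitiveIdeal A) (a : A) : value (star a) t = star (value a t) := rfl

end PrimitiveIdeal

/-- The total space of the C*-bundle over `Prim A` corresponding to `A`, with fibres `A / t`. -/
structure BundleSpace (A : Type u) [NonUnitalCStarAlgebra A] where
  base : PrimitiveIdeal A
  val : PrimitiveIdeal.Fibre base

/-- The tube of radius `ε` around the section `t ↦ a(t)` over the subset `U` of the base. -/
def BundleSpace.tube {A : Type u} [NonUnitalCStarAlgebra A] (a : A) (U : Set (PrimitiveIdeal A))
    (ε : ℝ) : Set (BundleSpace A) :=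
  {x : BundleSpace A | x.base ∈ U ∧ ‖x.val - PrimitiveIdeal.value a x.base‖ < ε}

/-- The topology of the C*-bundle: it is generated by the tubes of radius `ε` around the sections
`t ↦ a(t)`, `a ∈ A`, over open subsets `U` of the base. -/
instance (A : Type u) [NonUnitalCStarAlgebra A] : TopologicalSpace (BundleSpace A) :=
  TopologicalSpace.generateFrom
    {V | ∃ (a : A) (U : Set (PrimitiveIdeal A)) (ε : ℝ), IsOpen U ∧ 0 < ε ∧
      V = BundleSpace.tube a U ε}

/-! ### The groups `Aut(M_n)` and `Aut(M_n, D_n)` -/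

/-- The *-algebra `M_n` of complex `n × n` matrices; the star is the conjugate transpose. -/
abbrev Mat (n : ℕ) : Type := Matrix (Fin n) (Fin n) ℂ

/-- The group of *-automorphisms of `M_n`. -/
abbrev AutMat (n : ℕ) : Type := Mat n ≃⋆ₐ[ℂ] Mat n

/-- The topology of pointwise convergence; as `M_n` is finite-dimensional it is the norm topology. -/
instance (n : ℕ) : TopologicalSpace (AutMat n) :=
  TopologicalSpace.induced (fun (g : AutMat n) (x : Mat n) => g x) inferInstance

/-- The subalgebra `D_n` of diagonal matrices, as a set. -/
def diagMat (n : ℕ) : Set (Mat n) := {x | x.IsDiag}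

/-- The subgroup `Aut(M_n, D_n)` of the automorphisms `g` of `M_n` with `g(D_n) = D_n`. -/
def autDiag (n : ℕ) : Subgroup (AutMat n) where
  carrier := {g | (fun x => g x) '' diagMat n = diagMat n}
  mul_mem' := by
    intro g h hg hh
    change (fun x => g (h x)) '' diagMat n = diagMat n
    rw [← Set.image_image (fun x => g x) (fun x => h x)]
    exact (congrArg _ hh).trans hg
  one_mem' := by
    change (fun x => x) '' diagMat n = diagMat n
    exact Set.image_id' _
  inv_mem' := by
    intro g hg
    change (fun x => g.symm x) '' diagMat n = diagMat n
    have hg' : (fun x => g x) '' diagMat n = diagMat n := hg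
    conv_lhs => rw [← hg']
    rw [Set.image_image]
    simp

/-! ### Principal bundles, extension and reduction of the structure group

The structure group acts from the right, that is, through its opposite group: `x · g` is
`MulOpposite.op g • x`. -/

/-- `p : P → T` is a (locally trivial) principal `G`-bundle. -/
structure IsPrincipalBundle (G : Type*) [Group G] [TopologicalSpace G] {P T : Type*}
    [TopologicalSpace P] [TopologicalSpace T] [MulAction Gᵐᵒᵖ P] (p : P → T) : Prop where
  proj_smul : ∀ (g : G) (x : P), p (MulOpposite.op g • x) = p x
  locally_trivial : ∀ t : T, ∃ e : Bundle.Trivialization G p, t ∈ e.baseSet ∧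
    ∀ x : P, p x ∈ e.baseSet → ∀ g : G, (e (MulOpposite.op g • x)).2 = (e x).2 * g

section Extension

variable {G : Type*} [Group G] (H : Subgroup G) (Q : Type*) [MulAction (H)ᵐᵒᵖ Q]

/-- The relation `(x · h, g) ∼ (x, h g)` on `Q × G`. -/
def extensionSetoid : Setoid (Q × G) where
  r y z := ∃ h : H, z.1 = MulOpposite.op h • y.1 ∧ y.2 = (h : G) * z.2
  iseqv :=
    { refl := fun y => ⟨1, by simp, by simp⟩
      symm := by
        rintro y z ⟨h, h₁, h₂⟩
        refine ⟨h⁻¹, ?_, ?_⟩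
        · rw [h₁, smul_smul, ← MulOpposite.op_mul]; simp
        · rw [h₂]; simp
      trans := by
        rintro x y z ⟨h, h₁, h₂⟩ ⟨k, k₁, k₂⟩
        refine ⟨h * k, ?_, ?_⟩
        · rw [k₁, h₁, smul_smul, ← MulOpposite.op_mul]
        · rw [h₂, k₂, Subgroup.coe_mul, mul_assoc] }

/-- The extension `Q ×_H G` of a principal `H`-bundle `Q` to the structure group `G`, constructed
from `Q` and the action of `H` on `G` by left multiplication. -/
def Extension : Type _ := Quotient (extensionSetoid H Q)

/-- The quotient topology of the product topology. -/
instance [TopologicalSpace G] [TopologicalSpace Q] : TopologicalSpace (Extension H Q) :=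
  inferInstanceAs (TopologicalSpace (Quotient (extensionSetoid H Q)))

/-- The right action `[x, g] · k = [x, g k]` of `G`. -/
instance : MulAction Gᵐᵒᵖ (Extension H Q) where
  smul k := Quotient.map (fun y : Q × G => (y.1, y.2 * k.unop)) (by
    rintro y z ⟨h, h₁, h₂⟩
    exact ⟨h, h₁, by rw [h₂, mul_assoc]⟩)
  one_smul := by
    rintro ⟨x, g⟩
    exact congrArg (Quotient.mk (extensionSetoid H Q)) (Prod.ext rfl (mul_one g))
  mul_smul := by
    rintro k l ⟨x, g⟩
    exact congrArg (Quotient.mk (extensionSetoid H Q))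
      (Prod.ext rfl (mul_assoc g l.unop k.unop).symm)

/-- The class `[x, g]` in `Q ×_H G`. -/
def Extension.mk {Q : Type*} [MulAction (H)ᵐᵒᵖ Q] (x : Q) (g : G) : Extension H Q :=
  Quotient.mk (extensionSetoid H Q) (x, g)

end Extension

/-- The principal `G`-bundle `p : P → T` reduces to a principal `H`-bundle: there are a principal
`H`-bundle `q : Q → T` and an isomorphism over `T` (an equivariant homeomorphism that respects the
projections) from the principal `G`-bundle `Q ×_H G → T`, `[x, g] ↦ q x`, onto `P`. -/
def ReducesTo {G : Type*} [Group G] [TopologicalSpace G] (H : Subgroup G) {P T : Type u}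
    [TopologicalSpace P] [TopologicalSpace T] [MulAction Gᵐᵒᵖ P] (p : P → T) : Prop :=
  ∃ (Q : Type u) (_ : TopologicalSpace Q) (_ : MulAction (H)ᵐᵒᵖ Q) (q : Q → T),
    IsPrincipalBundle H q ∧
      ∃ f : Extension H Q ≃ₜ P,
        (∀ (g : G) (y : Extension H Q), f (MulOpposite.op g • y) = MulOpposite.op g • f y) ∧
        ∀ (x : Q) (g : G), p (f (Extension.mk H x g)) = q x

/-! ### The principal `Aut(M_n)`-bundle of the `M_n`-bundle corresponding to `A` -/

/-- The principal bundle associated with the bundle of the fibres `A / t`: its points over `t` are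
the admissible maps `M_n → A / t`, that is, the *-isomorphisms of `M_n` onto the fibre. -/
structure FrameSpace (n : ℕ) (A : Type u) [NonUnitalCStarAlgebra A] where
  base : PrimitiveIdeal A
  frame : Mat n ≃⋆ₐ[ℂ] PrimitiveIdeal.Fibre base

namespace FrameSpace

variable {n : ℕ} {A : Type u} [NonUnitalCStarAlgebra A]

/-- A point of the principal bundle, as a map from `M_n` to the total space of the bundle. -/
def toBundle (w : FrameSpace n A) (x : Mat n) : BundleSpace A := ⟨w.base, w.frame x⟩

/-- The topology of pointwise convergence of maps from `M_n` to the total space of the bundle. -/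
instance : TopologicalSpace (FrameSpace n A) :=
  TopologicalSpace.induced (fun (w : FrameSpace n A) (x : Mat n) => w.toBundle x) inferInstance

/-- The right action of `Aut(M_n)` by composition: `φ · g = φ ∘ g`. -/
instance : MulAction (AutMat n)ᵐᵒᵖ (FrameSpace n A) where
  smul g w := ⟨w.base, g.unop.trans w.frame⟩
  one_smul _ := rfl
  mul_smul _ _ _ := rfl

theorem toBundle_smul (w : FrameSpace n A) (g : AutMat n) (x : Mat n) :
    (MulOpposite.op g • w).toBundle x = w.toBundle (g x) := rfl

end FrameSpace

/-! ### Cartan subalgebras -/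

section Cartan

variable {A : Type u} [NonUnitalCStarAlgebra A]

/-- `E` is a faithful conditional expectation of `A` onto the sub-C*-algebra `B`: a positive
contractive `B`-bimodule map which is the identity on `B`, such that `E (a* a) = 0` only for
`a = 0`. -/
structure IsFaithfulCondExp (B : NonUnitalStarSubalgebra ℂ A) (E : A →ₗ[ℂ] B) : Prop where
  map_coe : ∀ b : B, E (b : A) = b
  norm_le : ∀ a : A, ‖E a‖ ≤ ‖a‖
  map_positive : ∀ a : A, ∃ b : B, E (star a * a) = star b * b
  map_mul_left : ∀ (b : B) (a : A), E ((b : A) * a) = b * E a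
  map_mul_right : ∀ (a : A) (b : B), E (a * (b : A)) = E a * b
  faithful : ∀ a : A, E (star a * a) = 0 → a = 0

/-- The normalizer `{m ∈ A | m B m* ⊆ B and m* B m ⊆ B}` of `B` in `A`. -/
def normalizerSet (B : NonUnitalStarSubalgebra ℂ A) : Set A :=
  {m | ∀ b ∈ B, m * b * star m ∈ B ∧ star m * b * m ∈ B}

/-- `B` is a Cartan subalgebra of `A`. -/
structure IsCartanSubalgebra (B : NonUnitalStarSubalgebra ℂ A) : Prop where
  /-- `B` is maximal among the abelian sub-C*-algebras of `A`. -/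
  maximal_abelian : Maximal (fun C : NonUnitalStarSubalgebra ℂ A =>
    IsClosed (C : Set A) ∧ ∀ x ∈ C, ∀ y ∈ C, x * y = y * x) B
  /-- `B` contains an approximate unit of `A`. -/
  approximate_unit : ∃ l : Filter A, l.IsApproximateUnit ∧ ∀ᶠ x in l, x ∈ B
  /-- `B` is regular: the normalizer of `B` generates `A` as a C*-algebra. -/
  regular : (NonUnitalStarAlgebra.adjoin ℂ (normalizerSet B)).topologicalClosure = ⊤
  /-- There is a faithful conditional expectation of `A` onto `B`. -/
  expectation : ∃ E : A →ₗ[ℂ] B, IsFaithfulCondExp B E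

end Cartan

end

/-!
A frame at `t ∈ Prim A` is the same thing as a representation of `A` onto `M_n` with kernel `t`, and
the frame bundle carries the topology of pointwise convergence of these representations. A reduction
to `Aut(M_n, D_n)` amounts to a set `R` of frames which is stable under `Aut(M_n, D_n)`, on whose
fibres this group is transitive, and which has local continuous sections.

Given `R`, the elements which are diagonal in all frames of `R` form a Cartan subalgebra: the
conditional expectation takes the diagonal part, which commutes with `Aut(M_n, D_n)`, and locally
the matrix units of the frames in `R` cut the elements of `A` into normalizers.

Conversely, let `B` be a Cartan subalgebra with conditional expectation `E`. Since `B` contains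
central elements with small support, `E` acts fibrewise as a projection onto the fibre of `B`, and
continuity makes the dimension of these fibres locally constant. Functional calculus then gives
orthogonal self-adjoint elements of `B` whose values form a basis of each fibre of `B` nearby; there
are at least `n` of them, because `B` is maximal abelian and so contains the corners that they cut
out. Hence the fibres of `B` are conjugate to `D_n`. The frames which carry `D_n` onto the fibres of
`B` have continuous local sections, obtained by requiring elements `v i ∈ A` to be positive
multiples of the matrix units `e_{i i₀}`, which determines the frame.
-/

/-! ### Pure states and irreducible representations -/

section PureStates

open scoped ComplexOrder InnerProductSpace

theorem exists_mem_extremePoints_closedBall_dual {E : Type*} [NormedAddCommGroup E]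
    [NormedSpace ℂ E] (x : E) :
    ∃ φ ∈ Set.extremePoints ℝ (Metric.closedBall (0 : StrongDual ℂ E) 1), φ x = ‖x‖ := by
  have : LocallyConvexSpace ℝ (WeakDual ℂ E) :=
    inferInstanceAs (LocallyConvexSpace ℝ (WeakBilin (topDualPairing ℂ E)))
  let S : Set (WeakDual ℂ E) := WeakDual.toStrongDual ⁻¹' Metric.closedBall 0 1
  let F : Set (WeakDual ℂ E) := S ∩ {φ | φ x = ‖x‖}
  have hF : IsCompact F := (WeakDual.isCompact_closedBall 0 1).inter_right
    (isClosed_eq (WeakDual.eval_continuous x) continuous_const)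
  obtain ⟨g, hg, hgx⟩ := exists_dual_vector'' ℂ x
  have hne : F.Nonempty :=
    ⟨StrongDual.toWeakDual g, mem_closedBall_zero_iff.2 hg, hgx⟩
  obtain ⟨φ, hφ⟩ := hF.extremePoints_nonempty hne
  have hface : IsExtreme ℝ S F := by
    refine ⟨Set.inter_subset_left, fun φ₁ h₁ φ₂ h₂ ψ hψ hseg => ⟨h₁, ?_⟩⟩
    have hball : ∀ χ ∈ S, χ x ∈ Metric.closedBall (0 : ℂ) ‖x‖ := fun χ hχ => by
      simpa using (WeakDual.toStrongDual χ).le_of_opNorm_le (mem_closedBall_zero_iff.1 hχ) x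
    rcases eq_or_ne x 0 with rfl | hx
    · simp
    have hext := StrictConvexSpace.sphere_subset_extremePoints_closedBall (0 : ℂ)
      (norm_ne_zero_iff.2 hx) (show (‖x‖ : ℂ) ∈ _ by simp)
    refine hext.2 (hball φ₁ h₁) (hball φ₂ h₂) ?_
    obtain ⟨a, b, ha, hb, hab, rfl⟩ := hseg
    exact ⟨a, b, ha, hb, hab, hψ.2⟩
  exact ⟨_, hface.extremePoints_subset_extremePoints hφ, hφ.1.2⟩

section States

variable {U : Type*} [CStarAlgebra U]

theorem norm_one_le_one (U : Type*) [CStarAlgebra U] : ‖(1 : U)‖ ≤ 1 := by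
  nontriviality U
  exact CStarRing.norm_one.le

theorem norm_add_norm_smul_one_of_nonneg [PartialOrder U] [StarOrderedRing U] {b : U}
    (hb : 0 ≤ b) : ‖b + ‖b‖ • (1 : U)‖ = 2 * ‖b‖ := by
  nontriviality U
  have hspec : 2 * ‖b‖ ∈ spectrum ℝ (b + ‖b‖ • (1 : U)) := by
    rw [← Algebra.algebraMap_eq_smul_one, add_comm b, two_mul, spectrum.add_mem_add_iff]
    exact CStarAlgebra.norm_mem_spectrum_of_nonneg hb
  refine le_antisymm ((norm_add_le _ _).trans ?_) ?_
  · rw [norm_smul, norm_norm, two_mul]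
    gcongr
    exact mul_le_of_le_one_right (norm_nonneg b) (norm_one_le_one U)
  · exact (le_abs_self _).trans (spectrum.norm_le_norm_of_mem hspec)

/-- Extreme functionals which attain their norm at `b + ‖b‖ • 1` take the value `1` at `1` and
`‖b‖` at `b`. -/
theorem exists_extreme_map_one_eq_one_map_eq_norm [PartialOrder U] [StarOrderedRing U] {b : U}
    (hb : 0 ≤ b) (hb₀ : b ≠ 0) :
    ∃ φ ∈ Set.extremePoints ℝ (Metric.closedBall (0 : StrongDual ℂ U) 1),
      φ 1 = 1 ∧ φ b = ‖b‖ := by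
  obtain ⟨φ, hφ, hval⟩ := exists_mem_extremePoints_closedBall_dual (b + ‖b‖ • (1 : U))
  refine ⟨φ, hφ, ?_⟩
  have hφ₁ : ‖φ‖ ≤ 1 := mem_closedBall_zero_iff.1 hφ.1
  have hpos : 0 < ‖b‖ := norm_pos_iff.2 hb₀
  have hb₁ : ‖φ b‖ ≤ ‖b‖ := by simpa using φ.le_of_opNorm_le hφ₁ b
  have h₁ : ‖φ 1‖ ≤ 1 := by
    simpa using (φ.le_of_opNorm_le hφ₁ 1).trans (by simpa using norm_one_le_one U)
  have hsum : φ b + ‖b‖ * φ 1 = 2 * ‖b‖ := by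
    rw [norm_add_norm_smul_one_of_nonneg hb, ← Complex.coe_smul, map_add, map_smul,
      smul_eq_mul] at hval
    exact_mod_cast hval
  have hre : (φ b).re + ‖b‖ * (φ 1).re = 2 * ‖b‖ := by
    simpa using congrArg Complex.re hsum
  have hre₁ : (φ 1).re = 1 := by
    nlinarith [Complex.re_le_norm (φ b), Complex.re_le_norm (φ 1)]
  have hone : φ 1 = 1 := by
    have hnorm : φ 1 = ‖φ 1‖ := RCLike.norm_le_re_iff_eq_norm.1 (h₁.trans hre₁.ge)
    rw [hnorm, le_antisymm h₁ (hre₁ ▸ Complex.re_le_norm _), Complex.ofReal_one]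
  refine ⟨hone, ?_⟩
  linear_combination hsum - ‖b‖ * hone

theorem im_apply_eq_zero_of_isSelfAdjoint {φ : StrongDual ℂ U} (hφ : ‖φ‖ ≤ 1) (h1 : φ 1 = 1)
    {h : U} (hh : IsSelfAdjoint h) : (φ h).im = 0 := by
  have hnorm (s : ℝ) : ‖h + (s * Complex.I) • (1 : U)‖ ^ 2 ≤ ‖h‖ ^ 2 + s ^ 2 := by
    have hmul : star (h + (s * Complex.I) • (1 : U)) * (h + (s * Complex.I) • (1 : U)) =
        h * h + ((s : ℂ) ^ 2) • (1 : U) := by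
      have hI : (s : ℂ) * -Complex.I * (s * Complex.I) = (s : ℂ) ^ 2 := by
        linear_combination -(s : ℂ) ^ 2 * Complex.I_sq
      simp only [star_add, hh.star_eq, star_smul, star_one, star_mul', RCLike.star_def,
        Complex.conj_I, Complex.conj_ofReal, add_mul, mul_add, smul_mul_assoc, mul_smul_comm,
        mul_one, one_mul, smul_smul, smul_add, ← hI]
      module
    rw [sq, ← CStarRing.norm_star_mul_self, hmul, sq ‖h‖]
    refine (norm_add_le _ _).trans (add_le_add (norm_mul_le h h) ?_)
    rw [norm_smul, norm_pow, Complex.norm_real, Real.norm_eq_abs, sq_abs]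
    exact mul_le_of_le_one_right (sq_nonneg s) (norm_one_le_one U)
  have hbound (s : ℝ) : ((φ h).im + s) ^ 2 ≤ ‖h‖ ^ 2 + s ^ 2 := by
    have hval : φ (h + (s * Complex.I) • (1 : U)) = φ h + s * Complex.I := by simp [h1]
    have him : |(φ h).im + s| ≤ ‖h + (s * Complex.I) • (1 : U)‖ := calc
      |(φ h).im + s| ≤ ‖φ h + s * Complex.I‖ := by
        simpa using Complex.abs_im_le_norm (φ h + s * Complex.I)
      _ ≤ ‖h + (s * Complex.I) • (1 : U)‖ := by
        simpa [hval] using φ.le_of_opNorm_le hφ (h + (s * Complex.I) • (1 : U))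
    rw [← sq_abs]
    exact (by gcongr : _ ≤ _).trans (hnorm s)
  by_contra hne
  have hs := hbound ((‖h‖ ^ 2 + 1) / (2 * (φ h).im))
  have hcross : 2 * (φ h).im * ((‖h‖ ^ 2 + 1) / (2 * (φ h).im)) = ‖h‖ ^ 2 + 1 :=
    mul_div_cancel₀ _ (mul_ne_zero two_ne_zero hne)
  rw [add_sq, hcross] at hs
  linarith [sq_nonneg (φ h).im]

theorem re_apply_nonneg {φ : StrongDual ℂ U} (hφ : ‖φ‖ ≤ 1) (h1 : φ 1 = 1)
    [PartialOrder U] [StarOrderedRing U] {x : U} (hx : 0 ≤ x) : 0 ≤ (φ x).re := by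
  have hnorm : ‖algebraMap ℝ U ‖x‖ - x‖ ≤ ‖x‖ := by
    rw [CStarAlgebra.norm_le_iff_le_algebraMap _ (norm_nonneg _)
      (sub_nonneg.2 (IsSelfAdjoint.of_nonneg hx).le_algebraMap_norm_self)]
    simpa using hx
  have hval : φ (algebraMap ℝ U ‖x‖ - x) = ‖x‖ - φ x := by
    rw [map_sub, Algebra.algebraMap_eq_smul_one, ← Complex.coe_smul, map_smul, h1, smul_eq_mul,
      mul_one]
  have hre : ‖x‖ - (φ x).re ≤ ‖x‖ := calc
    ‖x‖ - (φ x).re = (φ (algebraMap ℝ U ‖x‖ - x)).re := by simp [hval]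
    _ ≤ ‖φ (algebraMap ℝ U ‖x‖ - x)‖ := Complex.re_le_norm _
    _ ≤ 1 * ‖algebraMap ℝ U ‖x‖ - x‖ := φ.le_of_opNorm_le hφ _
    _ ≤ ‖x‖ := by rwa [one_mul]
  linarith

end States

section GNS

variable {U : Type u} [CStarAlgebra U] [PartialOrder U] [StarOrderedRing U]

/-- A state, that is, a contractive functional with value `1` at `1`, as a positive functional. -/
noncomputable def positiveOfState (φ : StrongDual ℂ U) (hφ : ‖φ‖ ≤ 1) (h1 : φ 1 = 1) : U →ₚ[ℂ] ℂ :=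
  PositiveLinearMap.mk₀ φ.toLinearMap fun _ hx => Complex.nonneg_iff.2
    ⟨re_apply_nonneg hφ h1 hx,
      (im_apply_eq_zero_of_isSelfAdjoint hφ h1 (IsSelfAdjoint.of_nonneg hx)).symm⟩

variable (f : U →ₚ[ℂ] ℂ)

/-- The canonical cyclic vector of the GNS representation. -/
noncomputable def gnsVector : f.GNS := ((f.toPreGNS 1 : f.PreGNS) : f.GNS)

theorem gns_apply_gnsVector (a : U) :
    f.gnsNonUnitalStarAlgHom a (gnsVector f) = ((f.toPreGNS a : f.PreGNS) : f.GNS) := by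
  simp [gnsVector, PositiveLinearMap.gnsNonUnitalStarAlgHom_apply_coe]

theorem inner_gnsVector_gns_apply_gnsVector (a : U) :
    ⟪gnsVector f, f.gnsNonUnitalStarAlgHom a (gnsVector f)⟫_ℂ = f a := by
  rw [gns_apply_gnsVector, gnsVector, UniformSpace.Completion.inner_coe,
    PositiveLinearMap.preGNS_inner_def]
  simp

theorem gns_one : f.gnsNonUnitalStarAlgHom 1 = 1 := f.gnsStarAlgHom.map_one'

theorem eq_zero_of_forall_inner_gns_apply_gnsVector {v : f.GNS}
    (h : ∀ a, ⟪v, f.gnsNonUnitalStarAlgHom a (gnsVector f)⟫_ℂ = 0) : v = 0 := by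
  refine ext_inner_right ℂ fun x => ?_
  rw [inner_zero_left]
  induction x using UniformSpace.Completion.induction_on with
  | hp => exact isClosed_eq (by fun_prop) continuous_const
  | ih x => simpa [gns_apply_gnsVector] using h (f.ofPreGNS x)

theorem eq_top_of_gnsVector_mem {K : Submodule ℂ f.GNS} (hK : IsClosed (K : Set f.GNS))
    (hinv : ∀ a, ∀ v ∈ K, f.gnsNonUnitalStarAlgHom a v ∈ K) (hξ : gnsVector f ∈ K) : K = ⊤ := by
  refine (Submodule.eq_top_iff' (p := K)).2 fun x => ?_
  induction x using UniformSpace.Completion.induction_on with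
  | hp => exact hK
  | ih x => simpa [gns_apply_gnsVector] using hinv (f.ofPreGNS x) _ hξ

end GNS

section Irreducible

/-- The functional `a ↦ ⟪v, π a v⟫` defined by a vector `v`. -/
noncomputable def vectorFunctional {A H : Type*} [NonUnitalCStarAlgebra A] [NormedAddCommGroup H]
    [InnerProductSpace ℂ H] [CompleteSpace H] (π : A →⋆ₙₐ[ℂ] (H →L[ℂ] H)) (v : H) :
    StrongDual ℂ A :=
  LinearMap.mkContinuous
    { toFun := fun a => ⟪v, π a v⟫_ℂ
      map_add' := fun a b => by rw [map_add, add_apply, inner_add_right]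
      map_smul' := fun c a => by rw [map_smul, smul_apply, inner_smul_right]; rfl }
    (‖v‖ ^ 2) fun a => calc
      ‖⟪v, π a v⟫_ℂ‖ ≤ ‖v‖ * ‖π a v‖ := norm_inner_le_norm _ _
      _ ≤ ‖v‖ * (‖a‖ * ‖v‖) := by
        gcongr
        exact (π a).le_of_opNorm_le (NonUnitalStarAlgHom.norm_apply_le π a) v
      _ = ‖v‖ ^ 2 * ‖a‖ := by ring

theorem vectorFunctional_apply {A H : Type*} [NonUnitalCStarAlgebra A] [NormedAddCommGroup H]
    [InnerProductSpace ℂ H] [CompleteSpace H] (π : A →⋆ₙₐ[ℂ] (H →L[ℂ] H)) (v : H) (a : A) :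
    vectorFunctional π v a = ⟪v, π a v⟫_ℂ := rfl

theorem norm_vectorFunctional_le {A H : Type*} [NonUnitalCStarAlgebra A] [NormedAddCommGroup H]
    [InnerProductSpace ℂ H] [CompleteSpace H] (π : A →⋆ₙₐ[ℂ] (H →L[ℂ] H)) (v : H) :
    ‖vectorFunctional π v‖ ≤ ‖v‖ ^ 2 :=
  LinearMap.mkContinuous_norm_le _ (sq_nonneg _) _

theorem eq_smul_of_mem_extremePoints_closedBall {E : Type*} [NormedAddCommGroup E]
    [NormedSpace ℝ E] {x y z : E} (hx : x ∈ Set.extremePoints ℝ (Metric.closedBall (0 : E) 1))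
    (hxyz : x = y + z) {s t : ℝ} (hy : ‖y‖ ≤ s) (hz : ‖z‖ ≤ t) (hst : s + t = 1) :
    y = s • x := by
  rcases ((norm_nonneg y).trans hy).eq_or_lt with rfl | hs
  · rw [norm_le_zero_iff.1 hy, zero_smul]
  rcases ((norm_nonneg z).trans hz).eq_or_lt with rfl | ht
  · rw [hxyz, norm_le_zero_iff.1 hz, add_zero, (add_zero s).symm.trans hst, one_smul]
  have hball : ∀ {r : ℝ} {w : E}, 0 < r → ‖w‖ ≤ r → r⁻¹ • w ∈ Metric.closedBall (0 : E) 1 :=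
    fun {r w} hr hw => by
      rw [mem_closedBall_zero_iff, norm_smul, norm_inv, Real.norm_of_nonneg hr.le]
      exact inv_mul_le_one_of_le₀ hw hr.le
  have hseg : x ∈ openSegment ℝ (s⁻¹ • y) (t⁻¹ • z) :=
    ⟨s, t, hs, ht, hst, by rw [smul_inv_smul₀ hs.ne', smul_inv_smul₀ ht.ne', hxyz]⟩
  rw [← hx.2 (hball hs hy) (hball ht hz) hseg, smul_inv_smul₀ hs.ne']

theorem apply_mem_orthogonal_of_invariant {A H : Type*} [NonUnitalNonAssocSemiring A] [Star A]
    [DistribMulAction ℂ A] [NormedAddCommGroup H] [InnerProductSpace ℂ H] [CompleteSpace H]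
    (π : A →⋆ₙₐ[ℂ] (H →L[ℂ] H)) {K : Submodule ℂ H} (hinv : ∀ a, ∀ v ∈ K, π a v ∈ K) (a : A)
    {v : H} (hv : v ∈ Kᗮ) : π a v ∈ Kᗮ := by
  refine (Submodule.mem_orthogonal K _).2 fun u hu => ?_
  rw [← ContinuousLinearMap.adjoint_inner_left, ← ContinuousLinearMap.star_eq_adjoint, ← map_star]
  exact Submodule.inner_right_of_mem_orthogonal (hinv _ u hu) hv

variable {U : Type u} [CStarAlgebra U] [PartialOrder U] [StarOrderedRing U] (f : U →ₚ[ℂ] ℂ)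

/-- Both components of the cyclic vector along `K` and `Kᗮ` define multiples of the pure state, so
the cyclic vector lies in `K` or in `Kᗮ`. -/
theorem eq_bot_or_eq_top_of_mem_extremePoints {φ : StrongDual ℂ U}
    (hφ : φ ∈ Set.extremePoints ℝ (Metric.closedBall (0 : StrongDual ℂ U) 1)) (h1 : φ 1 = 1)
    (hf : ∀ a, f a = φ a) {K : Submodule ℂ f.GNS} (hK : IsClosed (K : Set f.GNS))
    (hinv : ∀ a, ∀ v ∈ K, f.gnsNonUnitalStarAlgHom a v ∈ K) : K = ⊥ ∨ K = ⊤ := by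
  have : CompleteSpace K := hK.completeSpace_coe
  set π := f.gnsNonUnitalStarAlgHom
  set ξ := gnsVector f with hξ
  obtain ⟨x, hx, y, hy, hxy⟩ := K.exists_add_mem_mem_orthogonal ξ
  have hsplit (a : U) : φ a = ⟪x, π a x⟫_ℂ + ⟪y, π a y⟫_ℂ := by
    rw [← hf, ← inner_gnsVector_gns_apply_gnsVector, ← hξ, hxy, map_add, inner_add_left,
      inner_add_right, inner_add_right,
      Submodule.inner_right_of_mem_orthogonal hx (apply_mem_orthogonal_of_invariant π hinv a hy),
      Submodule.inner_left_of_mem_orthogonal (hinv a x hx) hy]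
    ring
  have hnorm : ‖x‖ ^ 2 + ‖y‖ ^ 2 = 1 := by
    have h := hsplit 1
    rw [h1, gns_one, one_apply_eq_self, one_apply_eq_self, inner_self_eq_norm_sq_to_K,
      inner_self_eq_norm_sq_to_K] at h
    exact Complex.ofReal_injective (by simpa using h.symm)
  have hωx : vectorFunctional π x = ‖x‖ ^ 2 • φ :=
    eq_smul_of_mem_extremePoints_closedBall hφ (ContinuousLinearMap.ext hsplit)
      (norm_vectorFunctional_le π x) (norm_vectorFunctional_le π y) hnorm
  have hxξ : x = ((‖x‖ ^ 2 : ℝ) : ℂ) • ξ := by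
    refine sub_eq_zero.1 (eq_zero_of_forall_inner_gns_apply_gnsVector f fun a => ?_)
    have hxa : ⟪x, π a ξ⟫_ℂ = ((‖x‖ ^ 2 : ℝ) : ℂ) * φ a := calc
      ⟪x, π a ξ⟫_ℂ = ⟪x, π a x⟫_ℂ := by
        rw [hxy, map_add, inner_add_right, Submodule.inner_right_of_mem_orthogonal hx
          (apply_mem_orthogonal_of_invariant π hinv a hy), add_zero]
      _ = ((‖x‖ ^ 2 : ℝ) : ℂ) * φ a := by
        rw [← vectorFunctional_apply, hωx, smul_apply, Complex.real_smul]
    rw [inner_sub_left, inner_smul_left, Complex.conj_ofReal, inner_gnsVector_gns_apply_gnsVector,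
      hf, ← hξ, hxa, sub_self]
  rcases eq_or_ne x 0 with hx₀ | hx₀
  · refine Or.inl ((Submodule.eq_bot_iff K).2 fun v hv =>
      eq_zero_of_forall_inner_gns_apply_gnsVector f fun a => ?_)
    rw [← hξ, hxy, hx₀, zero_add]
    exact Submodule.inner_right_of_mem_orthogonal hv (apply_mem_orthogonal_of_invariant π hinv a hy)
  · refine Or.inr (eq_top_of_gnsVector_mem f hK hinv ?_)
    rwa [hxξ, Submodule.smul_mem_iff K (by simpa using hx₀)] at hx

theorem exists_isIrreducibleRep_apply_ne_zero {A : Type u} [NonUnitalCStarAlgebra A] {a : A}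
    (ha : a ≠ 0) : ∃ (H : Type u) (_ : NormedAddCommGroup H) (_ : InnerProductSpace ℂ H)
      (_ : CompleteSpace H) (π : A →⋆ₙₐ[ℂ] (H →L[ℂ] H)), IsIrreducibleRep π ∧ π a ≠ 0 := by
  let V := Unitization ℂ A
  let _ : PartialOrder V := CStarAlgebra.spectralOrder V
  let _ : StarOrderedRing V := CStarAlgebra.spectralOrderedRing V
  let c : V := (a : Unitization ℂ A)
  have hc : star c * c ≠ 0 := by
    rw [Ne, CStarRing.star_mul_self_eq_zero_iff]
    exact fun h => ha (Unitization.inr_injective (h.trans (Unitization.inr_zero ℂ).symm))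
  obtain ⟨φ, hφ, h1, hφc⟩ :=
    exists_extreme_map_one_eq_one_map_eq_norm (star_mul_self_nonneg c) hc
  let f := positiveOfState φ (mem_closedBall_zero_iff.1 hφ.1) h1
  let π := f.gnsNonUnitalStarAlgHom.comp (Unitization.inrNonUnitalStarAlgHom ℂ A)
  have hπa : π a ≠ 0 := fun h => by
    have hzero : f (star c * c) = 0 := by
      rw [← inner_gnsVector_gns_apply_gnsVector, map_mul,
        show f.gnsNonUnitalStarAlgHom c = 0 from h, mul_zero, zero_apply, inner_zero_right]
    exact hc (norm_eq_zero.1 (Complex.ofReal_eq_zero.1 (hφc.symm.trans hzero)))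
  refine ⟨f.GNS, _, _, inferInstance, π, ⟨fun h => hπa (by rw [h]; rfl), fun K hK hinv => ?_⟩, hπa⟩
  refine eq_bot_or_eq_top_of_mem_extremePoints f hφ h1 (fun _ => rfl) hK fun u v hv => ?_
  have hu : u = u.fst • (1 : V) + ((u.snd : A) : Unitization ℂ A) := by
    ext <;> simp [V]
  rw [hu, map_add, map_smul, gns_one]
  exact K.add_mem (K.smul_mem _ hv) (hinv _ _ hv)

end Irreducible

end PureStates

/-! ### Burnside's theorem -/

section Burnside

open Module

variable {k V : Type*} [Field k] [IsAlgClosed k] [AddCommGroup V] [Module k V]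
  [FiniteDimensional k V]

theorem adjoin_eq_top_of_irreducible [Nontrivial V] (S : Set (End k V))
    (hirr : ∀ K : Submodule k V, (∀ f ∈ S, ∀ v ∈ K, f v ∈ K) → K = ⊥ ∨ K = ⊤) :
    Algebra.adjoin k S = ⊤ := by
  set R := Algebra.adjoin k S
  have hsimple : IsSimpleModule R V :=
    { eq_bot_or_eq_top := fun K => by
        simpa using hirr (K.restrictScalars k) fun f hf v hv =>
          K.smul_mem (⟨f, Algebra.subset_adjoin hf⟩ : R) hv }
  refine Algebra.eq_top_iff.2 fun T => ?_
  let T' : End (End R V) V :=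
    { toFun := T
      map_add' := map_add T
      map_smul' := fun g x => by
        obtain ⟨c, rfl⟩ := (IsSimpleModule.algebraMap_end_bijective_of_isAlgClosed k).2 g
        exact map_smul T c x }
  classical
  let b := Module.finBasis k V
  obtain ⟨r, hr⟩ := jacobson_density (R := R) T' (Finset.univ.image b)
  have hT : T = r := b.ext fun i => hr (b i) (Finset.mem_image_of_mem b (Finset.mem_univ i))
  exact hT ▸ r.2

/-- Burnside's theorem, for algebras which are not assumed to contain the identity: such an algebra
is a nonzero ideal in its unitization, which is a simple ring. -/
theorem eq_top_of_irreducible (S : NonUnitalSubalgebra k (End k V)) (hS : S ≠ ⊥)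
    (hirr : ∀ K : Submodule k V, (∀ f ∈ S, ∀ v ∈ K, f v ∈ K) → K = ⊥ ∨ K = ⊤) : S = ⊤ := by
  obtain ⟨P, hP, hP₀⟩ : ∃ P ∈ S, P ≠ 0 := by
    by_contra! h
    exact hS (eq_bot_iff.2 fun x hx => NonUnitalAlgebra.mem_bot.2 (h x hx))
  have : Nontrivial V := by
    by_contra h
    have := not_nontrivial_iff_subsingleton.1 h
    exact hP₀ (Subsingleton.elim P 0)
  have hscalar (X : End k V) : ∃ (r : k) (Y : S), algebraMap k (End k V) r + Y = X := by
    have hX : X ∈ (NonUnitalSubalgebra.unitization S).range := by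
      rw [NonUnitalSubalgebra.unitization_range, adjoin_eq_top_of_irreducible _ hirr]
      exact Algebra.mem_top
    obtain ⟨u, rfl⟩ := hX
    exact ⟨u.fst, u.snd, rfl⟩
  let I : TwoSidedIdeal (End k V) := .mk' S S.zero_mem S.add_mem S.neg_mem
    (fun {X Y} hY => by
      obtain ⟨r, Z, rfl⟩ := hscalar X
      rw [add_mul, ← Algebra.smul_def]
      exact S.add_mem (S.smul_mem r hY) (S.mul_mem Z.2 hY))
    (fun {Y X} hY => by
      obtain ⟨r, Z, rfl⟩ := hscalar X
      rw [mul_add, ← Algebra.commutes, ← Algebra.smul_def]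
      exact S.add_mem (S.smul_mem r hY) (S.mul_mem hY Z.2))
  have hI (X : End k V) : X ∈ I ↔ X ∈ S := TwoSidedIdeal.mem_mk' ..
  have : Nonempty (Fin (finrank k V)) := ⟨⟨0, finrank_pos⟩⟩
  have : IsSimpleRing (End k V) :=
    .of_ringEquiv (algEquivMatrix (Module.finBasis k V)).symm.toRingEquiv inferInstance
  have h1 : (1 : End k V) ∈ I := IsSimpleRing.one_mem_of_ne_zero_mem I hP₀ ((hI P).2 hP)
  refine eq_top_iff.2 fun X _ => (hI X).1 ?_
  simpa using I.mul_mem_left X 1 h1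

end Burnside

/-! ### Truncation by functional calculus -/

section Truncation

open scoped CStarAlgebra

variable {A B : Type*} [NonUnitalCStarAlgebra A] [NonUnitalCStarAlgebra B]

theorem mem_Icc_of_mem_quasispectrum_star_mul_self {a : A} {x : ℝ}
    (hx : x ∈ quasispectrum ℝ (star a * a)) : x ∈ Set.Icc 0 (‖a‖ ^ 2) := by
  let _ := CStarAlgebra.spectralOrder A
  let _ := CStarAlgebra.spectralOrderedRing A
  refine ⟨quasispectrum_nonneg_of_nonneg _ (star_mul_self_nonneg a) x hx, ?_⟩
  have hnorm := NonUnitalIsometricContinuousFunctionalCalculus.norm_quasispectrum_le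
    (𝕜 := ℝ) (star a * a) hx (IsSelfAdjoint.star_mul_self a)
  rw [CStarRing.norm_star_mul_self, ← sq] at hnorm
  exact (le_abs_self x).trans hnorm

theorem star_mul_self_sub_mul_cfcₙ {f : ℝ → ℝ} (hf : Continuous f) (hf₀ : f 0 = 0) (a : A) :
    star (a - a * cfcₙ f (star a * a)) * (a - a * cfcₙ f (star a * a)) =
      cfcₙ (fun t => t * (1 - f t) ^ 2) (star a * a) := by
  set x := star a * a with hx
  have hk : star (cfcₙ f x) = cfcₙ f x := (cfcₙ_predicate f x : IsSelfAdjoint _)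
  have hfun : (fun t => t * (1 - f t) ^ 2) =
      fun t => t - f t * t - (t * f t - f t * (t * f t)) := by
    ext t
    ring
  rw [hfun, cfcₙ_sub (fun t => t - f t * t) _ x, cfcₙ_sub (fun t => t) _ x,
    cfcₙ_sub (fun t => t * f t) _ x, cfcₙ_mul f (fun t => t) x, cfcₙ_mul f (fun t => t * f t) x,
    cfcₙ_mul (fun t => t) f x, cfcₙ_id' ℝ x, star_sub, star_mul, hk, hx]
  noncomm_ring

/-- The function used to cut off the part of an element of norm larger than `r`. -/
noncomputable def truncFun (r x : ℝ) : ℝ := 1 - r / max r (Real.sqrt x)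

theorem truncFun_of_sqrt_le {r x : ℝ} (hr : 0 < r) (hx : Real.sqrt x ≤ r) : truncFun r x = 0 := by
  rw [truncFun, max_eq_left hx, div_self hr.ne', sub_self]

theorem truncFun_zero {r : ℝ} (hr : 0 < r) : truncFun r 0 = 0 :=
  truncFun_of_sqrt_le hr (by simpa using hr.le)

theorem continuous_truncFun {r : ℝ} (hr : 0 < r) : Continuous (truncFun r) :=
  continuous_const.sub (continuous_const.div (by fun_prop) fun _ => (lt_max_of_lt_left hr).ne')

theorem mul_one_sub_truncFun_sq_le {r x : ℝ} (hr : 0 < r) (hx : 0 ≤ x) :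
    x * (1 - truncFun r x) ^ 2 ≤ r ^ 2 := by
  have hle : x ≤ max r (Real.sqrt x) ^ 2 := calc
    x = Real.sqrt x ^ 2 := (Real.sq_sqrt hx).symm
    _ ≤ max r (Real.sqrt x) ^ 2 := by gcongr; exact le_max_right _ _
  rw [truncFun, sub_sub_cancel, div_pow, mul_div_assoc', div_le_iff₀ (by positivity), mul_comm]
  gcongr

/-- The element `k` with `‖a - a k‖ ≤ r` which vanishes if `‖a‖ ≤ r`. It is used to detect the
points where `a` has norm `> r` by an element which is nonzero there. -/
noncomputable def truncElem (r : ℝ) (a : A) : A := cfcₙ (truncFun r) (star a * a)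

theorem truncElem_eq_zero {r : ℝ} (hr : 0 < r) {a : A} (ha : ‖a‖ ≤ r) : truncElem r a = 0 := by
  rw [truncElem, ← cfcₙ_zero ℝ (star a * a)]
  refine cfcₙ_congr fun x hx => truncFun_of_sqrt_le hr ?_
  exact (Real.sqrt_le_left hr.le).2
    ((mem_Icc_of_mem_quasispectrum_star_mul_self hx).2.trans (by gcongr))

theorem norm_sub_mul_truncElem_le {r : ℝ} (hr : 0 < r) (a : A) :
    ‖a - a * truncElem r a‖ ≤ r := by
  refine (sq_le_sq₀ (norm_nonneg _) hr.le).1 ?_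
  rw [sq, ← CStarRing.norm_star_mul_self, truncElem,
    star_mul_self_sub_mul_cfcₙ (continuous_truncFun hr) (truncFun_zero hr)]
  refine norm_cfcₙ_le fun t ht => ?_
  have ht₀ := (mem_Icc_of_mem_quasispectrum_star_mul_self ht).1
  rw [Real.norm_of_nonneg (by positivity)]
  exact mul_one_sub_truncFun_sq_le hr ht₀

theorem map_truncElem (φ : A →⋆ₙₐ[ℂ] B) {r : ℝ} (hr : 0 < r) (a : A) :
    φ (truncElem r a) = truncElem r (φ a) := by
  rw [truncElem, truncElem, φ.map_cfcₙ (truncFun r) (star a * a)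
    (continuous_truncFun hr).continuousOn (truncFun_zero hr) (map_continuous φ)
    (IsSelfAdjoint.star_mul_self a) ((IsSelfAdjoint.star_mul_self a).map φ), map_mul, map_star]

theorem map_truncElem_eq_zero_iff (φ : A →⋆ₙₐ[ℂ] B) {r : ℝ} (hr : 0 < r) (a : A) :
    φ (truncElem r a) = 0 ↔ ‖φ a‖ ≤ r := by
  refine ⟨fun h => ?_, fun h => by rw [map_truncElem φ hr, truncElem_eq_zero hr h]⟩
  have hφa : φ a = φ (a - a * truncElem r a) := by rw [map_sub, map_mul, h, mul_zero, sub_zero]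
  exact hφa ▸ (NonUnitalStarAlgHom.norm_apply_le φ _).trans (norm_sub_mul_truncElem_le hr a)

theorem exists_map_eq_norm_le (φ : A →⋆ₙₐ[ℂ] B) (a : A) : ∃ a', φ a' = φ a ∧ ‖a'‖ ≤ ‖φ a‖ := by
  rcases eq_or_ne (φ a) 0 with h | h
  · exact ⟨0, by rw [h, map_zero], by simp⟩
  · have hr : 0 < ‖φ a‖ := norm_pos_iff.2 h
    refine ⟨a - a * truncElem ‖φ a‖ a, ?_, norm_sub_mul_truncElem_le hr a⟩
    rw [map_sub, map_mul, (map_truncElem_eq_zero_iff φ hr a).2 le_rfl, mul_zero, sub_zero]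

end Truncation

/-! ### Coordinates with respect to a frame -/

section Coordinates

open scoped Matrix.Norms.L2Operator

open PrimitiveIdeal

variable {n : ℕ} {A : Type u} [NonUnitalCStarAlgebra A]

namespace PrimitiveIdeal

theorem value_add (t : PrimitiveIdeal A) (a b : A) : value (a + b) t = value a t + value b t := rfl

theorem value_sub (t : PrimitiveIdeal A) (a b : A) : value (a - b) t = value a t - value b t := rfl

theorem value_smul (t : PrimitiveIdeal A) (c : ℂ) (a : A) : value (c • a) t = c • value a t := rfl

theorem value_zero (t : PrimitiveIdeal A) : value (0 : A) t = 0 := rfl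

theorem value_surjective (t : PrimitiveIdeal A) : Function.Surjective fun a : A => value a t :=
  Submodule.mkQ_surjective _

theorem value_eq_zero_iff (t : PrimitiveIdeal A) (a : A) : value a t = 0 ↔ a ∈ t.toSubmodule :=
  Submodule.Quotient.mk_eq_zero _

@[ext]
theorem ext {s t : PrimitiveIdeal A} (h : ∀ a, a ∈ s.toSubmodule ↔ a ∈ t.toSubmodule) : s = t := by
  cases s
  cases t
  simp only [mk.injEq]
  exact Submodule.ext h

theorem isOpen_setOf_notMem (a : A) : IsOpen {t : PrimitiveIdeal A | a ∉ t.toSubmodule} :=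
  TopologicalSpace.isOpen_generateFrom_of_mem ⟨a, rfl⟩

end PrimitiveIdeal

namespace FrameSpace

/-- The representation of `A` on `ℂⁿ` given by a frame. -/
noncomputable def coord (w : FrameSpace n A) : A →⋆ₙₐ[ℂ] Mat n where
  toFun a := w.frame.symm (value a w.base)
  map_smul' c a := by rw [value_smul, map_smul]; rfl
  map_zero' := by rw [value_zero, map_zero]
  map_add' a b := by rw [value_add, map_add]
  map_mul' a b := by rw [value_mul, map_mul]
  map_star' a := by rw [value_star, map_star]

theorem coord_def (w : FrameSpace n A) (a : A) : w.coord a = w.frame.symm (value a w.base) := rfl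

theorem frame_coord (w : FrameSpace n A) (a : A) : w.frame (w.coord a) = value a w.base :=
  w.frame.apply_symm_apply _

theorem coord_surjective (w : FrameSpace n A) : Function.Surjective w.coord :=
  (EquivLike.surjective w.frame.symm).comp (value_surjective w.base)

theorem coord_eq_zero_iff (w : FrameSpace n A) (a : A) :
    w.coord a = 0 ↔ a ∈ w.base.toSubmodule := by
  rw [← value_eq_zero_iff, coord_def, map_eq_zero_iff _ (EquivLike.injective w.frame.symm)]

theorem coord_smul (w : FrameSpace n A) (g : AutMat n) (a : A) :
    (MulOpposite.op g • w).coord a = g.symm (w.coord a) := rfl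

theorem base_smul (w : FrameSpace n A) (g : AutMat n) : (MulOpposite.op g • w).base = w.base := rfl

theorem ext_coord {w w' : FrameSpace n A} (h : ∀ a, w.coord a = w'.coord a) : w = w' := by
  obtain ⟨t, φ⟩ := w
  obtain ⟨s, ψ⟩ := w'
  obtain rfl : t = s := by
    ext a
    rw [← coord_eq_zero_iff ⟨t, φ⟩, ← coord_eq_zero_iff ⟨s, ψ⟩, h]
  have hsymm : φ.symm = ψ.symm := by
    refine StarAlgEquiv.ext fun y => ?_
    obtain ⟨a, rfl⟩ := value_surjective t y
    exact h a
  rw [← StarAlgEquiv.symm_symm φ, hsymm, StarAlgEquiv.symm_symm]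

/-- The automorphism `g` with `w' = w · g`, for two frames at the same point. -/
noncomputable def diff (w w' : FrameSpace n A) (h : w.base = w'.base) : AutMat n :=
  (h ▸ w'.frame : Mat n ≃⋆ₐ[ℂ] Fibre w.base).trans w.frame.symm

theorem diff_coord (w w' : FrameSpace n A) (h : w.base = w'.base) (a : A) :
    diff w w' h (w'.coord a) = w.coord a := by
  obtain ⟨t, φ⟩ := w
  obtain ⟨s, ψ⟩ := w'
  obtain rfl : t = s := h
  change φ.symm (ψ (ψ.symm (value a t))) = φ.symm (value a t)
  rw [StarAlgEquiv.apply_symm_apply]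

theorem smul_diff (w w' : FrameSpace n A) (h : w.base = w'.base) :
    MulOpposite.op (diff w w' h) • w = w' :=
  ext_coord fun a => by
    rw [coord_smul, ← diff_coord w w' h]
    exact StarAlgEquiv.symm_apply_apply _ _

theorem diff_eq_of_smul {w w' : FrameSpace n A} (h : w.base = w'.base) {g : AutMat n}
    (hg : MulOpposite.op g • w = w') : diff w w' h = g := by
  refine StarAlgEquiv.ext fun x => ?_
  obtain ⟨a, rfl⟩ := w'.coord_surjective x
  rw [diff_coord, ← hg, coord_smul]
  exact (StarAlgEquiv.apply_symm_apply _ _).symm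

theorem norm_value (w : FrameSpace n A) (a : A) : ‖value a w.base‖ = ‖w.coord a‖ := by
  apply le_antisymm
  · obtain ⟨a', ha', hnorm⟩ := exists_map_eq_norm_le w.coord a
    have hvalue : value a' w.base = value a w.base := by rw [← frame_coord, ha', frame_coord]
    rw [← hvalue]
    exact (QuotientAddGroup.norm_mk_le_norm (S := w.base.toSubmodule.toAddSubgroup)).trans hnorm
  · refine le_of_forall_pos_lt_add fun ε hε => ?_
    obtain ⟨a', ha', hnorm⟩ := QuotientAddGroup.norm_lt_iff.1
      (show ‖(value a w.base : A ⧸ w.base.toSubmodule.toAddSubgroup)‖ < ‖value a w.base‖ + ε from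
        lt_add_of_pos_right _ hε)
    have hcoord : w.coord a' = w.coord a := congrArg w.frame.symm ha'
    exact hcoord ▸ (NonUnitalStarAlgHom.norm_apply_le _ _).trans_lt hnorm

theorem norm_frame (w : FrameSpace n A) (x : Mat n) : ‖w.frame x‖ = ‖x‖ := by
  obtain ⟨a, rfl⟩ := w.coord_surjective x
  rw [frame_coord, norm_value]

end FrameSpace

theorem AutMat.norm_map (g : AutMat n) (x : Mat n) : ‖g x‖ = ‖x‖ :=
  NonUnitalStarAlgHom.norm_map g g.injective x

end Coordinates

/-! ### Frames and representations on `ℂⁿ` -/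

section Representations

open scoped Matrix.Norms.L2Operator InnerProductSpace

open PrimitiveIdeal

variable {n : ℕ} {A : Type u} [NonUnitalCStarAlgebra A]

section Irreducible

variable {H : Type u} [NormedAddCommGroup H] [InnerProductSpace ℂ H] [CompleteSpace H]

/-- The restriction of a representation to a closed invariant subspace. -/
noncomputable def restrictRep (π : A →⋆ₙₐ[ℂ] (H →L[ℂ] H)) (K : Submodule ℂ H) [CompleteSpace K]
    (hinv : ∀ a, ∀ v ∈ K, π a v ∈ K) : A →⋆ₙₐ[ℂ] (K →L[ℂ] K) where
  toFun a := ((π a).comp K.subtypeL).codRestrict K fun v => hinv a v v.2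
  map_smul' c a := by
    ext v
    exact DFunLike.congr_fun (map_smul π c a) (v : H)
  map_zero' := by
    ext v
    exact DFunLike.congr_fun (map_zero π) (v : H)
  map_add' a b := by
    ext v
    exact DFunLike.congr_fun (map_add π a b) (v : H)
  map_mul' a b := by
    ext v
    exact DFunLike.congr_fun (map_mul π a b) (v : H)
  map_star' a := by
    rw [ContinuousLinearMap.star_eq_adjoint, ContinuousLinearMap.eq_adjoint_iff]
    intro x y
    change ⟪π (star a) x, (y : H)⟫_ℂ = ⟪(x : H), π a y⟫_ℂ
    rw [map_star, ContinuousLinearMap.star_eq_adjoint, ContinuousLinearMap.adjoint_inner_left]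

theorem isIrreducibleRep_or_exists_restrictRep_ne_zero [FiniteDimensional ℂ H]
    {π : A →⋆ₙₐ[ℂ] (H →L[ℂ] H)} (hπ : ∃ a, π a ≠ 0) :
    IsIrreducibleRep π ∨ ∃ (K : Submodule ℂ H) (hinv : ∀ a, ∀ v ∈ K, π a v ∈ K),
      K ≠ ⊤ ∧ ∃ a, restrictRep π K hinv a ≠ 0 := by
  obtain ⟨a, ha⟩ := hπ
  refine or_iff_not_imp_right.2 fun h => ⟨fun hπ => ha (by rw [hπ]; rfl), fun K _ hinv => ?_⟩
  push Not at h
  have hzero (L : Submodule ℂ H) (hL : ∀ a, ∀ v ∈ L, π a v ∈ L) (hL' : L ≠ ⊤) (v : H)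
      (hv : v ∈ L) : π a v = 0 :=
    congrArg Subtype.val (DFunLike.congr_fun (h L hL hL' a) (⟨v, hv⟩ : L))
  by_contra! hK
  refine ha (ContinuousLinearMap.ext fun v => ?_)
  obtain ⟨x, hx, y, hy, rfl⟩ := K.exists_add_mem_mem_orthogonal v
  rw [map_add, hzero K hinv hK.2 x hx,
    hzero Kᗮ (fun b _ => apply_mem_orthogonal_of_invariant π hinv b)
      (mt (Submodule.orthogonal_eq_top_iff K).1 hK.1) y hy, add_zero, zero_apply]

theorem IsHomogeneous.le_finrank (hA : IsHomogeneous n A) [FiniteDimensional ℂ H]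
    {π : A →⋆ₙₐ[ℂ] (H →L[ℂ] H)} (hπ : ∃ a, π a ≠ 0) : n ≤ Module.finrank ℂ H := by
  induction hd : Module.finrank ℂ H using Nat.strong_induction_on generalizing H with
  | _ d ih =>
    subst hd
    obtain hirr | ⟨K, hinv, hK, hne⟩ := isIrreducibleRep_or_exists_restrictRep_ne_zero hπ
    · exact (hA H π hirr).ge
    · have hlt := Submodule.finrank_lt hK
      exact (ih _ hlt hne rfl).trans hlt.le

theorem IsHomogeneous.isIrreducibleRep (hA : IsHomogeneous n A) [FiniteDimensional ℂ H]
    (hH : Module.finrank ℂ H = n) {π : A →⋆ₙₐ[ℂ] (H →L[ℂ] H)} (hπ : ∃ a, π a ≠ 0) :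
    IsIrreducibleRep π :=
  (isIrreducibleRep_or_exists_restrictRep_ne_zero hπ).resolve_right fun ⟨_, _, hK, hne⟩ =>
    ((Submodule.finrank_lt hK).trans_eq hH).not_ge (hA.le_finrank hne)

theorem IsIrreducibleRep.surjective [FiniteDimensional ℂ H] {π : A →⋆ₙₐ[ℂ] (H →L[ℂ] H)}
    (hπ : IsIrreducibleRep π) : Function.Surjective π := by
  let ρ : A →ₙₐ[ℂ] Module.End ℂ H :=
    { toFun := fun a => (π a : H →ₗ[ℂ] H)
      map_smul' := fun c a => by simp
      map_zero' := by simp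
      map_add' := fun a b => by simp
      map_mul' := fun a b => by simp }
  have hρ : NonUnitalAlgHom.range ρ ≠ ⊥ := fun h => hπ.1 <| NonUnitalStarAlgHom.ext fun a =>
    ContinuousLinearMap.coe_injective <|
      NonUnitalAlgebra.mem_bot.1 (h ▸ NonUnitalAlgHom.mem_range_self ρ a)
  have htop := eq_top_of_irreducible _ hρ fun K hK =>
    hπ.2 K (Submodule.closed_of_finiteDimensional K) fun a =>
      hK _ (NonUnitalAlgHom.mem_range_self ρ a)
  intro T
  have hT : (T : H →ₗ[ℂ] H) ∈ NonUnitalAlgHom.range ρ := htop ▸ NonUnitalAlgebra.mem_top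
  obtain ⟨a, ha⟩ := (NonUnitalAlgHom.mem_range ρ).1 hT
  exact ⟨a, ContinuousLinearMap.coe_injective ha⟩

end Irreducible

/-- The matrices as operators on a Hilbert space with an orthonormal basis. -/
noncomputable def matrixToOperator {H : Type*} [NormedAddCommGroup H] [InnerProductSpace ℂ H]
    [FiniteDimensional ℂ H] [CompleteSpace H] (b : OrthonormalBasis (Fin n) ℂ H) :
    Mat n ≃⋆ₐ[ℂ] (H →L[ℂ] H) :=
  (LinearMap.toMatrixOrthonormal b).symm.trans
    { LinearMap.toContinuousLinearMap with
      map_mul' := fun _ _ => rfl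
      map_star' := LinearMap.adjoint_toContinuousLinearMap }

/-- The frame at `t` given by a homomorphism of `A` onto `M_n` with kernel `t`. -/
noncomputable def FrameSpace.ofHom (t : PrimitiveIdeal A) (ρ : A →⋆ₙₐ[ℂ] Mat n)
    (hs : Function.Surjective ρ) (hk : ∀ a, a ∈ t.toSubmodule ↔ ρ a = 0) : FrameSpace n A where
  base := t
  frame := StarAlgEquiv.symm
    { toFun := t.toSubmodule.liftQ (ρ : A →ₗ[ℂ] Mat n) fun a ha => (hk a).1 ha
      invFun := fun x => value (Function.surjInv hs x) t
      left_inv := fun y => by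
        obtain ⟨a, rfl⟩ := value_surjective t y
        change value (Function.surjInv hs (ρ a)) t = value a t
        rw [← sub_eq_zero, ← value_sub, value_eq_zero_iff, hk, map_sub, Function.surjInv_eq hs,
          sub_self]
      right_inv := fun x => Function.surjInv_eq hs x
      map_mul' := fun x y => by
        obtain ⟨a, rfl⟩ := value_surjective t x
        obtain ⟨b, rfl⟩ := value_surjective t y
        exact map_mul ρ a b
      map_add' := map_add _
      map_star' := fun x => by
        obtain ⟨a, rfl⟩ := value_surjective t x
        exact map_star ρ a
      map_smul' := map_smul _ }

theorem IsHomogeneous.exists_base_eq (hn : 1 ≤ n) (hA : IsHomogeneous n A) (t : PrimitiveIdeal A) :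
    ∃ w : FrameSpace n A, w.base = t := by
  obtain ⟨H, _, _, _, π, hπ, hk⟩ := t.exists_rep
  have hH := hA H π hπ
  have : FiniteDimensional ℂ H := Module.finite_of_finrank_pos (by lia)
  let b : OrthonormalBasis (Fin n) ℂ H := (stdOrthonormalBasis ℂ H).reindex (finCongr hH)
  let M := (matrixToOperator b).symm
  let ρ : A →⋆ₙₐ[ℂ] Mat n := (M : (H →L[ℂ] H) →⋆ₙₐ[ℂ] Mat n).comp π
  refine ⟨FrameSpace.ofHom t ρ ((EquivLike.surjective M).comp hπ.surjective) fun a => ?_, rfl⟩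
  rw [hk]
  exact (map_eq_zero_iff M (EquivLike.injective M)).symm

theorem IsHomogeneous.exists_coord_eq (hA : IsHomogeneous n A) (ρ : A →⋆ₙₐ[ℂ] Mat n)
    (hρ : ∃ a, ρ a ≠ 0) : ∃ w : FrameSpace n A, w.coord = ρ := by
  let H := EuclideanSpace ℂ (ULift.{u} (Fin n))
  let b : OrthonormalBasis (Fin n) ℂ H :=
    (EuclideanSpace.basisFun (ULift.{u} (Fin n)) ℂ).reindex Equiv.ulift
  let M := matrixToOperator b
  let π : A →⋆ₙₐ[ℂ] (H →L[ℂ] H) := (M : Mat n →⋆ₙₐ[ℂ] (H →L[ℂ] H)).comp ρ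
  have hπ (a : A) : π a = 0 ↔ ρ a = 0 := map_eq_zero_iff M (EquivLike.injective M)
  have hirr : IsIrreducibleRep π :=
    hA.isIrreducibleRep (by simp [H]) (hρ.imp fun a => (hπ a).not.2)
  have hs : Function.Surjective ρ := fun x => by
    obtain ⟨a, ha⟩ := hirr.surjective (M x)
    exact ⟨a, EquivLike.injective M ha⟩
  let t : PrimitiveIdeal A :=
    { toSubmodule := LinearMap.ker (ρ : A →ₗ[ℂ] Mat n)
      exists_rep := ⟨H, _, _, _, π, hirr, fun a => (hπ a).symm⟩ }
  exact ⟨FrameSpace.ofHom t ρ hs fun a => LinearMap.mem_ker, rfl⟩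

end Representations

/-! ### The topology of the frame space and of the primitive ideal space -/

section FrameTopology

open scoped Matrix.Norms.L2Operator

open PrimitiveIdeal Filter

variable {n : ℕ} {A : Type u} [NonUnitalCStarAlgebra A]

theorem mul_single_one_mul_apply {m R : Type*} [Fintype m] [DecidableEq m] [NonAssocSemiring R]
    (x y : Matrix m m R) (i j k l : m) :
    (x * Matrix.single j k (1 : R) * y) i l = x i j * y k l := by
  rw [Matrix.mul_apply, Finset.sum_eq_single k]
  · rw [Matrix.mul_single_apply_same, mul_one]
  · intro m _ hm
    rw [Matrix.mul_single_apply_of_ne (hbj := hm), zero_mul]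
  · exact fun h => absurd (Finset.mem_univ k) h

namespace FrameSpace

theorem continuous_toBundle (x : Mat n) : Continuous fun w : FrameSpace n A => w.toBundle x :=
  (continuous_apply x).comp
    (continuous_induced_dom (f := fun (w : FrameSpace n A) (x : Mat n) => w.toBundle x))

theorem continuous_coord (a : A) : Continuous fun w : FrameSpace n A => w.coord a := by
  rw [continuous_iff_continuousAt]
  intro w
  rw [ContinuousAt, Metric.tendsto_nhds]
  intro ε hε
  have hopen : IsOpen (BundleSpace.tube a Set.univ ε) :=
    TopologicalSpace.isOpen_generateFrom_of_mem ⟨a, Set.univ, ε, isOpen_univ, hε, rfl⟩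
  have hmem : w.toBundle (w.coord a) ∈ BundleSpace.tube a Set.univ ε := by
    refine ⟨trivial, ?_⟩
    change ‖w.frame (w.coord a) - value a w.base‖ < ε
    rwa [frame_coord, sub_self, norm_zero]
  filter_upwards [(continuous_toBundle (w.coord a)).continuousAt.preimage_mem_nhds
    (hopen.mem_nhds hmem)] with v hv
  have hlt : ‖v.frame (w.coord a) - value a v.base‖ < ε := hv.2
  rw [← frame_coord, ← map_sub, norm_frame] at hlt
  rwa [dist_comm, dist_eq_norm]

theorem continuous_base_of_continuous_coord {τ : TopologicalSpace (FrameSpace n A)}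
    (h : ∀ a : A, Continuous fun w : FrameSpace n A => w.coord a) :
    Continuous (FrameSpace.base : FrameSpace n A → PrimitiveIdeal A) := by
  rw [continuous_generateFrom_iff]
  rintro _ ⟨a, rfl⟩
  have hpre : FrameSpace.base ⁻¹' {t : PrimitiveIdeal A | a ∉ t.toSubmodule} =
      (fun w : FrameSpace n A => w.coord a) ⁻¹' {0}ᶜ :=
    Set.ext fun w => (coord_eq_zero_iff w a).not.symm
  rw [hpre]
  exact isOpen_compl_singleton.preimage (h a)

theorem continuous_base : Continuous (FrameSpace.base : FrameSpace n A → PrimitiveIdeal A) :=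
  continuous_base_of_continuous_coord continuous_coord

theorem isInducing_coord : IsInducing fun (w : FrameSpace n A) (a : A) => w.coord a := by
  refine ⟨le_antisymm (continuous_pi continuous_coord).le_induced ?_⟩
  let τ : TopologicalSpace (FrameSpace n A) :=
    TopologicalSpace.induced (fun (w : FrameSpace n A) (a : A) => w.coord a) inferInstance
  have hc (a : A) : @Continuous _ _ τ _ fun w : FrameSpace n A => w.coord a :=
    (continuous_apply a).comp continuous_induced_dom
  refine continuous_iff_le_induced.1 (continuous_pi fun x => ?_)
  rw [continuous_generateFrom_iff]
  rintro _ ⟨a, U, ε, hU, -, rfl⟩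
  have hpre : (fun w : FrameSpace n A => w.toBundle x) ⁻¹' BundleSpace.tube a U ε =
      FrameSpace.base ⁻¹' U ∩ (fun w : FrameSpace n A => ‖x - w.coord a‖) ⁻¹' Set.Iio ε := by
    ext w
    change (w.base ∈ U ∧ ‖w.frame x - value a w.base‖ < ε) ↔ w.base ∈ U ∧ ‖x - w.coord a‖ < ε
    rw [← frame_coord, ← map_sub, norm_frame]
  rw [hpre]
  exact (hU.preimage (continuous_base_of_continuous_coord hc)).inter
    (isOpen_Iio.preimage (continuous_const.sub (hc a)).norm)

theorem tendsto_nhds_iff {ι : Type*} {l : Filter ι} {f : ι → FrameSpace n A} {w : FrameSpace n A} :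
    Tendsto f l (𝓝 w) ↔ ∀ a, Tendsto (fun i => (f i).coord a) l (𝓝 (w.coord a)) := by
  rw [isInducing_coord.tendsto_nhds_iff, tendsto_pi_nhds]
  rfl

end FrameSpace

namespace AutMat

theorem tendsto_nhds_iff {ι : Type*} {l : Filter ι} {f : ι → AutMat n} {g : AutMat n} :
    Tendsto f l (𝓝 g) ↔ ∀ x, Tendsto (fun i => f i x) l (𝓝 (g x)) := by
  have hind : IsInducing fun (g : AutMat n) (x : Mat n) => g x := ⟨rfl⟩
  rw [hind.tendsto_nhds_iff, tendsto_pi_nhds]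
  rfl

theorem tendsto_symm_apply {ι : Type*} {l : Filter ι} {f : ι → AutMat n} {g : AutMat n}
    (hf : Tendsto f l (𝓝 g)) {x : ι → Mat n} {x₀ : Mat n} (hx : Tendsto x l (𝓝 x₀)) :
    Tendsto (fun i => (f i).symm (x i)) l (𝓝 (g.symm x₀)) := by
  have hfx := tendsto_nhds_iff.1 hf (g.symm x₀)
  rw [StarAlgEquiv.apply_symm_apply] at hfx
  rw [tendsto_iff_dist_tendsto_zero]
  refine (tendsto_iff_dist_tendsto_zero.1 (hx.dist hfx)).congr fun i => ?_
  rw [dist_self, Real.dist_0_eq_abs, abs_of_nonneg dist_nonneg, dist_eq_norm, dist_eq_norm,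
    ← norm_map (f i) ((f i).symm (x i) - g.symm x₀), map_sub, StarAlgEquiv.apply_symm_apply]

end AutMat

namespace FrameSpace

theorem tendsto_smul {ι : Type*} {l : Filter ι} {f : ι → AutMat n} {g : AutMat n}
    (hf : Tendsto f l (𝓝 g)) {w : ι → FrameSpace n A} {w₀ : FrameSpace n A}
    (hw : Tendsto w l (𝓝 w₀)) :
    Tendsto (fun i => MulOpposite.op (f i) • w i) l (𝓝 (MulOpposite.op g • w₀)) :=
  tendsto_nhds_iff.2 fun a => AutMat.tendsto_symm_apply hf (tendsto_nhds_iff.1 hw a)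

theorem tendsto_of_smul_eq {ι : Type*} {l : Filter ι} {w w' : ι → FrameSpace n A}
    {w₀ w₀' : FrameSpace n A} {g : ι → AutMat n} {g₀ : AutMat n} (hw : Tendsto w l (𝓝 w₀))
    (hw' : Tendsto w' l (𝓝 w₀')) (h : ∀ᶠ i in l, MulOpposite.op (g i) • w i = w' i)
    (h₀ : MulOpposite.op g₀ • w₀ = w₀') : Tendsto g l (𝓝 g₀) := by
  rw [AutMat.tendsto_nhds_iff]
  intro x
  obtain ⟨a, rfl⟩ := w₀'.coord_surjective x
  have happly {v v' : FrameSpace n A} {k : AutMat n} (hk : MulOpposite.op k • v = v') :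
      k (v'.coord a) = v.coord a := by
    rw [← hk, coord_smul, StarAlgEquiv.apply_symm_apply]
  have hdiff : Tendsto (fun i => g i (w₀'.coord a - (w' i).coord a)) l (𝓝 0) := by
    rw [tendsto_zero_iff_norm_tendsto_zero]
    simp only [AutMat.norm_map]
    rw [← tendsto_zero_iff_norm_tendsto_zero, ← sub_self (w₀'.coord a)]
    exact tendsto_const_nhds.sub (tendsto_nhds_iff.1 hw' a)
  have hsum := hdiff.add (tendsto_nhds_iff.1 hw a)
  rw [zero_add, ← happly h₀] at hsum
  refine hsum.congr' (h.mono fun i hi => ?_)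
  rw [map_sub, happly hi, sub_add_cancel]

theorem exists_ultralimit {ι : Type*} (𝒰 : Ultrafilter ι) (w : ι → FrameSpace n A) :
    ∃ ρ : A →⋆ₙₐ[ℂ] Mat n, ∀ a, Tendsto (fun i => (w i).coord a) 𝒰 (𝓝 (ρ a)) := by
  have hlim (a : A) : ∃ x : Mat n, Tendsto (fun i => (w i).coord a) 𝒰 (𝓝 x) := by
    have : ProperSpace (Mat n) := FiniteDimensional.proper ℂ (Mat n)
    have hball : ∀ᶠ x in (𝒰.map fun i => (w i).coord a : Filter (Mat n)),
        x ∈ Metric.closedBall 0 ‖a‖ :=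
      eventually_map.2 (Eventually.of_forall fun i =>
        mem_closedBall_zero_iff.2 (NonUnitalStarAlgHom.norm_apply_le (w i).coord a))
    obtain ⟨x, -, hx⟩ := (isCompact_closedBall (0 : Mat n) ‖a‖).ultrafilter_le_nhds _
      (le_principal_iff.2 hball)
    exact ⟨x, hx⟩
  choose ρ hρ using hlim
  refine ⟨{ toFun := ρ
            map_smul' := fun c a => tendsto_nhds_unique (hρ (c • a)) ?_
            map_zero' := tendsto_nhds_unique (hρ 0) ?_
            map_add' := fun a b => tendsto_nhds_unique (hρ (a + b)) ?_
            map_mul' := fun a b => tendsto_nhds_unique (hρ (a * b)) ?_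
            map_star' := fun a => tendsto_nhds_unique (hρ (star a)) ?_ }, hρ⟩
  · simpa only [map_smul, MonoidHom.id_apply] using (hρ a).const_smul c
  · simp only [map_zero, tendsto_const_nhds]
  · simpa only [map_add] using (hρ a).add (hρ b)
  · simpa only [map_mul] using (hρ a).mul (hρ b)
  · simpa only [map_star] using (hρ a).star

theorem base_eq_of_le {w w' : FrameSpace n A} (h : w.base.toSubmodule ≤ w'.base.toSubmodule) :
    w.base = w'.base := by
  let φ : A →ₗ[ℂ] Mat n := w.coord
  let ψ : A →ₗ[ℂ] Mat n := w'.coord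
  have hle : LinearMap.ker φ ≤ LinearMap.ker ψ := fun x hx =>
    (coord_eq_zero_iff w' x).2 (h ((coord_eq_zero_iff w x).1 hx))
  let e := φ.quotKerEquivOfSurjective w.coord_surjective
  let F : Mat n →ₗ[ℂ] Mat n := ((LinearMap.ker φ).liftQ ψ hle).comp e.symm.toLinearMap
  have hF (x : A) : F (φ x) = ψ x :=
    congrArg ((LinearMap.ker φ).liftQ ψ hle) (e.symm_apply_apply (Submodule.Quotient.mk x))
  have hsurj : Function.Surjective F := fun y => by
    obtain ⟨x, rfl⟩ := w'.coord_surjective y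
    exact ⟨φ x, hF x⟩
  refine PrimitiveIdeal.ext fun a => ⟨fun ha => h ha, fun ha => ?_⟩
  rw [← coord_eq_zero_iff] at ha ⊢
  exact (map_eq_zero_iff F (LinearMap.injective_iff_surjective.2 hsurj)).1 ((hF a).trans ha)

end FrameSpace

theorem eq_of_forall_value {a b : A} (h : ∀ t : PrimitiveIdeal A, value a t = value b t) :
    a = b := by
  rw [← sub_eq_zero]
  by_contra hne
  obtain ⟨H, _, _, _, π, hπ, hπa⟩ := exists_isIrreducibleRep_apply_ne_zero hne
  let t : PrimitiveIdeal A :=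
    { toSubmodule := LinearMap.ker (π : A →ₗ[ℂ] (H →L[ℂ] H))
      exists_rep := ⟨H, _, _, _, π, hπ, fun _ => LinearMap.mem_ker⟩ }
  refine hπa ((value_eq_zero_iff t (a - b)).1 ?_)
  rw [value_sub, h, sub_self]

variable (hn : 1 ≤ n) (hA : IsHomogeneous n A)

include hn hA

theorem norm_value_pos_iff (t : PrimitiveIdeal A) (a : A) :
    0 < ‖value a t‖ ↔ a ∉ t.toSubmodule := by
  obtain ⟨w, rfl⟩ := hA.exists_base_eq hn t
  rw [FrameSpace.norm_value, norm_pos_iff, ne_eq, FrameSpace.coord_eq_zero_iff]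

theorem isOpen_lt_norm_value (a : A) {r : ℝ} (hr : 0 < r) :
    IsOpen {t : PrimitiveIdeal A | r < ‖value a t‖} := by
  have htrunc : {t : PrimitiveIdeal A | r < ‖value a t‖} =
      {t | truncElem r a ∉ t.toSubmodule} := by
    ext t
    obtain ⟨w, rfl⟩ := hA.exists_base_eq hn t
    change r < ‖value a w.base‖ ↔ truncElem r a ∉ w.base.toSubmodule
    rw [FrameSpace.norm_value, ← FrameSpace.coord_eq_zero_iff, map_truncElem_eq_zero_iff _ hr,
      not_le]
  rw [htrunc]
  exact isOpen_setOf_notMem _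

theorem exists_notMem (t : PrimitiveIdeal A) : ∃ a, a ∉ t.toSubmodule := by
  obtain ⟨w, rfl⟩ := hA.exists_base_eq hn t
  have : Nonempty (Fin n) := ⟨⟨0, hn⟩⟩
  obtain ⟨a, ha⟩ := w.coord_surjective 1
  exact ⟨a, by rw [← FrameSpace.coord_eq_zero_iff, ha]; exact one_ne_zero⟩

theorem FrameSpace.exists_tendsto {ι : Type*} (𝒰 : Ultrafilter ι) (w : ι → FrameSpace n A)
    {t : PrimitiveIdeal A} (h : Tendsto (fun i => (w i).base) 𝒰 (𝓝 t)) :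
    ∃ w₀ : FrameSpace n A, w₀.base = t ∧ Tendsto w 𝒰 (𝓝 w₀) := by
  obtain ⟨ρ, hρ⟩ := exists_ultralimit 𝒰 w
  have hker (b : A) (hb : ρ b = 0) : b ∈ t.toSubmodule := by
    by_contra hbt
    have hpos := (norm_value_pos_iff hn hA t b).2 hbt
    have hlarge : ∀ᶠ i in (𝒰 : Filter ι), ‖value b t‖ / 2 < ‖(w i).coord b‖ := by
      filter_upwards [h.eventually ((isOpen_lt_norm_value hn hA b (half_pos hpos)).mem_nhds
        (half_lt_self hpos : ‖value b t‖ / 2 < ‖value b t‖))] with i hi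
      exact (norm_value (w i) b) ▸ hi
    have hsmall := (hρ b).norm
    rw [hb, norm_zero] at hsmall
    linarith [ge_of_tendsto hsmall (hlarge.mono fun i hi => hi.le)]
  obtain ⟨a₀, ha₀⟩ := exists_notMem hn hA t
  obtain ⟨w₁, hw₁⟩ := hA.exists_coord_eq ρ ⟨a₀, fun h => ha₀ (hker _ h)⟩
  subst hw₁
  obtain ⟨w₂, rfl⟩ := hA.exists_base_eq hn t
  exact ⟨w₁, base_eq_of_le fun b hb => hker b ((coord_eq_zero_iff w₁ b).2 hb),
    tendsto_nhds_iff.2 hρ⟩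

theorem continuous_norm_value (a : A) : Continuous fun t : PrimitiveIdeal A => ‖value a t‖ := by
  rw [continuous_iff_ultrafilter]
  intro t 𝒰 h𝒰
  choose w hw using hA.exists_base_eq hn
  obtain ⟨w₀, rfl, hw₀⟩ := FrameSpace.exists_tendsto hn hA 𝒰 w (t := t) <| by
    simp only [hw]
    exact h𝒰
  have hcoord (s : PrimitiveIdeal A) : ‖value a s‖ = ‖(w s).coord a‖ := by
    rw [← FrameSpace.norm_value, hw]
  rw [FrameSpace.norm_value, funext hcoord]
  exact (FrameSpace.tendsto_nhds_iff.1 hw₀ a).norm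

theorem isCompact_le_norm_value (a : A) {ε : ℝ} (hε : 0 < ε) :
    IsCompact {t : PrimitiveIdeal A | ε ≤ ‖value a t‖} := by
  rw [isCompact_iff_ultrafilter_le_nhds]
  intro 𝒰 h𝒰
  rw [le_principal_iff] at h𝒰
  choose w hw using hA.exists_base_eq hn
  obtain ⟨ρ, hρ⟩ := FrameSpace.exists_ultralimit 𝒰 w
  have hle : ε ≤ ‖ρ a‖ := by
    refine ge_of_tendsto (hρ a).norm ?_
    filter_upwards [h𝒰] with t ht
    rw [← FrameSpace.norm_value, hw]
    exact ht
  obtain ⟨w₀, rfl⟩ := hA.exists_coord_eq ρ ⟨a, norm_pos_iff.1 (hε.trans_le hle)⟩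
  refine ⟨w₀.base, hle.trans_eq (w₀.norm_value a).symm, ?_⟩
  have hbase := (FrameSpace.continuous_base.tendsto w₀).comp (FrameSpace.tendsto_nhds_iff.2 hρ)
  rwa [show FrameSpace.base ∘ w = id from funext hw, tendsto_id'] at hbase

theorem exists_mul_mul_notMem (t : PrimitiveIdeal A) {a b : A} (ha : a ∉ t.toSubmodule)
    (hb : b ∉ t.toSubmodule) : ∃ x, a * x * b ∉ t.toSubmodule := by
  obtain ⟨w, rfl⟩ := hA.exists_base_eq hn t
  rw [← FrameSpace.coord_eq_zero_iff] at ha hb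
  obtain ⟨i, j, hij⟩ : ∃ i j, w.coord a i j ≠ 0 := by
    by_contra! h
    exact ha (Matrix.ext h)
  obtain ⟨k, l, hkl⟩ : ∃ k l, w.coord b k l ≠ 0 := by
    by_contra! h
    exact hb (Matrix.ext h)
  obtain ⟨x, hx⟩ := w.coord_surjective (Matrix.single j k 1)
  refine ⟨x, fun h => mul_ne_zero hij hkl ?_⟩
  rw [← FrameSpace.coord_eq_zero_iff, map_mul, map_mul, hx] at h
  rw [← mul_single_one_mul_apply, h, Matrix.zero_apply]

theorem exists_notMem_of_isOpen {V : Set (PrimitiveIdeal A)} (hV : IsOpen V)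
    {t : PrimitiveIdeal A} (ht : t ∈ V) :
    ∃ c, c ∉ t.toSubmodule ∧ ∀ s ∉ V, c ∈ s.toSubmodule := by
  induction hV with
  | basic U hU =>
    obtain ⟨a, rfl⟩ := hU
    exact ⟨a, ht, fun s hs => not_not.1 hs⟩
  | univ =>
    obtain ⟨a, ha⟩ := exists_notMem hn hA t
    exact ⟨a, ha, fun s hs => absurd trivial hs⟩
  | inter U V _ _ hU hV =>
    obtain ⟨c, hc, hc'⟩ := hU ht.1
    obtain ⟨d, hd, hd'⟩ := hV ht.2
    obtain ⟨x, hx⟩ := exists_mul_mul_notMem hn hA t hc hd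
    refine ⟨c * x * d, hx, fun s hs => ?_⟩
    by_cases h : s ∈ U
    · exact s.mul_mem_left _ (hd' s fun h' => hs ⟨h, h'⟩)
    · exact s.mul_mem_right _ (s.mul_mem_right _ (hc' s h))
  | sUnion S _ hS =>
    obtain ⟨U, hU, htU⟩ := ht
    obtain ⟨c, hc, hc'⟩ := hS U hU htU
    exact ⟨c, hc, fun s hs => hc' s fun h => hs ⟨U, hU, h⟩⟩

/-- The ideals are maximal, because their quotients all have the same finite dimension. -/
theorem IsHomogeneous.t1Space : T1Space (PrimitiveIdeal A) := by
  refine ⟨fun t => ⟨isOpen_iff_forall_mem_open.2 fun s hs => ?_⟩⟩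
  obtain ⟨b, hbt, hbs⟩ : ∃ b ∈ t.toSubmodule, b ∉ s.toSubmodule := by
    by_contra! h
    obtain ⟨w, rfl⟩ := hA.exists_base_eq hn t
    obtain ⟨v, rfl⟩ := hA.exists_base_eq hn s
    exact hs (FrameSpace.base_eq_of_le h).symm
  refine ⟨{r | b ∉ r.toSubmodule}, ?_, isOpen_setOf_notMem b, hbs⟩
  rintro r hr rfl
  exact hr hbt

theorem eq_of_forall_coord {a b : A} (h : ∀ w : FrameSpace n A, w.coord a = w.coord b) :
    a = b := by
  refine eq_of_forall_value fun t => ?_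
  obtain ⟨w, rfl⟩ := hA.exists_base_eq hn t
  rw [← FrameSpace.frame_coord, h, FrameSpace.frame_coord]

theorem norm_le_of_forall_coord {a : A} {r : ℝ} (hr : 0 < r)
    (h : ∀ w : FrameSpace n A, ‖w.coord a‖ ≤ r) : ‖a‖ ≤ r := by
  have hzero : truncElem r a = 0 := eq_of_forall_coord hn hA fun w => by
    rw [map_zero, map_truncElem_eq_zero_iff _ hr]
    exact h w
  simpa only [hzero, mul_zero, sub_zero] using norm_sub_mul_truncElem_le hr a

theorem norm_le_of_forall_value {a : A} {r : ℝ} (hr : 0 < r)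
    (h : ∀ t : PrimitiveIdeal A, ‖value a t‖ ≤ r) : ‖a‖ ≤ r :=
  norm_le_of_forall_coord hn hA hr fun w => (w.norm_value a).symm.trans_le (h _)

end FrameTopology

/-! ### Orthogonal families and central elements -/

section Central

open scoped Matrix.Norms.L2Operator CStarAlgebra

open PrimitiveIdeal Filter

variable {n : ℕ}

theorem exists_unit_eigenvector {p : Mat n} (hs : p.IsHermitian) (h0 : p ≠ 0) :
    ∃ (v : Fin n → ℂ) (c : ℂ), c ≠ 0 ∧ star v ⬝ᵥ v = 1 ∧ p.mulVec v = c • v := by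
  obtain ⟨i, hi⟩ := Function.ne_iff.1 (hs.eigenvalues_eq_zero_iff.not.2 h0)
  refine ⟨(hs.eigenvectorBasis i).ofLp, (hs.eigenvalues i : ℂ), Complex.ofReal_ne_zero.2 hi, ?_,
    hs.mulVec_eigenvectorBasis i⟩
  rw [dotProduct_comm, ← EuclideanSpace.inner_eq_star_dotProduct,
    inner_self_eq_norm_sq_to_K, hs.eigenvectorBasis.norm_eq_one]
  norm_num

theorem exists_unitary_mul_eq_mul_single {p : Fin n → Mat n} (hs : ∀ i, star (p i) = p i)
    (ho : ∀ i j, i ≠ j → p i * p j = 0) (h0 : ∀ i, p i ≠ 0) :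
    ∃ (U : unitary (Mat n)) (c : Fin n → ℂ), (∀ i, c i ≠ 0) ∧
      ∀ i, p i * (U : Mat n) = U * Matrix.single i i (c i) := by
  choose v c hc hv hp using fun i => exists_unit_eigenvector (hs i) (h0 i)
  have hpv (i j : Fin n) (hij : i ≠ j) : (p i).mulVec (v j) = 0 := by
    have h : (p i).mulVec ((p j).mulVec (v j)) = 0 := by
      rw [Matrix.mulVec_mulVec, ho i j hij, Matrix.zero_mulVec]
    rw [hp, Matrix.mulVec_smul] at h
    exact (smul_eq_zero.1 h).resolve_left (hc j)
  have hort (i j : Fin n) (hij : i ≠ j) : star (v i) ⬝ᵥ v j = 0 := by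
    have h : star ((p j).mulVec (v i)) ⬝ᵥ v j = star (v i) ⬝ᵥ (p j).mulVec (v j) := by
      rw [Matrix.star_mulVec, ← Matrix.dotProduct_mulVec, ← Matrix.star_eq_conjTranspose, hs]
    rw [hpv j i hij.symm, hp, star_zero, zero_dotProduct, dotProduct_smul] at h
    exact (smul_eq_zero.1 h.symm).resolve_left (hc j)
  let U : Mat n := Matrix.of fun k i => v i k
  have hU : U ∈ Matrix.unitaryGroup (Fin n) ℂ := by
    refine Matrix.mem_unitaryGroup_iff'.2 (Matrix.ext fun i j => ?_)
    change star (v i) ⬝ᵥ v j = (1 : Mat n) i j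
    obtain rfl | hij := eq_or_ne i j
    · rw [hv, Matrix.one_apply_eq]
    · rw [hort i j hij, Matrix.one_apply_ne hij]
  refine ⟨⟨U, hU⟩, c, hc, fun i => Matrix.ext fun k j => ?_⟩
  change (p i).mulVec (v j) k = _
  obtain rfl | hij := eq_or_ne i j
  · rw [hp, Matrix.mul_single_apply_same, Pi.smul_apply, smul_eq_mul, mul_comm]
    rfl
  · rw [hpv i j hij, Matrix.mul_single_apply_of_ne (hbj := hij.symm), Pi.zero_apply]

theorem exists_aut_of_orthogonal {p : Fin n → Mat n} (hs : ∀ i, star (p i) = p i)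
    (ho : ∀ i j, i ≠ j → p i * p j = 0) (h0 : ∀ i, p i ≠ 0) :
    ∃ (g : AutMat n) (c : Fin n → ℂ), (∀ i, c i ≠ 0) ∧
      ∀ i, g.symm (p i) = Matrix.single i i (c i) := by
  obtain ⟨U, c, hc, hU⟩ := exists_unitary_mul_eq_mul_single hs ho h0
  let g : AutMat n := Unitary.conjStarAlgAut ℂ (Mat n) U
  have hg (i : Fin n) : g (Matrix.single i i (c i)) = p i := by
    change (U : Mat n) * Matrix.single i i (c i) * star (U : Mat n) = p i
    rw [← hU, mul_assoc, Unitary.mul_star_self_of_mem U.2, mul_one]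
  exact ⟨g, c, hc, fun i => by rw [← hg, StarAlgEquiv.symm_apply_apply]⟩

/-- A bump function supported in the interval of length one around `i + 1`. -/
noncomputable def bumpFun (i : ℕ) (x : ℝ) : ℝ := max 0 (1 - 2 * |x - (i + 1)|)

theorem continuous_bumpFun (i : ℕ) : Continuous (bumpFun i) := by
  unfold bumpFun
  fun_prop

theorem abs_sub_lt_of_bumpFun_ne_zero {i : ℕ} {x : ℝ} (h : bumpFun i x ≠ 0) :
    |x - (i + 1)| < 1 / 2 := by
  by_contra! hc
  exact h (max_eq_left (by linarith))

theorem bumpFun_zero (i : ℕ) : bumpFun i 0 = 0 := by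
  by_contra h
  have hi := (abs_lt.1 (abs_sub_lt_of_bumpFun_ne_zero h)).1
  have : (0 : ℝ) ≤ i := i.cast_nonneg
  linarith

theorem bumpFun_self (i : ℕ) : bumpFun i (i + 1) = 1 := by simp [bumpFun]

theorem bumpFun_mul_bumpFun {i j : ℕ} (hij : i ≠ j) (x : ℝ) : bumpFun i x * bumpFun j x = 0 := by
  by_contra h
  have hi := abs_lt.1 (abs_sub_lt_of_bumpFun_ne_zero (left_ne_zero_of_mul h))
  have hj := abs_lt.1 (abs_sub_lt_of_bumpFun_ne_zero (right_ne_zero_of_mul h))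
  have hlt : (i : ℝ) < j + 1 := by linarith
  have hgt : (j : ℝ) < i + 1 := by linarith
  norm_cast at hlt hgt
  lia

/-- The function `bumpFun i` of a self-adjoint element. -/
noncomputable def bump {A : Type*} [NonUnitalCStarAlgebra A] (i : ℕ) (h : A) : A :=
  cfcₙ (bumpFun i) h

section Bump

variable {A : Type*} [NonUnitalCStarAlgebra A]

theorem star_bump (i : ℕ) (h : A) : star (bump i h) = bump i h :=
  (cfcₙ_predicate (bumpFun i) h : IsSelfAdjoint _).star_eq

theorem bump_mul_bump (h : A) {i j : ℕ} (hij : i ≠ j) : bump i h * bump j h = 0 := by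
  rw [bump, bump, ← cfcₙ_mul (bumpFun i) (bumpFun j) h (continuous_bumpFun i).continuousOn
    (bumpFun_zero i) (continuous_bumpFun j).continuousOn (bumpFun_zero j)]
  simp only [bumpFun_mul_bumpFun hij]
  exact cfcₙ_const_zero ℝ h

theorem map_bump {B : Type*} [NonUnitalCStarAlgebra B] (φ : A →⋆ₙₐ[ℂ] B) (i : ℕ) {h : A}
    (hh : IsSelfAdjoint h) : φ (bump i h) = bump i (φ h) :=
  φ.map_cfcₙ (bumpFun i) h (continuous_bumpFun i).continuousOn (bumpFun_zero i)
    (map_continuous φ) hh (hh.map φ)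

theorem bump_ne_zero {i : ℕ} {h : Mat n} (hh : IsSelfAdjoint h)
    (hi : ((i : ℝ) + 1) ∈ spectrum ℝ h) : bump i h ≠ 0 := by
  intro h0
  rw [bump, cfcₙ_eq_cfc (continuous_bumpFun i).continuousOn (bumpFun_zero i)] at h0
  have hspec := cfc_map_spectrum (bumpFun i) h hh (continuous_bumpFun i).continuousOn
  have hone : (1 : ℝ) ∈ spectrum ℝ (0 : Mat n) := by
    rw [← h0, hspec]
    exact ⟨_, hi, bumpFun_self i⟩
  obtain _ | _ := subsingleton_or_nontrivial (Mat n)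
  · rwa [spectrum.of_subsingleton] at hone
  · rw [spectrum.zero_eq] at hone
    exact one_ne_zero hone

end Bump

variable {A : Type u} [NonUnitalCStarAlgebra A]

theorem FrameSpace.exists_selfAdjoint_lift (w : FrameSpace n A) {x : Mat n} (hx : star x = x) :
    ∃ h : A, IsSelfAdjoint h ∧ w.coord h = x := by
  obtain ⟨a, rfl⟩ := w.coord_surjective x
  refine ⟨realPart a, (realPart a).2, ?_⟩
  rw [map_realPart]
  exact IsSelfAdjoint.coe_realPart hx

theorem FrameSpace.exists_coord_eq_single (w : FrameSpace n A) {p : Fin n → A}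
    (hs : ∀ i, star (p i) = p i) (ho : ∀ i j, i ≠ j → p i * p j = 0) (h0 : ∀ i, w.coord (p i) ≠ 0) :
    ∃ w' : FrameSpace n A, w'.base = w.base ∧ ∃ c : Fin n → ℂ, (∀ i, c i ≠ 0) ∧
      ∀ i, w'.coord (p i) = Matrix.single i i (c i) := by
  obtain ⟨g, c, hc, hg⟩ := exists_aut_of_orthogonal (p := fun i => w.coord (p i))
    (fun i => by rw [← map_star, hs]) (fun i j hij => by rw [← map_mul, ho i j hij, map_zero]) h0
  exact ⟨MulOpposite.op g • w, rfl, c, hc, hg⟩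

variable (n) in
/-- `z` acts in all fibres as multiplication by the scalar `ζ`. -/
def IsScalar (z : A) (ζ : PrimitiveIdeal A → ℝ) : Prop :=
  ∀ w : FrameSpace n A, w.coord z = ((ζ w.base : ℝ) : ℂ) • (1 : Mat n)

/-- The product `(v j₁)* (v j₁) ⋯ (v jₘ)* (v jₘ) q` over a list `[j₁, …, jₘ]`. -/
def starMulProd {ι : Type*} (v : ι → A) (q : A) (l : List ι) : A :=
  l.foldr (fun j y => star (v j) * v j * y) q

theorem map_starMulProd_eq_zero {ι : Type*} (φ : A →⋆ₙₐ[ℂ] Mat n) (v : ι → A) (q : A) {l : List ι}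
    {j : ι} (hj : j ∈ l) (h0 : φ (v j) = 0) : φ (starMulProd v q l) = 0 := by
  induction l with
  | nil => exact absurd hj List.not_mem_nil
  | cons k l ih =>
    rw [starMulProd, List.foldr_cons, map_mul, map_mul]
    obtain rfl | hj := List.mem_cons.1 hj
    · rw [h0, mul_zero, zero_mul]
    · rw [← starMulProd, ih hj, mul_zero]

theorem map_starMulProd {ι : Type*} (φ : A →⋆ₙₐ[ℂ] Mat n) {v : ι → A} {q : A} (l : List ι)
    {σ : ι → ℂ} {k : Fin n} {c : ℂ} (hq : φ q = Matrix.single k k c)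
    (hv : ∀ j, φ (star (v j) * v j) = Matrix.single k k (σ j)) :
    φ (starMulProd v q l) = Matrix.single k k ((l.map σ).prod * c) := by
  induction l with
  | nil => rw [starMulProd, List.foldr_nil, hq, List.map_nil, List.prod_nil, one_mul]
  | cons j l ih =>
    rw [starMulProd, List.foldr_cons, map_mul, hv, ← starMulProd, ih,
      Matrix.single_mul_single_same, List.map_cons, List.prod_cons, mul_assoc]

/-- If `v i` is a multiple of the matrix unit `e i k` in some frame, and `q` one of `e k k`, then
this element is a multiple of the unit matrix in the same frame: each summand is a multiple of
`e i i`, with a factor that does not depend on `i`. -/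
def centralSum (v : Fin n → A) (q : A) : A :=
  ∑ i, v i * starMulProd v q ((List.finRange n).erase i) * star (v i)

theorem map_centralSum_eq_zero (φ : A →⋆ₙₐ[ℂ] Mat n) (v : Fin n → A) (q : A) {j : Fin n}
    (hj : φ (v j) = 0) : φ (centralSum v q) = 0 := by
  rw [centralSum, map_sum]
  refine Finset.sum_eq_zero fun i _ => ?_
  rw [map_mul, map_mul]
  obtain rfl | hij := eq_or_ne i j
  · rw [hj, zero_mul, zero_mul]
  · rw [map_starMulProd_eq_zero φ v q ((List.mem_erase_of_ne hij.symm).2 (List.mem_finRange j)) hj,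
      mul_zero, zero_mul]

theorem map_centralSum (φ : A →⋆ₙₐ[ℂ] Mat n) {v : Fin n → A} {q : A} {k : Fin n} {m : Fin n → ℂ}
    {c : ℂ} (hq : φ q = Matrix.single k k c) (hv : ∀ i, φ (v i) = Matrix.single i k (m i)) :
    φ (centralSum v q) = ((∏ i, star (m i) * m i) * c) • (1 : Mat n) := by
  let σ (i : Fin n) : ℂ := star (m i) * m i
  have hsv (i : Fin n) : φ (star (v i)) = Matrix.single k i (star (m i)) := by
    rw [map_star, hv, Matrix.star_eq_conjTranspose, Matrix.conjTranspose_single]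
  have hsvv (i : Fin n) : φ (star (v i) * v i) = Matrix.single k k (σ i) := by
    rw [map_mul, hsv, hv, Matrix.single_mul_single_same]
  have hterm (i : Fin n) : φ (v i * starMulProd v q ((List.finRange n).erase i) * star (v i)) =
      ((∏ i, σ i) * c) • Matrix.single i i 1 := by
    rw [map_mul, map_mul, hv, hsv, map_starMulProd φ _ hq hsvv, Matrix.single_mul_single_same,
      Matrix.single_mul_single_same, Matrix.smul_single, smul_eq_mul, mul_one, Fin.prod_univ_def,
      ← List.prod_map_erase σ (List.mem_finRange i)]
    congr 1
    simp only [σ]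
    ring
  rw [centralSum, map_sum, Finset.sum_congr rfl fun i _ => hterm i, ← Finset.smul_sum,
    Matrix.sum_single_one]

theorem exists_scalar_of_orthogonal (p a : Fin n → A) (k : Fin n) (hs : ∀ i, star (p i) = p i)
    (ho : ∀ i j, i ≠ j → p i * p j = 0) :
    ∃ (z : A) (ζ : FrameSpace n A → ℂ), ∀ w : FrameSpace n A, w.coord z = ζ w • (1 : Mat n) ∧
      (ζ w = 0 ↔ ∃ i, w.coord (p i * a i * p k) = 0) := by
  let v (i : Fin n) : A := p i * a i * p k
  suffices h : ∀ w : FrameSpace n A, ∃ ζ : ℂ, w.coord (centralSum v (p k)) = ζ • (1 : Mat n) ∧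
      (ζ = 0 ↔ ∃ i, w.coord (v i) = 0) by
    choose ζ hζ using h
    exact ⟨_, ζ, hζ⟩
  intro w
  by_cases hw : ∃ i, w.coord (v i) = 0
  · obtain ⟨j, hj⟩ := hw
    exact ⟨0, by rw [map_centralSum_eq_zero w.coord v (p k) hj, zero_smul],
      iff_of_true rfl ⟨j, hj⟩⟩
  have hp0 (i : Fin n) : w.coord (p i) ≠ 0 := fun hi =>
    hw ⟨i, by rw [map_mul, map_mul, hi, zero_mul, zero_mul]⟩
  obtain ⟨w', hw', c, hc, hp⟩ := w.exists_coord_eq_single hs ho hp0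
  have hv (i : Fin n) : w'.coord (v i) = Matrix.single i k (c i * w'.coord (a i) i k * c k) := by
    rw [map_mul, map_mul, hp, hp, Matrix.single_mul_mul_single]
  have hm (i : Fin n) : c i * w'.coord (a i) i k * c k ≠ 0 := fun hi => hw ⟨i, by
    rw [FrameSpace.coord_eq_zero_iff, ← hw', ← FrameSpace.coord_eq_zero_iff, hv, hi,
      Matrix.single_zero]⟩
  have hne : (∏ i, star (c i * w'.coord (a i) i k * c k) * (c i * w'.coord (a i) i k * c k)) *
      c k ≠ 0 :=
    mul_ne_zero (Finset.prod_ne_zero_iff.2 fun i _ =>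
      mul_ne_zero (star_ne_zero.2 (hm i)) (hm i)) (hc k)
  refine ⟨_, ?_, iff_of_false hne hw⟩
  rw [← FrameSpace.diff_coord w w' hw'.symm, map_centralSum w'.coord (hp k) hv, map_smul, map_one]

end Central

/-! ### Partitions of unity and continuous sections -/

section Sections

open scoped Matrix.Norms.L2Operator CStarAlgebra

open PrimitiveIdeal Filter

/-- A continuous function vanishing at `0` which agrees with `x ↦ x⁻¹` on `[δ, ∞)`. -/
noncomputable def invAbove (δ x : ℝ) : ℝ := x / max x δ ^ 2

section InvAbove

variable {δ x : ℝ}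

theorem continuous_invAbove (hδ : 0 < δ) : Continuous (invAbove δ) :=
  continuous_id.div (by fun_prop) fun _ => (pow_pos (lt_max_of_lt_right hδ) 2).ne'

theorem invAbove_zero (δ : ℝ) : invAbove δ 0 = 0 := zero_div _

theorem invAbove_nonneg (hx : 0 ≤ x) : 0 ≤ invAbove δ x := div_nonneg hx (sq_nonneg _)

theorem mul_invAbove_le_one (hδ : 0 < δ) (hx : 0 ≤ x) : x * invAbove δ x ≤ 1 := by
  have hmax : 0 < max x δ := lt_max_of_lt_right hδ
  rw [invAbove, mul_div_assoc', ← sq, div_le_one (pow_pos hmax 2)]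
  gcongr
  exact le_max_left x δ

theorem mul_invAbove_of_le (hδ : 0 < δ) (hx : δ ≤ x) : x * invAbove δ x = 1 := by
  rw [invAbove, max_eq_left hx, mul_div_assoc', ← sq, div_self (pow_pos (hδ.trans_le hx) 2).ne']

end InvAbove

variable {n : ℕ} {A : Type u} [NonUnitalCStarAlgebra A]

namespace IsScalar

theorem mul {z z' : A} {ζ ζ' : PrimitiveIdeal A → ℝ} (h : IsScalar n z ζ) (h' : IsScalar n z' ζ') :
    IsScalar n (z * z') fun t => ζ t * ζ' t := by
  intro w
  rw [map_mul, h, h', smul_mul_smul_comm, one_mul, Complex.ofReal_mul]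

theorem sum {ι : Type*} (F : Finset ι) {z : ι → A} {ζ : ι → PrimitiveIdeal A → ℝ}
    (h : ∀ i ∈ F, IsScalar n (z i) (ζ i)) : IsScalar n (∑ i ∈ F, z i) fun t => ∑ i ∈ F, ζ i t := by
  intro w
  rw [map_sum, Finset.sum_congr rfl fun i hi => h i hi w, ← Finset.sum_smul, Complex.ofReal_sum]

theorem coord_mul {z : A} {ζ : PrimitiveIdeal A → ℝ} (h : IsScalar n z ζ) (w : FrameSpace n A)
    (a : A) : w.coord (z * a) = ((ζ w.base : ℝ) : ℂ) • w.coord a := by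
  rw [map_mul, h, smul_mul_assoc, one_mul]

theorem coord_mul' {z : A} {ζ : PrimitiveIdeal A → ℝ} (h : IsScalar n z ζ) (w : FrameSpace n A)
    (a : A) : w.coord (a * z) = ((ζ w.base : ℝ) : ℂ) • w.coord a := by
  rw [map_mul, h, mul_smul_comm, mul_one]

end IsScalar

namespace FrameSpace

theorem norm_frame_symm (w : FrameSpace n A) (s : Fibre w.base) : ‖w.frame.symm s‖ = ‖s‖ := by
  rw [← norm_frame w, StarAlgEquiv.apply_symm_apply]

theorem norm_sub_value (w : FrameSpace n A) (s : Fibre w.base) (a : A) :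
    ‖s - value a w.base‖ = ‖w.frame.symm s - w.coord a‖ := by
  rw [coord_def, ← map_sub, norm_frame_symm]

end FrameSpace

theorem norm_smul_one (hn : 1 ≤ n) (c : ℂ) : ‖c • (1 : Mat n)‖ = ‖c‖ := by
  have : Nonempty (Fin n) := ⟨⟨0, hn⟩⟩
  rw [norm_smul, norm_one, mul_one]

variable (hn : 1 ≤ n) (hA : IsHomogeneous n A)

include hn hA

theorem IsScalar.star_eq {z : A} {ζ : PrimitiveIdeal A → ℝ} (h : IsScalar n z ζ) : star z = z :=
  eq_of_forall_coord hn hA fun w => by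
    rw [map_star, h, star_smul, star_one, RCLike.star_def, Complex.conj_ofReal]

theorem IsScalar.mul_comm {z : A} {ζ : PrimitiveIdeal A → ℝ} (h : IsScalar n z ζ) (a : A) :
    z * a = a * z :=
  eq_of_forall_coord hn hA fun w => by rw [h.coord_mul, h.coord_mul']

theorem IsScalar.continuous {z : A} {ζ : PrimitiveIdeal A → ℝ} (h : IsScalar n z ζ)
    (h0 : ∀ t, 0 ≤ ζ t) : Continuous ζ := by
  have hζ : ζ = fun t => ‖value z t‖ := by
    funext t
    obtain ⟨w, rfl⟩ := hA.exists_base_eq hn t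
    rw [FrameSpace.norm_value, h, norm_smul_one hn, Complex.norm_real, Real.norm_of_nonneg (h0 _)]
  rw [hζ]
  exact continuous_norm_value hn hA z

theorem IsScalar.cfcₙ {z : A} {ζ : PrimitiveIdeal A → ℝ} (h : IsScalar n z ζ) {f : ℝ → ℝ}
    (hf : Continuous f) (hf0 : f 0 = 0) : IsScalar n (cfcₙ f z) fun t => f (ζ t) := by
  intro w
  have hz : IsSelfAdjoint z := h.star_eq hn hA
  have hreal (r : ℝ) : (r : ℂ) • (1 : Mat n) = algebraMap ℝ (Mat n) r := by
    rw [Algebra.algebraMap_eq_smul_one, ← Complex.coe_smul]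
  rw [w.coord.map_cfcₙ f z hf.continuousOn hf0 (map_continuous _) hz (hz.map _), h, hreal, hreal,
    cfcₙ_eq_cfc hf.continuousOn hf0, cfc_algebraMap]

theorem exists_orthogonal_notMem (t : PrimitiveIdeal A) :
    ∃ p : Fin n → A, (∀ i, star (p i) = p i) ∧ (∀ i j, i ≠ j → p i * p j = 0) ∧
      ∀ i, p i ∉ t.toSubmodule := by
  obtain ⟨w, rfl⟩ := hA.exists_base_eq hn t
  let d : Mat n := Matrix.diagonal fun i => (((i : ℕ) + 1 : ℝ) : ℂ)
  have hd : IsSelfAdjoint d := by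
    rw [IsSelfAdjoint, Matrix.star_eq_conjTranspose, Matrix.diagonal_conjTranspose]
    exact congrArg _ (funext fun i => Complex.conj_ofReal _)
  obtain ⟨h, hh, hhd⟩ := w.exists_selfAdjoint_lift hd
  refine ⟨fun i => bump i h, fun i => star_bump i h,
    fun i j hij => bump_mul_bump h (Fin.val_ne_of_ne hij), fun i => ?_⟩
  have hspec : ((((i : ℕ) : ℝ) + 1 : ℝ) : ℂ) ∈ spectrum ℂ d := by
    rw [spectrum_diagonal]
    exact ⟨i, rfl⟩
  rw [← FrameSpace.coord_eq_zero_iff, map_bump _ _ hh, hhd]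
  exact bump_ne_zero hd ((spectrum.algebraMap_mem_iff ℂ).1 hspec)

theorem exists_mul_mul_notMem_of_isOpen {V : Set (PrimitiveIdeal A)} (hV : IsOpen V)
    {t : PrimitiveIdeal A} (ht : t ∈ V) {p q : A} (hp : p ∉ t.toSubmodule)
    (hq : q ∉ t.toSubmodule) :
    ∃ a, p * a * q ∉ t.toSubmodule ∧ ∀ s ∉ V, p * a * q ∈ s.toSubmodule := by
  obtain ⟨c, hc, hcV⟩ := exists_notMem_of_isOpen hn hA hV ht
  obtain ⟨x, hx⟩ := exists_mul_mul_notMem hn hA t hp hc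
  obtain ⟨y, hy⟩ := exists_mul_mul_notMem hn hA t hx hq
  refine ⟨x * c * y, by simpa only [mul_assoc] using hy, fun s hs => ?_⟩
  exact s.mul_mem_right _ (s.mul_mem_left _ (s.mul_mem_right _ (s.mul_mem_left _ (hcV s hs))))

theorem exists_isScalar {V : Set (PrimitiveIdeal A)} (hV : IsOpen V) {t : PrimitiveIdeal A}
    (ht : t ∈ V) : ∃ (z : A) (ζ : PrimitiveIdeal A → ℝ), IsScalar n z ζ ∧ (∀ s, 0 ≤ ζ s) ∧
      0 < ζ t ∧ ∀ s ∉ V, ζ s = 0 := by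
  obtain ⟨p, hs, ho, hp⟩ := exists_orthogonal_notMem hn hA t
  let k : Fin n := ⟨0, hn⟩
  choose a ha haV using fun i => exists_mul_mul_notMem_of_isOpen hn hA hV ht (hp i) (hp k)
  obtain ⟨z, ζ, hζ⟩ := exists_scalar_of_orthogonal p a k hs ho
  have hnorm (v : FrameSpace n A) : ‖value z v.base‖ = ‖ζ v‖ := by
    rw [FrameSpace.norm_value, (hζ v).1, norm_smul_one hn]
  refine ⟨star z * z, fun s => ‖value z s‖ ^ 2, fun v => ?_, fun s => sq_nonneg _, ?_,
    fun s hs => ?_⟩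
  · change v.coord (star z * z) = ((‖value z v.base‖ ^ 2 : ℝ) : ℂ) • 1
    rw [hnorm, map_mul, map_star, (hζ v).1, star_smul, star_one, smul_mul_smul_comm, one_mul,
      RCLike.star_def, ← Complex.normSq_eq_conj_mul_self, Complex.normSq_eq_norm_sq]
  · obtain ⟨w, rfl⟩ := hA.exists_base_eq hn t
    refine pow_pos ?_ 2
    rw [hnorm, norm_pos_iff, ne_eq, (hζ w).2]
    rintro ⟨i, hi⟩
    exact ha i ((w.coord_eq_zero_iff _).1 hi)
  · obtain ⟨v, rfl⟩ := hA.exists_base_eq hn s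
    have hzero : ζ v = 0 := (hζ v).2.2 ⟨k, (v.coord_eq_zero_iff _).2 (haV k _ hs)⟩
    exact (pow_eq_zero_iff two_ne_zero).2 (by rw [hnorm, hzero, norm_zero])

omit hn hA in
variable (n) in
/-- The central elements `z i`, `i ∈ F`, form a partition of unity on `K` subordinate to the sets
`V i`; the functions `g i` are their scalar values. -/
structure IsCentralPartition {ι : Type*} (K : Set (PrimitiveIdeal A))
    (V : ι → Set (PrimitiveIdeal A)) (F : Finset ι) (z : ι → A) (g : ι → PrimitiveIdeal A → ℝ) :
    Prop where
  isScalar : ∀ i ∈ F, IsScalar n (z i) (g i)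
  nonneg : ∀ i ∈ F, ∀ t, 0 ≤ g i t
  eq_zero : ∀ i ∈ F, ∀ t ∉ V i, g i t = 0
  sum_le_one : ∀ t, ∑ i ∈ F, g i t ≤ 1
  sum_eq_one : ∀ t ∈ K, ∑ i ∈ F, g i t = 1

theorem exists_isCentralPartition {K : Set (PrimitiveIdeal A)} (hK : IsCompact K)
    {V : PrimitiveIdeal A → Set (PrimitiveIdeal A)} (hV : ∀ t ∈ K, IsOpen (V t) ∧ t ∈ V t) :
    ∃ (F : Finset (PrimitiveIdeal A)) (z : PrimitiveIdeal A → A)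
      (g : PrimitiveIdeal A → PrimitiveIdeal A → ℝ), IsCentralPartition n K V F z g := by
  have hex (t : PrimitiveIdeal A) : ∃ (z : A) (ζ : PrimitiveIdeal A → ℝ), t ∈ K →
      IsScalar n z ζ ∧ (∀ s, 0 ≤ ζ s) ∧ 0 < ζ t ∧ ∀ s ∉ V t, ζ s = 0 := by
    by_cases ht : t ∈ K
    · obtain ⟨z, ζ, h⟩ := exists_isScalar hn hA (hV t ht).1 (hV t ht).2
      exact ⟨z, ζ, fun _ => h⟩
    · exact ⟨0, 0, fun h => absurd h ht⟩
  choose z ζ h using hex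
  have hcont (t) (ht : t ∈ K) : Continuous (ζ t) := (h t ht).1.continuous hn hA (h t ht).2.1
  obtain ⟨F, hFK, hF⟩ := hK.elim_nhds_subcover (fun t => {s | 0 < ζ t s}) fun t ht =>
    (isOpen_lt continuous_const (hcont t ht)).mem_nhds (h t ht).2.2.1
  replace h i (hi : i ∈ F) := h i (hFK i hi)
  let W (t : PrimitiveIdeal A) : ℝ := ∑ i ∈ F, ζ i t
  have hW0 (t) : 0 ≤ W t := Finset.sum_nonneg fun i hi => (h i hi).2.1 t
  have hWpos (t) (ht : t ∈ K) : 0 < W t := by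
    obtain ⟨i, hi, hti⟩ := Set.mem_iUnion₂.1 (hF ht)
    exact Finset.sum_pos' (fun i hi => (h i hi).2.1 t) ⟨i, hi, hti⟩
  obtain ⟨δ, hδ, hδK⟩ : ∃ δ > 0, ∀ t ∈ K, δ ≤ W t := hK.exists_forall_le'
    (continuous_finsetSum _ fun i hi => hcont i (hFK i hi)).continuousOn hWpos
  have hinv : IsScalar n (cfcₙ (invAbove δ) (∑ i ∈ F, z i)) fun t => invAbove δ (W t) :=
    (IsScalar.sum F fun i hi => (h i hi).1).cfcₙ hn hA (continuous_invAbove hδ) (invAbove_zero δ)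
  refine ⟨F, fun i => z i * cfcₙ (invAbove δ) (∑ i ∈ F, z i), fun i t => ζ i t * invAbove δ (W t),
    { isScalar := fun i hi => (h i hi).1.mul hinv
      nonneg := fun i hi t => mul_nonneg ((h i hi).2.1 t) (invAbove_nonneg (hW0 t))
      eq_zero := fun i hi t ht => mul_eq_zero_of_left ((h i hi).2.2.2 t ht) _
      sum_le_one := fun t => ?_
      sum_eq_one := fun t ht => ?_ }⟩
  · rw [← Finset.sum_mul]
    exact mul_invAbove_le_one hδ (hW0 t)
  · rw [← Finset.sum_mul]
    exact mul_invAbove_of_le hδ (hδK t ht)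

theorem eq_value_of_norm_sub_eq_zero {t : PrimitiveIdeal A} {s : Fibre t} {a : A}
    (h : ‖s - value a t‖ = 0) : s = value a t := by
  obtain ⟨w, rfl⟩ := hA.exists_base_eq hn t
  rw [w.norm_sub_value, norm_eq_zero, sub_eq_zero] at h
  rw [← w.frame_coord, ← h, StarAlgEquiv.apply_symm_apply]

theorem exists_approx_section {s : ∀ t : PrimitiveIdeal A, Fibre t} {b : A}
    (hb : ∀ t, ‖s t‖ ≤ ‖value b t‖) {ε : ℝ} (hε : 0 < ε)
    (hloc : ∀ t₀, ∃ a : A, ∀ᶠ t in 𝓝 t₀, ‖s t - value a t‖ < ε) :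
    ∃ c : A, ∀ t, ‖s t - value c t‖ ≤ ε := by
  choose a ha using hloc
  choose V hV hVo hVt using fun t₀ => eventually_nhds_iff.1 (ha t₀)
  obtain ⟨F, z, g, hP⟩ := exists_isCentralPartition hn hA
    (isCompact_le_norm_value hn hA b hε) fun t _ => ⟨hVo t, hVt t⟩
  refine ⟨∑ i ∈ F, z i * a i, fun t => ?_⟩
  obtain ⟨w, rfl⟩ := hA.exists_base_eq hn t
  let S := w.frame.symm (s w.base)
  have hterm (i) (hi : i ∈ F) :
      ‖((g i w.base : ℝ) : ℂ) • (S - w.coord (a i))‖ ≤ g i w.base * ε := by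
    rw [norm_smul, Complex.norm_real, Real.norm_of_nonneg (hP.nonneg i hi _)]
    by_cases hm : w.base ∈ V i
    · refine mul_le_mul_of_nonneg_left ?_ (hP.nonneg i hi _)
      rw [← w.norm_sub_value]
      exact (hV i _ hm).le
    · rw [hP.eq_zero i hi _ hm, zero_mul, zero_mul]
  let G := ∑ i ∈ F, g i w.base
  have hG : 0 ≤ 1 - G := sub_nonneg.2 (hP.sum_le_one _)
  have hrest : ‖((1 - G : ℝ) : ℂ) • S‖ ≤ (1 - G) * ε := by
    rw [norm_smul, Complex.norm_real, Real.norm_of_nonneg hG]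
    by_cases hm : ε ≤ ‖value b w.base‖
    · rw [show G = 1 from hP.sum_eq_one _ hm, sub_self, zero_mul, zero_mul]
    · refine mul_le_mul_of_nonneg_left ?_ hG
      rw [w.norm_frame_symm]
      exact (hb _).trans (not_le.1 hm).le
  have hsplit : S - w.coord (∑ i ∈ F, z i * a i) =
      ∑ i ∈ F, ((g i w.base : ℝ) : ℂ) • (S - w.coord (a i)) + ((1 - G : ℝ) : ℂ) • S := by
    rw [map_sum, Finset.sum_congr rfl fun i hi => (hP.isScalar i hi).coord_mul w (a i)]
    simp only [smul_sub, Finset.sum_sub_distrib, ← Finset.sum_smul, G, Complex.ofReal_sub,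
      Complex.ofReal_one, Complex.ofReal_sum]
    module
  rw [w.norm_sub_value, show w.frame.symm (s w.base) = S from rfl, hsplit]
  calc _ ≤ ∑ i ∈ F, g i w.base * ε + (1 - G) * ε :=
        (norm_add_le _ _).trans (add_le_add (norm_sum_le_of_le _ hterm) hrest)
    _ = ε := by rw [← Finset.sum_mul]; ring

theorem dist_le_of_forall_norm_sub_value_le {s : ∀ t : PrimitiveIdeal A, Fibre t} {c d : A}
    {r : ℝ} (hr : 0 < r) (hc : ∀ t, ‖s t - value c t‖ ≤ r) (hd : ∀ t, ‖s t - value d t‖ ≤ r) :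
    dist c d ≤ r + r := by
  rw [dist_eq_norm]
  refine norm_le_of_forall_value hn hA (add_pos hr hr) fun t => ?_
  rw [value_sub, ← sub_sub_sub_cancel_left _ _ (s t)]
  exact (norm_sub_le _ _).trans (add_le_add (hd t) (hc t))

/-- The bound by `b` makes the section vanish at infinity. -/
theorem exists_section {s : ∀ t : PrimitiveIdeal A, Fibre t} {b : A}
    (hb : ∀ t, ‖s t‖ ≤ ‖value b t‖)
    (hloc : ∀ t₀, ∀ ε > 0, ∃ a : A, ∀ᶠ t in 𝓝 t₀, ‖s t - value a t‖ < ε) :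
    ∃ c : A, ∀ t, value c t = s t := by
  choose c hc using fun m : ℕ => exists_approx_section hn hA hb
    (Nat.one_div_pos_of_nat (α := ℝ) (n := m)) fun t₀ => hloc t₀ _ Nat.one_div_pos_of_nat
  have hlim : Tendsto (fun m : ℕ => 1 / ((m : ℝ) + 1)) atTop (𝓝 0) :=
    tendsto_one_div_add_atTop_nhds_zero_nat
  have hcauchy : CauchySeq c := by
    refine cauchySeq_of_le_tendsto_0 _ (fun p q N hp hq => ?_)
      (by simpa only [add_zero] using hlim.add hlim)
    exact dist_le_of_forall_norm_sub_value_le hn hA Nat.one_div_pos_of_nat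
      (fun t => (hc p t).trans (Nat.one_div_le_one_div hp))
      fun t => (hc q t).trans (Nat.one_div_le_one_div hq)
  obtain ⟨x, hx⟩ := cauchySeq_tendsto_of_complete hcauchy
  refine ⟨x, fun t => (eq_value_of_norm_sub_eq_zero hn hA ?_).symm⟩
  have hbound : Tendsto (fun m : ℕ => 1 / ((m : ℝ) + 1) + ‖c m - x‖) atTop (𝓝 0) := by
    simpa only [add_zero] using hlim.add (tendsto_iff_norm_sub_tendsto_zero.1 hx)
  refine le_antisymm (ge_of_tendsto hbound (Eventually.of_forall fun m => ?_)) (norm_nonneg _)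
  rw [← sub_add_sub_cancel _ (value (c m) t), ← value_sub]
  exact norm_add_le_of_le (hc m t) (Submodule.Quotient.norm_mk_le _ _)

theorem IsCentralPartition.norm_sub_sum_mul_le {ι : Type*} {a : A} {ε : ℝ} (hε : 0 < ε)
    {V : ι → Set (PrimitiveIdeal A)} {F : Finset ι} {z : ι → A} {g : ι → PrimitiveIdeal A → ℝ}
    (hP : IsCentralPartition n {t | ε ≤ ‖value a t‖} V F z g) :
    ‖a - (∑ i ∈ F, z i) * a‖ ≤ ε := by
  refine norm_le_of_forall_coord hn hA hε fun w => ?_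
  let G := ∑ i ∈ F, g i w.base
  have hG0 : 0 ≤ G := Finset.sum_nonneg fun i hi => hP.nonneg i hi _
  have hG1 : 0 ≤ 1 - G := sub_nonneg.2 (hP.sum_le_one _)
  have hsub : w.coord (a - (∑ i ∈ F, z i) * a) = ((1 - G : ℝ) : ℂ) • w.coord a := by
    rw [map_sub, (IsScalar.sum F hP.isScalar).coord_mul, Complex.ofReal_sub, Complex.ofReal_one,
      sub_smul, one_smul]
  rw [hsub, norm_smul, Complex.norm_real, Real.norm_of_nonneg hG1]
  by_cases hm : ε ≤ ‖value a w.base‖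
  · rw [show G = 1 from hP.sum_eq_one _ hm, sub_self, zero_mul]
    exact hε.le
  · rw [FrameSpace.norm_value, not_le] at hm
    exact (mul_le_of_le_one_left (norm_nonneg _) (sub_le_self 1 hG0)).trans hm.le

theorem exists_isScalar_mul_approx (a : A) {ε : ℝ} (hε : 0 < ε) {V : Set (PrimitiveIdeal A)}
    (hV : IsOpen V) (haV : ∀ t, ε ≤ ‖value a t‖ → t ∈ V) :
    ∃ (z : A) (ζ : PrimitiveIdeal A → ℝ), IsScalar n z ζ ∧ (∀ t ∉ V, ζ t = 0) ∧
      ‖a - z * a‖ ≤ ε := by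
  obtain ⟨F, z, g, hP⟩ := exists_isCentralPartition hn hA (isCompact_le_norm_value hn hA a hε)
    (V := fun _ => V) fun t ht => ⟨hV, haV t ht⟩
  exact ⟨_, _, IsScalar.sum F hP.isScalar,
    fun t ht => Finset.sum_eq_zero fun i hi => hP.eq_zero i hi t ht,
    hP.norm_sub_sum_mul_le hn hA hε⟩

end Sections

/-! ### Reductions of the structure group as subsets of the total space -/

section Reduction

open Filter MulOpposite

section TranslationMap

variable {G : Type*} [Group G] [TopologicalSpace G] {P T : Type*} [TopologicalSpace P]
  [TopologicalSpace T] [MulAction Gᵐᵒᵖ P] {p : P → T}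

/-- `τ` is the translation map of an action of `G` on `P` which is free and transitive on the fibres
of `p`: for `x` and `y` in the same fibre, `τ x y` is the element carrying `x` to `y`. -/
structure IsTranslationMap (p : P → T) (τ : P → P → G) : Prop where
  proj_smul : ∀ (g : G) (x : P), p (op g • x) = p x
  smul_eq : ∀ x y, p x = p y → op (τ x y) • x = y
  eq_of_smul_eq : ∀ x y g, op g • x = y → τ x y = g
  continuousOn : ContinuousOn (fun y : P × P => τ y.1 y.2) {y | p y.1 = p y.2}

variable {τ : P → P → G}

/-- The trivialization, over the domain `V` of a continuous section `σ`, in which `σ s · g` has the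
coordinates `(s, g)`. -/
def IsTranslationMap.trivialization [ContinuousSMul Gᵐᵒᵖ P] (hτ : IsTranslationMap p τ)
    (hp : Continuous p) {V : Set T} (hV : IsOpen V) {σ : T → P} (hσ : ContinuousOn σ V)
    (hpσ : ∀ s ∈ V, p (σ s) = s) : Bundle.Trivialization G p where
  toFun x := (p x, τ (σ (p x)) x)
  invFun y := op y.2 • σ y.1
  source := p ⁻¹' V
  target := V ×ˢ Set.univ
  map_source' _ hx := ⟨hx, trivial⟩
  map_target' y hy := by rw [Set.mem_preimage, hτ.proj_smul, hpσ _ hy.1]; exact hy.1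
  left_inv' x hx := hτ.smul_eq _ _ (hpσ _ hx)
  right_inv' y hy := by
    have hb : p (op y.2 • σ y.1) = y.1 := (hτ.proj_smul _ _).trans (hpσ _ hy.1)
    exact Prod.ext hb (hτ.eq_of_smul_eq _ _ _ (by rw [hb]))
  open_source := hV.preimage hp
  open_target := hV.prod isOpen_univ
  continuousOn_toFun := hp.continuousOn.prodMk <| hτ.continuousOn.comp
    ((hσ.comp hp.continuousOn fun _ hx => hx).prodMk continuousOn_id) fun _ hx => hpσ _ hx
  continuousOn_invFun := (continuous_op.comp continuous_snd).continuousOn.smul <|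
    hσ.comp continuousOn_fst fun _ hy => hy.1
  baseSet := V
  open_baseSet := hV
  source_eq := rfl
  target_eq := rfl
  proj_toFun _ _ := rfl

theorem IsTranslationMap.isPrincipalBundle [ContinuousSMul Gᵐᵒᵖ P] (hτ : IsTranslationMap p τ)
    (hp : Continuous p) (hσ : ∀ t, ∃ (V : Set T) (σ : T → P), IsOpen V ∧ t ∈ V ∧
      ContinuousOn σ V ∧ ∀ s ∈ V, p (σ s) = s) : IsPrincipalBundle G p where
  proj_smul := hτ.proj_smul
  locally_trivial t := by
    obtain ⟨V, σ, hV, ht, hσ, hpσ⟩ := hσ t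
    refine ⟨hτ.trivialization hp hV hσ hpσ, ht, fun x hx g => ?_⟩
    change τ (σ (p (op g • x))) (op g • x) = τ (σ (p x)) x * g
    refine hτ.eq_of_smul_eq _ _ _ ?_
    rw [op_mul, mul_smul, hτ.proj_smul, hτ.smul_eq _ _ (hpσ _ hx)]

theorem IsPrincipalBundle.exists_smul_eq (hp : IsPrincipalBundle G p) {x y : P} (h : p x = p y) :
    ∃ g : G, op g • x = y := by
  obtain ⟨e, he, hact⟩ := hp.locally_trivial (p x)
  let g := (e x).2⁻¹ * (e y).2
  have hy : y ∈ e.source := e.mem_source.2 (h ▸ he)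
  have hgx : op g • x ∈ e.source := e.mem_source.2 (by rwa [hp.proj_smul])
  refine ⟨g, e.injOn hgx hy (Prod.ext ?_ ?_)⟩
  · change (e (op g • x)).1 = (e y).1
    rw [e.coe_fst hgx, hp.proj_smul, h, e.coe_fst hy]
  · change (e (op g • x)).2 = (e y).2
    rw [hact x he, mul_inv_cancel_left]

end TranslationMap

section Extension

variable {G : Type*} [Group G] (H : Subgroup G) {Q : Type*} [MulAction (H)ᵐᵒᵖ Q]

theorem Extension.mk_smul (x : Q) (h : H) (g : G) :
    Extension.mk H (op h • x) g = Extension.mk H x (h * g) :=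
  (Quotient.sound (s := extensionSetoid H Q) ⟨h, rfl, rfl⟩ : Extension.mk H x (h * g) = _).symm

theorem Extension.smul_mk (x : Q) (g k : G) :
    op k • Extension.mk H x g = Extension.mk H x (g * k) := rfl

theorem Extension.continuous_mk [TopologicalSpace G] [TopologicalSpace Q] :
    Continuous fun y : Q × G => Extension.mk H y.1 y.2 :=
  continuous_quotient_mk' (s := extensionSetoid H Q)

end Extension

variable {G : Type*} [Group G] {H : Subgroup G} {P T : Type u} [TopologicalSpace P]
  [TopologicalSpace T] [MulAction Gᵐᵒᵖ P] {p : P → T}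

variable (H p) in
/-- A reduction of the structure group of `p : P → T` to `H`, given as a subset `R` of `P` which is
a principal `H`-bundle over `T` for the restricted action. -/
structure IsReduction (R : Set P) : Prop where
  smul_mem : ∀ x ∈ R, ∀ h ∈ H, op h • x ∈ R
  exists_smul : ∀ x ∈ R, ∀ y ∈ R, p x = p y → ∃ h ∈ H, op h • x = y
  exists_section : ∀ t, ∃ (V : Set T) (σ : T → P), IsOpen V ∧ t ∈ V ∧ ContinuousOn σ V ∧
    ∀ s ∈ V, σ s ∈ R ∧ p (σ s) = s

theorem ReducesTo.exists_isReduction [TopologicalSpace G] (h : ReducesTo H p) :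
    ∃ R, IsReduction H p R := by
  obtain ⟨Q, _, _, q, hq, f, hf, hfq⟩ := h
  have hfmk (x : Q) (h : H) : f (Extension.mk H (op h • x) 1) =
      op (h : G) • f (Extension.mk H x 1) := by
    rw [← hf, Extension.mk_smul, Extension.smul_mk, one_mul, mul_one]
  refine ⟨Set.range fun x => f (Extension.mk H x 1), ?_, ?_, fun t => ?_⟩
  · rintro _ ⟨x, rfl⟩ h hh
    exact ⟨op (⟨h, hh⟩ : H) • x, hfmk x ⟨h, hh⟩⟩
  · rintro _ ⟨x, rfl⟩ _ ⟨y, rfl⟩ hb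
    dsimp only at hb
    rw [hfq, hfq] at hb
    obtain ⟨h, rfl⟩ := hq.exists_smul_eq hb
    exact ⟨h, h.2, (hfmk x h).symm⟩
  · obtain ⟨e, he, -⟩ := hq.locally_trivial t
    have hmk : Continuous fun x : Q => f (Extension.mk H x 1) :=
      f.continuous.comp ((Extension.continuous_mk H).comp (Continuous.prodMk_left 1))
    refine ⟨e.baseSet, fun s => f (Extension.mk H (e.invFun (s, 1)) 1), e.open_baseSet, he,
      hmk.comp_continuousOn (e.continuousOn_invFun.comp (Continuous.prodMk_left 1).continuousOn
        fun s hs => e.mem_target.2 hs), fun s hs => ⟨⟨_, rfl⟩, ?_⟩⟩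
    rw [hfq]
    exact e.proj_symm_apply' hs

namespace IsReduction

variable {R : Set P} (hR : IsReduction H p R)

/-- The action of `H` on `R`, restricted from `P`. -/
abbrev mulAction : MulAction (H)ᵐᵒᵖ R where
  smul h x := ⟨op (h.unop : G) • (x : P), hR.smul_mem x x.2 h.unop h.unop.2⟩
  one_smul x := Subtype.ext (one_smul Gᵐᵒᵖ (x : P))
  mul_smul h k x := Subtype.ext (mul_smul (op (h.unop : G)) (op (k.unop : G)) (x : P))

include hR

theorem exists_mem (t : T) : ∃ x ∈ R, p x = t := by
  obtain ⟨V, σ, -, ht, -, h⟩ := hR.exists_section t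
  exact ⟨σ t, (h t ht).1, (h t ht).2⟩

theorem exists_section_subtype (t : T) : ∃ (V : Set T) (σ : T → R), IsOpen V ∧ t ∈ V ∧
    ContinuousOn σ V ∧ ∀ s ∈ V, p (σ s) = s := by
  classical
  obtain ⟨V, σ, hV, ht, hσ, hσR⟩ := hR.exists_section t
  let σ' (s : T) : R := if h : σ s ∈ R then ⟨σ s, h⟩ else ⟨σ t, (hσR t ht).1⟩
  have hσ' (s) (hs : s ∈ V) : (σ' s : P) = σ s := by simp only [σ', dif_pos (hσR s hs).1]
  refine ⟨V, σ', hV, ht, IsInducing.subtypeVal.continuousOn_iff.2 (hσ.congr hσ'), fun s hs => ?_⟩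
  rw [hσ' s hs, (hσR s hs).2]

variable [TopologicalSpace G] {τ : P → P → G} (hτ : IsTranslationMap p τ)

include hτ

theorem exists_isTranslationMap : letI := hR.mulAction
    ∃ τ' : R → R → H, IsTranslationMap (fun x : R => p x) τ' := by
  classical
  let _ := hR.mulAction
  have hmem (x y : R) (h : p x = p y) : τ x y ∈ H := by
    obtain ⟨g, hg, hxy⟩ := hR.exists_smul x x.2 y y.2 h
    rwa [hτ.eq_of_smul_eq _ _ _ hxy]
  let τ' (x y : R) : H := if h : τ x y ∈ H then ⟨τ x y, h⟩ else 1
  have hτ' (x y : R) (h : p x = p y) : (τ' x y : G) = τ x y := by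
    simp only [τ', dif_pos (hmem x y h)]
  refine ⟨τ', fun h x => hτ.proj_smul h x, fun x y h => Subtype.ext ?_, fun x y h hxy => ?_, ?_⟩
  · change op (τ' x y : G) • (x : P) = y
    rw [hτ' x y h, hτ.smul_eq _ _ h]
  · have hb : op (h : G) • (x : P) = y := congrArg Subtype.val hxy
    refine Subtype.ext ?_
    rw [hτ' x y (by rw [← hb, hτ.proj_smul]), hτ.eq_of_smul_eq _ _ _ hb]
  · refine IsInducing.subtypeVal.continuousOn_iff.2 (ContinuousOn.congr ?_ fun y hy => hτ' _ _ hy)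
    exact hτ.continuousOn.comp
      (continuous_subtype_val.prodMap continuous_subtype_val).continuousOn fun _ hy => hy

theorem isPrincipalBundle [ContinuousSMul Gᵐᵒᵖ P] (hp : Continuous p) : letI := hR.mulAction
    IsPrincipalBundle H fun x : R => p x := by
  let _ := hR.mulAction
  have : ContinuousSMul (H)ᵐᵒᵖ R := ⟨by
    refine Continuous.subtype_mk ?_ _
    fun_prop⟩
  obtain ⟨τ', hτ'⟩ := hR.exists_isTranslationMap hτ
  exact hτ'.isPrincipalBundle (hp.comp continuous_subtype_val) hR.exists_section_subtype

theorem reducesTo [ContinuousSMul Gᵐᵒᵖ P] (hp : Continuous p) : ReducesTo H p := by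
  let _ := hR.mulAction
  let F : Extension H R → P := Quotient.lift (fun y : R × G => op y.2 • (y.1 : P)) (by
    rintro ⟨x, g⟩ ⟨y, k⟩ ⟨h, h₁ : y = op h • x, h₂ : g = h * k⟩
    rw [h₁, h₂, op_mul, mul_smul]
    rfl)
  have hFc : Continuous F := Continuous.quotient_lift (by fun_prop) _
  let Φ (w : P) (x : R) : Extension H R := Extension.mk H x (τ x w)
  have hFΦ (w : P) (x : R) (h : p x = p w) : F (Φ w x) = w := hτ.smul_eq _ _ h
  have hinj : Function.Injective F := by
    rintro ⟨x, g⟩ ⟨y, k⟩ (h : op g • (x : P) = op k • (y : P))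
    have hb : p x = p y := by rw [← hτ.proj_smul g, h, hτ.proj_smul]
    obtain ⟨d, hd, hxy⟩ := hR.exists_smul x x.2 y y.2 hb
    refine Quotient.sound ⟨⟨d, hd⟩, Subtype.ext hxy.symm, ?_⟩
    rw [← hxy, smul_smul, ← op_mul] at h
    rw [← hτ.eq_of_smul_eq _ _ _ h, hτ.eq_of_smul_eq _ _ _ rfl]
  have hsurj : Function.Surjective F := fun w => by
    obtain ⟨x, hx, hb⟩ := hR.exists_mem (p w)
    exact ⟨Φ w ⟨x, hx⟩, hFΦ w ⟨x, hx⟩ hb⟩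
  let E : Extension H R ≃ P := Equiv.ofBijective F ⟨hinj, hsurj⟩
  have hE : Continuous E.symm := continuous_iff_continuousAt.2 fun w => by
    obtain ⟨V, σ, hV, hw, hσ, hpσ⟩ := hR.exists_section_subtype (p w)
    have hVw : p ⁻¹' V ∈ 𝓝 w := (hV.preimage hp).mem_nhds hw
    have hσp : ContinuousOn (fun v => σ (p v)) (p ⁻¹' V) := hσ.comp hp.continuousOn fun _ h => h
    have hτσ : ContinuousOn (fun v => τ (σ (p v)) v) (p ⁻¹' V) := hτ.continuousOn.comp
      ((continuous_subtype_val.comp_continuousOn hσp).prodMk continuousOn_id) fun v hv => hpσ _ hv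
    refine (((Extension.continuous_mk H).comp_continuousOn (hσp.prodMk hτσ)).congr
      fun v hv => ?_).continuousAt hVw
    exact (Equiv.symm_apply_eq E).2 (hFΦ v (σ (p v)) (hpσ _ hv)).symm
  refine ⟨R, inferInstance, hR.mulAction, fun x => p x, hR.isPrincipalBundle hτ hp,
    ⟨E, hFc, hE⟩, ?_, fun x g => hτ.proj_smul g x⟩
  rintro g ⟨x, k⟩
  exact mul_smul (op g) (op k) (x : P)

end IsReduction

theorem reducesTo_iff_exists_isReduction [TopologicalSpace G] [ContinuousSMul Gᵐᵒᵖ P]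
    (hp : Continuous p) {τ : P → P → G} (hτ : IsTranslationMap p τ) :
    ReducesTo H p ↔ ∃ R, IsReduction H p R :=
  ⟨ReducesTo.exists_isReduction, fun ⟨_, hR⟩ => hR.reducesTo hτ hp⟩

end Reduction

section FrameReduction

open Filter MulOpposite

variable {n : ℕ} {A : Type u} [NonUnitalCStarAlgebra A]

namespace FrameSpace

instance : ContinuousSMul (AutMat n)ᵐᵒᵖ (FrameSpace n A) :=
  ⟨continuous_iff_continuousAt.2 fun y => tendsto_smul
    ((continuous_unop.comp continuous_fst).tendsto y) (continuous_snd.tendsto y)⟩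

theorem exists_isTranslationMap :
    ∃ τ : FrameSpace n A → FrameSpace n A → AutMat n, IsTranslationMap base τ := by
  classical
  let τ (w w' : FrameSpace n A) : AutMat n := if h : w.base = w'.base then diff w w' h else 1
  have hτ (w w' : FrameSpace n A) (h : w.base = w'.base) : op (τ w w') • w = w' := by
    simp only [τ, dif_pos h, smul_diff]
  refine ⟨τ, fun g w => base_smul w g, hτ, fun w w' g hg => ?_, fun y hy => ?_⟩
  · have hb : w.base = w'.base := by rw [← hg, base_smul]
    simp only [τ, dif_pos hb, diff_eq_of_smul hb hg]
  · exact tendsto_of_smul_eq continuous_fst.continuousWithinAt continuous_snd.continuousWithinAt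
      (eventually_mem_nhdsWithin.mono fun z hz => hτ _ _ hz) (hτ _ _ hy)

end FrameSpace

theorem frameSpace_reducesTo_iff {H : Subgroup (AutMat n)} :
    ReducesTo H (FrameSpace.base : FrameSpace n A → PrimitiveIdeal A) ↔
      ∃ R : Set (FrameSpace n A), IsReduction H FrameSpace.base R := by
  obtain ⟨τ, hτ⟩ := FrameSpace.exists_isTranslationMap (n := n) (A := A)
  exact reducesTo_iff_exists_isReduction FrameSpace.continuous_base hτ

end FrameReduction

/-! ### The diagonal part of a matrix -/

section DiagPart

open scoped ComplexOrder Matrix.Norms.L2Operator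

variable {m : Type*} [DecidableEq m]

/-- The diagonal part of a matrix, the conditional expectation onto the diagonal matrices. -/
def diagPart {R : Type*} [Semiring R] : Matrix m m R →ₗ[R] Matrix m m R :=
  Matrix.diagonalLinearMap m R R ∘ₗ Matrix.diagLinearMap m R R

section Semiring

variable {R : Type*} [Semiring R]

theorem diagPart_apply (x : Matrix m m R) : diagPart x = Matrix.diagonal x.diag := rfl

theorem isDiag_diagPart (x : Matrix m m R) : (diagPart x).IsDiag := Matrix.isDiag_diagonal _

theorem diagPart_eq_self_iff {x : Matrix m m R} : diagPart x = x ↔ x.IsDiag :=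
  ⟨fun h => h ▸ isDiag_diagPart x, Matrix.IsDiag.diagonal_diag⟩

theorem isDiag_single (i : m) (c : R) : (Matrix.single i i c).IsDiag := by
  rw [← Matrix.diagonal_single]
  exact Matrix.isDiag_diagonal _

variable [Fintype m]

theorem diagPart_mul_left {d : Matrix m m R} (hd : d.IsDiag) (x : Matrix m m R) :
    diagPart (d * x) = d * diagPart x := by
  rw [← hd.diagonal_diag, diagPart_apply, diagPart_apply, Matrix.diagonal_mul_diagonal]
  congr 1
  ext i
  simp

theorem diagPart_mul_right {d : Matrix m m R} (hd : d.IsDiag) (x : Matrix m m R) :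
    diagPart (x * d) = diagPart x * d := by
  rw [← hd.diagonal_diag, diagPart_apply, diagPart_apply, Matrix.diagonal_mul_diagonal]
  congr 1
  ext i
  simp

omit [DecidableEq m] in
theorem isDiag_mul {x y : Matrix m m R} (hx : x.IsDiag) (hy : y.IsDiag) : (x * y).IsDiag := by
  classical
  rw [← diagPart_eq_self_iff, diagPart_mul_left hx, diagPart_eq_self_iff.2 hy]

theorem isDiag_of_commute_single {x : Matrix m m R}
    (h : ∀ i, Commute x (Matrix.single i i 1)) : x.IsDiag := by
  intro i j hij
  have := congrFun₂ (h j) i j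
  rwa [Matrix.mul_single_apply_same, Matrix.single_mul_apply_of_ne (h := hij), mul_one] at this

theorem diagPart_eq_sum (x : Matrix m m R) :
    diagPart x = ∑ i, Matrix.single i i 1 * x * Matrix.single i i 1 := by
  simp only [Matrix.single_mul_mul_single, one_mul, mul_one]
  exact (Matrix.sum_single_eq_diagonal _).symm

end Semiring

omit [DecidableEq m] in
theorem isDiag_commute [Fintype m] {R : Type*} [CommSemiring R] {x y : Matrix m m R}
    (hx : x.IsDiag) (hy : y.IsDiag) : Commute x y := by
  classical
  rw [← hx.diagonal_diag, ← hy.diagonal_diag]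
  exact Matrix.commute_diagonal _ _

theorem diagPart_commutator [Fintype m] {R : Type*} [CommRing R] {d : Matrix m m R}
    (hd : d.IsDiag) (x : Matrix m m R) : diagPart (d * x - x * d) = 0 := by
  rw [map_sub, diagPart_mul_left hd, diagPart_mul_right hd,
    isDiag_commute hd (isDiag_diagPart x), sub_self]

theorem sub_diagPart_eq_sum [Fintype m] {R : Type*} [Ring R] (x : Matrix m m R) :
    x - diagPart x = ∑ i, (Matrix.single i i 1 * (Matrix.single i i 1 * x) -
      Matrix.single i i 1 * x * Matrix.single i i 1) := by
  simp only [Finset.sum_sub_distrib, ← diagPart_eq_sum, ← mul_assoc,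
    Matrix.single_mul_single_same, mul_one, ← Finset.sum_mul, Matrix.sum_single_one, one_mul]

theorem continuous_diagPart {R : Type*} [Semiring R] [TopologicalSpace R] :
    Continuous (diagPart : Matrix m m R → Matrix m m R) :=
  continuous_id.matrix_diag.matrix_diagonal

omit [DecidableEq m] in
theorem isClosed_isDiag {R : Type*} [Semiring R] [TopologicalSpace R] [T2Space R] :
    IsClosed {x : Matrix m m R | x.IsDiag} := by
  classical
  simp only [← diagPart_eq_self_iff]
  exact isClosed_eq continuous_diagPart continuous_id

section RCLike

variable [Fintype m] {𝕜 : Type*} [RCLike 𝕜]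

theorem norm_diagPart_le (x : Matrix m m 𝕜) : ‖diagPart x‖ ≤ ‖x‖ := by
  rw [diagPart_apply, Matrix.l2_opNorm_diagonal]
  refine (pi_norm_le_iff_of_nonneg (norm_nonneg _)).2 fun i => ?_
  have hcol := Matrix.l2_opNorm_mulVec x (EuclideanSpace.single i (1 : 𝕜))
  rw [PiLp.norm_single, norm_one, mul_one] at hcol
  refine le_trans ?_ hcol
  simpa using PiLp.norm_apply_le (p := 2)
    (WithLp.toLp 2 (x.mulVec (EuclideanSpace.single i (1 : 𝕜)))) i

theorem diagPart_star_mul_self_eq_zero {x : Matrix m m 𝕜} (h : diagPart (star x * x) = 0) :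
    x = 0 := by
  rw [diagPart_apply, Matrix.diagonal_eq_zero] at h
  exact Matrix.trace_conjTranspose_mul_self_eq_zero_iff.1 (Finset.sum_eq_zero fun i _ =>
    congrFun h i)

theorem exists_diagPart_star_mul_self (x : Matrix m m 𝕜) :
    ∃ d : Matrix m m 𝕜, d.IsDiag ∧ diagPart (star x * x) = star d * d := by
  have hdiag : ∀ i, ∃ r : ℝ, 0 ≤ r ∧ (r : 𝕜) = (star x * x) i i := fun i =>
    RCLike.nonneg_iff_exists_ofReal.1 (Matrix.posSemidef_conjTranspose_mul_self x).diag_nonneg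
  choose r hr₀ hr using hdiag
  refine ⟨Matrix.diagonal fun i => ((√(r i) : ℝ) : 𝕜), Matrix.isDiag_diagonal _, ?_⟩
  rw [diagPart_apply, Matrix.star_eq_conjTranspose (Matrix.diagonal _),
    Matrix.diagonal_conjTranspose, Matrix.diagonal_mul_diagonal]
  congr 1
  ext i
  rw [Matrix.diag_apply, ← hr, Pi.star_apply, RCLike.star_def, RCLike.conj_ofReal,
    ← RCLike.ofReal_mul, Real.mul_self_sqrt (hr₀ i)]

end RCLike

theorem isDiag_single_mul_mul [Fintype m] {R : Type*} [Semiring R] [StarRing R] (j k : m)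
    (x y : Matrix m m R) :
    (Matrix.single j j 1 * x * Matrix.single k k 1 * y *
      star (Matrix.single j j 1 * x * Matrix.single k k 1)).IsDiag := by
  have e : Matrix.single j j 1 * x * Matrix.single k k 1 * y *
      star (Matrix.single j j 1 * x * Matrix.single k k 1) = Matrix.single j j 1 *
        (x * Matrix.single k k 1 * y * Matrix.single k k 1 * star x) * Matrix.single j j 1 := by
    simp only [star_mul, Matrix.star_eq_conjTranspose, Matrix.conjTranspose_single, star_one,
      mul_assoc]
  rw [e, Matrix.single_mul_mul_single]
  exact isDiag_single j _

variable {n : ℕ} {g : AutMat n}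

theorem isDiag_map (hg : g ∈ autDiag n) {x : Mat n} (hx : x.IsDiag) : (g x).IsDiag := by
  have h : (fun x => g x) '' diagMat n = diagMat n := hg
  exact h.subset ⟨x, hx, rfl⟩

/-- The off-diagonal part of a matrix is a sum of commutators with diagonal matrices, and so is its
image under `g`. -/
theorem diagPart_map (hg : g ∈ autDiag n) (x : Mat n) : diagPart (g x) = g (diagPart x) := by
  have hoff : diagPart (g (x - diagPart x)) = 0 := by
    rw [sub_diagPart_eq_sum, map_sum, map_sum]
    refine Finset.sum_eq_zero fun i _ => ?_
    rw [map_sub, map_mul, map_mul _ _ (Matrix.single i i 1)]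
    exact diagPart_commutator (isDiag_map hg (isDiag_single i 1)) _
  rw [map_sub, map_sub, sub_eq_zero] at hoff
  rw [hoff, diagPart_eq_self_iff]
  exact isDiag_map hg (isDiag_diagPart x)

end DiagPart

/-! ### Sections adapted to a reduction -/

section Adapted

open scoped Matrix.Norms.L2Operator

open PrimitiveIdeal Filter

variable {n : ℕ} {A : Type u} [NonUnitalCStarAlgebra A]

namespace FrameSpace

theorem norm_value_of_base_eq {w : FrameSpace n A} {t : PrimitiveIdeal A} (h : w.base = t)
    (a : A) : ‖value a t‖ = ‖w.coord a‖ := by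
  rw [← h, norm_value]

theorem tendsto_norm_value_sub {c : PrimitiveIdeal A → A} {t₀ : PrimitiveIdeal A}
    {σ : PrimitiveIdeal A → FrameSpace n A} (hσ : ContinuousAt σ t₀)
    (hbase : ∀ᶠ t in 𝓝 t₀, (σ t).base = t) (hc : ContinuousAt (fun t => (σ t).coord (c t)) t₀) :
    Tendsto (fun t => ‖value (c t) t - value (c t₀) t‖) (𝓝 t₀) (𝓝 0) := by
  have hsub : Tendsto (fun t => (σ t).coord (c t - c t₀)) (𝓝 t₀) (𝓝 0) := by
    have := hc.tendsto.sub (tendsto_nhds_iff.1 hσ (c t₀))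
    simpa only [map_sub, sub_self] using this
  refine (tendsto_norm_zero.comp hsub).congr' (hbase.mono fun t ht => ?_)
  change _ = ‖value (c t - c t₀) t‖
  rw [norm_value_of_base_eq ht, Function.comp_apply]

end FrameSpace

theorem exists_value_eq (hn : 1 ≤ n) (hA : IsHomogeneous n A) {c : PrimitiveIdeal A → A} {b : A}
    (hb : ∀ t, ‖value (c t) t‖ ≤ ‖value b t‖)
    (hloc : ∀ t₀, value b t₀ ≠ 0 → ∃ σ : PrimitiveIdeal A → FrameSpace n A, ContinuousAt σ t₀ ∧
      (∀ᶠ t in 𝓝 t₀, (σ t).base = t) ∧ ContinuousAt (fun t => (σ t).coord (c t)) t₀) :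
    ∃ m : A, ∀ t, value m t = value (c t) t := by
  refine exists_section hn hA hb fun t₀ ε hε => ?_
  by_cases hb₀ : value b t₀ = 0
  · have hlt := (continuous_norm_value hn hA b).continuousAt.eventually_lt
      (continuousAt_const (y := ε)) (by rwa [hb₀, norm_zero])
    refine ⟨0, hlt.mono fun t ht => ?_⟩
    rw [value_zero, sub_zero]
    exact (hb t).trans_lt ht
  · obtain ⟨σ, hσ, hbase, hc⟩ := hloc t₀ hb₀
    exact ⟨c t₀, (FrameSpace.tendsto_norm_value_sub hσ hbase hc).eventually_lt_const hε⟩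

namespace IsReduction

variable {R : Set (FrameSpace n A)} (hR : IsReduction (autDiag n) FrameSpace.base R)

include hR

theorem ext_coord {a b : A} (h : ∀ w ∈ R, w.coord a = w.coord b) : a = b := by
  refine eq_of_forall_value fun t => ?_
  obtain ⟨w, hw, rfl⟩ := hR.exists_mem t
  rw [← FrameSpace.frame_coord, h w hw, FrameSpace.frame_coord]

theorem norm_le (hn : 1 ≤ n) (hA : IsHomogeneous n A) {a : A} {r : ℝ} (hr : 0 < r)
    (h : ∀ w ∈ R, ‖w.coord a‖ ≤ r) : ‖a‖ ≤ r := by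
  refine norm_le_of_forall_value hn hA hr fun t => ?_
  obtain ⟨w, hw, rfl⟩ := hR.exists_mem t
  rw [FrameSpace.norm_value]
  exact h w hw

theorem exists_coord_eq (hn : 1 ≤ n) (hA : IsHomogeneous n A) {Ψ : FrameSpace n A → Mat n}
    (heq : ∀ w ∈ R, ∀ g ∈ autDiag n, Ψ (MulOpposite.op g • w) = g.symm (Ψ w))
    (hcont : ContinuousOn Ψ R) {b : A} (hb : ∀ w ∈ R, ‖Ψ w‖ ≤ ‖w.coord b‖) :
    ∃ m : A, ∀ w ∈ R, w.coord m = Ψ w := by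
  have hval (t : PrimitiveIdeal A) : ∃ c, ∀ w ∈ R, w.base = t → w.coord c = Ψ w := by
    obtain ⟨r, hr, rfl⟩ := hR.exists_mem t
    obtain ⟨c, hc⟩ := r.coord_surjective (Ψ r)
    refine ⟨c, fun w hw hbase => ?_⟩
    obtain ⟨g, hg, rfl⟩ := hR.exists_smul r hr w hw hbase.symm
    rw [FrameSpace.coord_smul, hc, heq r hr g hg]
  choose c hc using hval
  have hbound (t : PrimitiveIdeal A) : ‖value (c t) t‖ ≤ ‖value b t‖ := by
    obtain ⟨w, hw, rfl⟩ := hR.exists_mem t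
    rw [FrameSpace.norm_value, FrameSpace.norm_value, hc _ w hw rfl]
    exact hb w hw
  obtain ⟨m, hm⟩ := exists_value_eq hn hA hbound fun t₀ _ => by
    obtain ⟨V, σ, hV, ht₀, hσ, hσR⟩ := hR.exists_section t₀
    have hnhds := hV.mem_nhds ht₀
    refine ⟨σ, hσ.continuousAt hnhds, eventually_of_mem hnhds fun t ht => (hσR t ht).2, ?_⟩
    refine ((hcont.comp hσ fun t ht => (hσR t ht).1).congr fun t ht => ?_).continuousAt hnhds
    exact hc t (σ t) (hσR t ht).1 (hσR t ht).2
  exact ⟨m, fun w hw => (congrArg w.frame.symm (hm w.base)).trans (hc w.base w hw rfl)⟩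

end IsReduction

theorem exists_coord_eq_smul (hn : 1 ≤ n) (hA : IsHomogeneous n A) {V : Set (PrimitiveIdeal A)}
    {σ : PrimitiveIdeal A → FrameSpace n A} (hV : IsOpen V) (hσ : ContinuousOn σ V)
    (hbase : ∀ t ∈ V, (σ t).base = t) {z : A} {ζ : PrimitiveIdeal A → ℝ} (hz : IsScalar n z ζ)
    (hζ : ∀ t, 0 ≤ ζ t) (hζV : ∀ t ∉ V, ζ t = 0) {Θ : Mat n → Mat n} (hΘ : Continuous Θ)
    (hΘn : ∀ x, ‖Θ x‖ ≤ ‖x‖) (a : A) :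
    ∃ m : A, (∀ t ∈ V, (σ t).coord m = (ζ t : ℂ) • Θ ((σ t).coord a)) ∧
      ∀ t ∉ V, value m t = 0 := by
  have hval (t : PrimitiveIdeal A) : ∃ c : A,
      (t ∈ V → (σ t).coord c = (ζ t : ℂ) • Θ ((σ t).coord a)) ∧ (t ∉ V → c = 0) := by
    by_cases ht : t ∈ V
    · obtain ⟨c, hc⟩ := (σ t).coord_surjective ((ζ t : ℂ) • Θ ((σ t).coord a))
      exact ⟨c, fun _ => hc, fun h => absurd ht h⟩
    · exact ⟨0, fun h => absurd h ht, fun _ => rfl⟩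
  choose c hcV hc₀ using hval
  have hbound (t : PrimitiveIdeal A) : ‖value (c t) t‖ ≤ ‖value (z * a) t‖ := by
    by_cases ht : t ∈ V
    · rw [FrameSpace.norm_value_of_base_eq (hbase t ht),
        FrameSpace.norm_value_of_base_eq (hbase t ht), hcV t ht, hz.coord_mul, hbase t ht,
        norm_smul, norm_smul]
      exact mul_le_mul_of_nonneg_left (hΘn _) (norm_nonneg _)
    · rw [hc₀ t ht, value_zero, norm_zero]
      exact norm_nonneg _
  have hsupp (t : PrimitiveIdeal A) (ht : t ∉ V) : value (z * a) t = 0 := by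
    obtain ⟨w, rfl⟩ := hA.exists_base_eq hn t
    rw [← FrameSpace.frame_coord, hz.coord_mul, hζV _ ht, Complex.ofReal_zero, zero_smul, map_zero]
  obtain ⟨m, hm⟩ := exists_value_eq hn hA hbound fun t₀ hne => by
    have hnhds := hV.mem_nhds (not_imp_comm.1 (hsupp t₀) hne)
    have hcoord : ContinuousOn (fun t => (σ t).coord a) V :=
      (FrameSpace.continuous_coord a).comp_continuousOn hσ
    exact ⟨σ, hσ.continuousAt hnhds, eventually_of_mem hnhds hbase,
      (((Complex.continuous_ofReal.comp (hz.continuous hn hA hζ)).continuousOn.smul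
        (hΘ.comp_continuousOn hcoord)).congr hcV).continuousAt hnhds⟩
  refine ⟨m, fun t ht => ?_, fun t ht => by rw [hm, hc₀ t ht, value_zero]⟩
  have hmt : value m (σ t).base = value (c t) (σ t).base := by rw [hbase t ht, hm]
  exact (congrArg (σ t).frame.symm hmt).trans (hcV t ht)

end Adapted

/-! ### The Cartan subalgebra of a reduction -/

section PositiveElements

theorem star_cfcₙ_sqrt_abs_mul_self {A : Type*} [NonUnitalCStarAlgebra A] (y : A) :
    star (cfcₙ (fun x : ℝ => √|x|) y) * cfcₙ (fun x : ℝ => √|x|) y =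
      cfcₙ (fun x : ℝ => |x|) y := by
  have hc : Continuous fun x : ℝ => √|x| := by fun_prop
  rw [(cfcₙ_predicate (fun x : ℝ => √|x|) y : IsSelfAdjoint _).star_eq,
    ← cfcₙ_mul (fun x : ℝ => √|x|) (fun x : ℝ => √|x|) y hc.continuousOn (by simp)
      hc.continuousOn (by simp)]
  simp only [Real.mul_self_sqrt (abs_nonneg _)]

theorem cfcₙ_abs_star_mul_self {A : Type*} [CStarAlgebra A] (d : A) :
    cfcₙ (fun x : ℝ => |x|) (star d * d) = star d * d := by
  conv_rhs => rw [← cfcₙ_id' ℝ (star d * d) (.star_mul_self d)]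
  refine cfcₙ_congr fun x hx => abs_of_nonneg ?_
  rw [quasispectrum_eq_spectrum_union_zero] at hx
  rcases hx with hx | rfl
  · exact spectrum_star_mul_self_nonneg x hx
  · exact le_rfl

end PositiveElements

section ApproximateUnit

open Filter

theorem norm_mul_sub_le {A : Type*} [NonUnitalNormedRing A] {e : A} (he : ‖e‖ ≤ 1) (a z : A) :
    ‖e * a - a‖ ≤ 2 * ‖a - z * a‖ + ‖e * z - z‖ * ‖a‖ := by
  have hsplit : e * a - a = e * (a - z * a) + (e * z - z) * a - (a - z * a) := by noncomm_ring
  calc ‖e * a - a‖ ≤ ‖e * (a - z * a)‖ + ‖(e * z - z) * a‖ + ‖a - z * a‖ := by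
        rw [hsplit]
        exact (norm_sub_le _ _).trans (add_le_add_left (norm_add_le _ _) _)
    _ ≤ 1 * ‖a - z * a‖ + ‖e * z - z‖ * ‖a‖ + ‖a - z * a‖ := by
        gcongr
        · exact (norm_mul_le _ _).trans (by gcongr)
        · exact norm_mul_le _ _
    _ = _ := by ring

theorem exists_isApproximateUnit {A : Type*} [NonUnitalCStarAlgebra A]
    {B : NonUnitalStarSubalgebra ℂ A} (hB : IsClosed (B : Set A))
    (happrox : ∀ a : A, ∀ ε > 0, ∃ z ∈ B, ‖a - z * a‖ ≤ ε) :
    ∃ l : Filter A, l.IsApproximateUnit ∧ ∀ᶠ x in l, x ∈ B := by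
  let _ := CStarAlgebra.spectralOrder B
  have := CStarAlgebra.spectralOrderedRing B
  have hu := CStarAlgebra.increasingApproximateUnit B
  let l := (CStarAlgebra.approximateUnit B).map (Subtype.val : B → A)
  have hsa : ∀ᶠ e in l, IsSelfAdjoint e :=
    eventually_map.2 (hu.eventually_isSelfAdjoint.mono fun e he => congrArg Subtype.val he)
  have hleft (a : A) : Tendsto (· * a) l (𝓝 a) := by
    refine tendsto_map'_iff.2 (Metric.tendsto_nhds.2 fun ε hε => ?_)
    obtain ⟨z, hz, hza⟩ := happrox a (ε / 4) (by positivity)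
    have hez : Tendsto (fun e : B => ‖(e : A) * z - z‖ * ‖a‖)
        (CStarAlgebra.approximateUnit B) (𝓝 0) := by
      have h := (continuous_subtype_val.tendsto _).comp (hu.tendsto_mul_right ⟨z, hz⟩)
      simpa using ((h.sub_const z).norm).mul_const ‖a‖
    filter_upwards [hu.eventually_norm, hez.eventually_lt_const (half_pos hε)] with e he hsmall
    rw [Function.comp_apply, dist_eq_norm]
    linarith [norm_mul_sub_le (e := (e : A)) he a z]
  have := hu.neBot
  exact ⟨l, ⟨(CStarAlgebra.tendsto_mul_left_iff_tendsto_mul_right hsa).2 hleft, hleft⟩,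
    eventually_map.2 (Eventually.of_forall Subtype.property)⟩

end ApproximateUnit

section OfReduction

open scoped CStarAlgebra Matrix.Norms.L2Operator

open PrimitiveIdeal

variable {n : ℕ}

theorem norm_single_one_mul_mul_single_one_le {m 𝕜 : Type*} [Fintype m] [DecidableEq m] [RCLike 𝕜]
    (j k : m) (x : Matrix m m 𝕜) :
    ‖Matrix.single j j 1 * x * Matrix.single k k 1‖ ≤ ‖x‖ := by
  have hsingle (i : m) : ‖(Matrix.single i i 1 : Matrix m m 𝕜)‖ ≤ 1 := by
    rw [← Matrix.diagonal_single, Matrix.l2_opNorm_diagonal]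
    refine (pi_norm_le_iff_of_nonneg zero_le_one).2 fun l => ?_
    rcases eq_or_ne l i with rfl | h
    · simp
    · simp [h]
  calc ‖Matrix.single j j 1 * x * Matrix.single k k 1‖
      ≤ ‖(Matrix.single j j 1 : Matrix m m 𝕜)‖ * ‖x‖ * ‖(Matrix.single k k 1 : Matrix m m 𝕜)‖ :=
        (norm_mul_le _ _).trans (by gcongr; exact norm_mul_le _ _)
    _ ≤ 1 * ‖x‖ * 1 := by gcongr <;> exact hsingle _
    _ = ‖x‖ := by ring

variable {A : Type u} [NonUnitalCStarAlgebra A]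

/-- The sub-C*-algebra of the elements of `A` which are diagonal in all the frames of `R`. For a
reduction `R` to `Aut(M_n, D_n)` this is the Cartan subalgebra that belongs to it. -/
def adaptedSubalgebra (R : Set (FrameSpace n A)) : NonUnitalStarSubalgebra ℂ A where
  carrier := {a | ∀ w ∈ R, (w.coord a).IsDiag}
  add_mem' ha hb w hw := by rw [map_add]; exact (ha w hw).add (hb w hw)
  zero_mem' w _ := by rw [map_zero]; exact Matrix.isDiag_zero
  mul_mem' ha hb w hw := by rw [map_mul]; exact isDiag_mul (ha w hw) (hb w hw)
  smul_mem' c a ha w hw := by rw [map_smul]; exact (ha w hw).smul c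
  star_mem' ha w hw := by rw [map_star]; exact (ha w hw).conjTranspose

theorem isClosed_adaptedSubalgebra (R : Set (FrameSpace n A)) :
    IsClosed (adaptedSubalgebra R : Set A) := by
  have hinter : (adaptedSubalgebra R : Set A) = ⋂ w ∈ R, w.coord ⁻¹' {x : Mat n | x.IsDiag} := by
    ext a
    simp only [Set.mem_iInter]
    rfl
  rw [hinter]
  exact isClosed_biInter fun w _ => isClosed_isDiag.preimage (map_continuous w.coord)

theorem IsScalar.mem_adaptedSubalgebra {R : Set (FrameSpace n A)} {z : A}
    {ζ : PrimitiveIdeal A → ℝ} (hz : IsScalar n z ζ) : z ∈ adaptedSubalgebra R := fun w _ => by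
  rw [hz]
  exact Matrix.isDiag_one.smul _

theorem exists_isApproximateUnit_adaptedSubalgebra (hn : 1 ≤ n) (hA : IsHomogeneous n A)
    (R : Set (FrameSpace n A)) :
    ∃ l : Filter A, l.IsApproximateUnit ∧ ∀ᶠ x in l, x ∈ adaptedSubalgebra R :=
  exists_isApproximateUnit (isClosed_adaptedSubalgebra R) fun a _ hε => by
    obtain ⟨z, _, hz, -, hza⟩ :=
      exists_isScalar_mul_approx hn hA a hε isOpen_univ fun _ _ => Set.mem_univ _
    exact ⟨z, hz.mem_adaptedSubalgebra, hza⟩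

namespace IsReduction

variable {R : Set (FrameSpace n A)} (hR : IsReduction (autDiag n) FrameSpace.base R)

include hR

theorem exists_star_mul_self_eq {y : A} (hy : y ∈ adaptedSubalgebra R)
    (hpos : ∀ w ∈ R, ∃ d : Mat n, w.coord y = star d * d) :
    ∃ b ∈ adaptedSubalgebra R, y = star b * b := by
  have hcl : IsClosed (adaptedSubalgebra R : Set A) := isClosed_adaptedSubalgebra R
  have hsa : IsSelfAdjoint y := hR.ext_coord fun w hw => by
    obtain ⟨d, hd⟩ := hpos w hw
    rw [map_star, hd, star_mul, star_star]
  refine ⟨cfcₙ (fun x : ℝ => √|x|) y, cfcₙ_mem (𝕜' := ℂ) _ hy, ?_⟩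
  refine hR.ext_coord fun w hw => ?_
  obtain ⟨d, hd⟩ := hpos w hw
  rw [star_cfcₙ_sqrt_abs_mul_self, w.coord.map_cfcₙ (fun x : ℝ => |x|) y
    continuous_abs.continuousOn (by simp) (map_continuous w.coord) hsa (hsa.map w.coord), hd,
    cfcₙ_abs_star_mul_self]

theorem isDiag_coord_of_isDiag {w w' : FrameSpace n A} (hw : w ∈ R) (hw' : w' ∈ R)
    (hb : w.base = w'.base) {a : A} (h : (w.coord a).IsDiag) : (w'.coord a).IsDiag := by
  obtain ⟨g, hg, rfl⟩ := hR.exists_smul w hw w' hw' hb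
  rw [FrameSpace.coord_smul]
  exact isDiag_map (inv_mem hg) h

theorem mul_mul_star_mem_adaptedSubalgebra {m : A} {j k : Fin n}
    (hm : ∀ t, ∃ w ∈ R, w.base = t ∧
      ∃ x, w.coord m = Matrix.single j j 1 * x * Matrix.single k k 1) (b : A) :
    m * b * star m ∈ adaptedSubalgebra R := fun w hw => by
  obtain ⟨w', hw', hbase, x, hx⟩ := hm w.base
  refine hR.isDiag_coord_of_isDiag hw' hw hbase ?_
  rw [map_mul, map_mul, map_star, hx]
  exact isDiag_single_mul_mul j k x _

theorem mem_normalizerSet {m : A} {j k : Fin n}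
    (hm : ∀ t, ∃ w ∈ R, w.base = t ∧
      ∃ x, w.coord m = Matrix.single j j 1 * x * Matrix.single k k 1) :
    m ∈ normalizerSet (adaptedSubalgebra R) := fun b _ => by
  refine ⟨hR.mul_mul_star_mem_adaptedSubalgebra hm b, ?_⟩
  have hm' (t) : ∃ w ∈ R, w.base = t ∧
      ∃ x, w.coord (star m) = Matrix.single k k 1 * x * Matrix.single j j 1 := by
    obtain ⟨w, hw, hbase, x, hx⟩ := hm t
    refine ⟨w, hw, hbase, star x, ?_⟩
    rw [map_star, hx]
    simp only [star_mul, Matrix.star_eq_conjTranspose, Matrix.conjTranspose_single, star_one,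
      mul_assoc]
  simpa only [star_star] using hR.mul_mul_star_mem_adaptedSubalgebra hm' b

variable (hn : 1 ≤ n) (hA : IsHomogeneous n A)

include hn hA

theorem exists_diagPart (a : A) : ∃ c : A, ∀ w ∈ R, w.coord c = diagPart (w.coord a) := by
  refine hR.exists_coord_eq hn hA (fun w _ g hg => ?_)
    (continuous_diagPart.comp (FrameSpace.continuous_coord a)).continuousOn
    fun w _ => norm_diagPart_le _
  rw [FrameSpace.coord_smul]
  exact diagPart_map (inv_mem hg) _

theorem exists_condExp : ∃ E : A →ₗ[ℂ] adaptedSubalgebra R,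
    ∀ a, ∀ w ∈ R, w.coord (E a) = diagPart (w.coord a) := by
  choose E hE using hR.exists_diagPart hn hA
  have hadd (a b) : E (a + b) = E a + E b := hR.ext_coord fun w hw => by
    rw [map_add, hE _ w hw, hE _ w hw, hE _ w hw, map_add, map_add]
  have hsmul (c : ℂ) (a) : E (c • a) = c • E a := hR.ext_coord fun w hw => by
    rw [map_smul, hE _ w hw, hE _ w hw, map_smul, map_smul]
  exact ⟨{ toFun a := ⟨E a, fun w hw => by rw [hE a w hw]; exact isDiag_diagPart _⟩
           map_add' a b := Subtype.ext (hadd a b)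
           map_smul' c a := Subtype.ext (hsmul c a) }, hE⟩

theorem exists_isFaithfulCondExp :
    ∃ E : A →ₗ[ℂ] adaptedSubalgebra R, IsFaithfulCondExp (adaptedSubalgebra R) E := by
  obtain ⟨E, hE⟩ := hR.exists_condExp hn hA
  refine ⟨E, ?_, ?_, ?_, ?_, ?_, ?_⟩
  · refine fun b => Subtype.ext (hR.ext_coord fun w hw => ?_)
    rw [hE _ w hw, diagPart_eq_self_iff.2 (b.2 w hw)]
  · intro a
    rcases eq_or_ne a 0 with rfl | ha
    · rw [map_zero, norm_zero, norm_zero]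
    refine hR.norm_le hn hA (norm_pos_iff.2 ha) fun w hw => ?_
    change ‖w.coord (E a : A)‖ ≤ ‖a‖
    rw [hE a w hw]
    exact (norm_diagPart_le _).trans (NonUnitalStarAlgHom.norm_apply_le w.coord a)
  · intro a
    obtain ⟨b, hb, hab⟩ := hR.exists_star_mul_self_eq (E (star a * a)).2 fun w hw => by
      obtain ⟨d, -, hd⟩ := exists_diagPart_star_mul_self (w.coord a)
      exact ⟨d, by rw [hE _ w hw, map_mul, map_star, hd]⟩
    exact ⟨⟨b, hb⟩, Subtype.ext hab⟩
  · refine fun b a => Subtype.ext (hR.ext_coord fun w hw => ?_)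
    change _ = w.coord ((b : A) * E a)
    rw [hE _ w hw, map_mul, diagPart_mul_left (b.2 w hw), map_mul, hE _ w hw]
  · refine fun a b => Subtype.ext (hR.ext_coord fun w hw => ?_)
    change _ = w.coord ((E a : A) * b)
    rw [hE _ w hw, map_mul, diagPart_mul_right (b.2 w hw), map_mul, hE _ w hw]
  · refine fun a ha => hR.ext_coord fun w hw => ?_
    rw [map_zero]
    refine diagPart_star_mul_self_eq_zero ?_
    rw [← map_star, ← map_mul, ← hE _ w hw, ha, ZeroMemClass.coe_zero, map_zero]

theorem exists_mem_coord_eq {w : FrameSpace n A} (hw : w ∈ R) {x : Mat n} (hx : x.IsDiag) :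
    ∃ b ∈ adaptedSubalgebra R, w.coord b = x := by
  obtain ⟨a, rfl⟩ := w.coord_surjective x
  obtain ⟨b, hb⟩ := hR.exists_diagPart hn hA a
  refine ⟨b, fun w hw => ?_, ?_⟩
  · rw [hb w hw]
    exact isDiag_diagPart _
  · rw [hb w hw, diagPart_eq_self_iff.2 hx]

theorem maximal_adaptedSubalgebra : Maximal (fun C : NonUnitalStarSubalgebra ℂ A =>
    IsClosed (C : Set A) ∧ ∀ x ∈ C, ∀ y ∈ C, x * y = y * x) (adaptedSubalgebra R) := by
  refine ⟨⟨isClosed_adaptedSubalgebra R, fun x hx y hy => hR.ext_coord fun w hw => ?_⟩, ?_⟩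
  · rw [map_mul, map_mul, isDiag_commute (hx w hw) (hy w hw)]
  · rintro C ⟨-, hC⟩ hBC c hc w hw
    refine isDiag_of_commute_single fun i => ?_
    obtain ⟨b, hb, hbw⟩ := hR.exists_mem_coord_eq hn hA hw (isDiag_single i 1)
    rw [Commute, SemiconjBy, ← hbw, ← map_mul, ← map_mul, hC c hc b (hBC hb)]

section Regular

variable {V : Set (PrimitiveIdeal A)} {σ : PrimitiveIdeal A → FrameSpace n A} (hV : IsOpen V)
  (hσ : ContinuousOn σ V) (hσR : ∀ s ∈ V, σ s ∈ R ∧ (σ s).base = s) {z : A}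
  {ζ : PrimitiveIdeal A → ℝ} (hz : IsScalar n z ζ) (hζ : ∀ t, 0 ≤ ζ t) (hζV : ∀ t ∉ V, ζ t = 0)

include hV hσ hσR hz hζ hζV

theorem exists_mem_normalizerSet (a : A) (j k : Fin n) :
    ∃ m ∈ normalizerSet (adaptedSubalgebra R),
      (∀ t ∈ V, (σ t).coord m =
        (ζ t : ℂ) • (Matrix.single j j 1 * (σ t).coord a * Matrix.single k k 1)) ∧
      ∀ t ∉ V, value m t = 0 := by
  obtain ⟨m, hmV, hm₀⟩ := exists_coord_eq_smul hn hA hV hσ (fun s hs => (hσR s hs).2) hz hζ hζV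
    (Θ := fun x => Matrix.single j j 1 * x * Matrix.single k k 1) (by fun_prop)
    (norm_single_one_mul_mul_single_one_le j k) a
  refine ⟨m, hR.mem_normalizerSet (j := j) (k := k) fun t => ?_, hmV, hm₀⟩
  by_cases ht : t ∈ V
  · refine ⟨σ t, (hσR t ht).1, (hσR t ht).2, (ζ t : ℂ) • (σ t).coord a, ?_⟩
    rw [hmV t ht, mul_smul_comm, smul_mul_assoc]
  · obtain ⟨w, hw, rfl⟩ := hR.exists_mem t
    refine ⟨w, hw, rfl, 0, ?_⟩
    rw [FrameSpace.coord_def, hm₀ _ ht, map_zero, mul_zero, zero_mul]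

/-- The matrix units of the frames `σ t` cut `z * a` into normalizers. -/
theorem mul_mem_adjoin_normalizerSet (a : A) :
    z * a ∈ NonUnitalStarAlgebra.adjoin ℂ (normalizerSet (adaptedSubalgebra R)) := by
  choose m hm hmV hm₀ using hR.exists_mem_normalizerSet hn hA hV hσ hσR hz hζ hζV a
  have hsum : z * a = ∑ j, ∑ k, m j k := by
    refine eq_of_forall_value fun t => ?_
    obtain ⟨w, rfl, hw⟩ : ∃ w : FrameSpace n A, w.base = t ∧
        ∀ j k, w.coord (m j k) =
          (ζ t : ℂ) • (Matrix.single j j 1 * w.coord a * Matrix.single k k 1) := by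
      by_cases ht : t ∈ V
      · exact ⟨σ t, (hσR t ht).2, fun j k => hmV j k t ht⟩
      · obtain ⟨w, rfl⟩ := hA.exists_base_eq hn t
        refine ⟨w, rfl, fun j k => ?_⟩
        rw [FrameSpace.coord_def, hm₀ j k _ ht, map_zero, hζV _ ht, Complex.ofReal_zero, zero_smul]
    rw [← FrameSpace.frame_coord, ← FrameSpace.frame_coord]
    simp only [map_sum, hw, ← Finset.smul_sum]
    simp only [← Finset.mul_sum, ← Finset.sum_mul, Matrix.sum_single_one, one_mul,
      mul_one, hz.coord_mul]
  rw [hsum]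
  exact sum_mem fun j _ => sum_mem fun k _ => NonUnitalStarAlgebra.subset_adjoin ℂ _ (hm j k)

end Regular

theorem topologicalClosure_adjoin_normalizerSet :
    (NonUnitalStarAlgebra.adjoin ℂ (normalizerSet (adaptedSubalgebra R))).topologicalClosure =
      ⊤ := by
  refine eq_top_iff.2 fun a _ => Metric.mem_closure_iff.2 fun ε hε => ?_
  choose V σ hV htV hσ hσR using hR.exists_section
  obtain ⟨F, z, g, hP⟩ := exists_isCentralPartition hn hA
    (isCompact_le_norm_value hn hA a (half_pos hε)) (V := V) fun t _ => ⟨hV t, htV t⟩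
  refine ⟨(∑ i ∈ F, z i) * a, ?_, ?_⟩
  · rw [Finset.sum_mul]
    exact sum_mem fun i hi => hR.mul_mem_adjoin_normalizerSet hn hA (hV i) (hσ i) (hσR i)
      (hP.isScalar i hi) (hP.nonneg i hi) (hP.eq_zero i hi) a
  · rw [dist_eq_norm]
    exact (hP.norm_sub_sum_mul_le hn hA (half_pos hε)).trans_lt (half_lt_self hε)

theorem isCartanSubalgebra : IsCartanSubalgebra (adaptedSubalgebra R) where
  maximal_abelian := hR.maximal_adaptedSubalgebra hn hA
  approximate_unit := exists_isApproximateUnit_adaptedSubalgebra hn hA R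
  regular := hR.topologicalClosure_adjoin_normalizerSet hn hA
  expectation := hR.exists_isFaithfulCondExp hn hA

end IsReduction

end OfReduction

/-! ### The fibres of a Cartan subalgebra -/

section OrthogonalElements

theorem exists_isSelfAdjoint_forall_mem_spectrum {D : Type*} [CommCStarAlgebra D]
    [FiniteDimensional ℂ D] :
    ∃ h : D, IsSelfAdjoint h ∧ ∀ i < Module.finrank ℂ D, ((i : ℂ) + 1) ∈ spectrum ℂ h := by
  let X := WeakDual.characterSpace ℂ D
  have : Finite X := Finite.of_injective (fun χ : X => WeakDual.CharacterSpace.toAlgHom χ)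
    fun χ χ' h => DFunLike.ext _ _ fun x => (DFunLike.congr_fun h x :)
  have := Fintype.ofFinite X
  have hcard : Module.finrank ℂ D ≤ Fintype.card X := by
    rw [← Module.finrank_fintype_fun_eq_card (R := ℂ)]
    exact LinearMap.finrank_le_finrank_of_injective (f := (ContinuousMap.coeFnLinearMap ℂ).comp
      (WeakDual.gelfandTransform ℂ D).toLinearMap)
      (DFunLike.coe_injective.comp (gelfandTransform_bijective D).injective)
  let e := Fintype.equivFin X
  let f : C(X, ℂ) := ⟨fun χ => (e χ : ℕ) + 1, continuous_of_discreteTopology⟩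
  have hf : IsSelfAdjoint f := ContinuousMap.ext fun χ => by simp [f]
  refine ⟨(gelfandStarTransform D).symm f, hf.map (gelfandStarTransform D).symm, fun i hi => ?_⟩
  refine WeakDual.CharacterSpace.mem_spectrum_iff_exists.2 ⟨e.symm ⟨i, hi.trans_le hcard⟩, ?_⟩
  have hχ (χ : X) : χ ((gelfandStarTransform D).symm f) = f χ :=
    DFunLike.congr_fun ((gelfandStarTransform D).apply_symm_apply f) χ
  rw [hχ]
  simp [f]

theorem exists_mem_isSelfAdjoint_forall_mem_spectrum {E : Type*} [CStarAlgebra E]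
    [FiniteDimensional ℂ E] {D : NonUnitalStarSubalgebra ℂ E}
    (hD : ∀ x ∈ D, ∀ y ∈ D, x * y = y * x) (h1 : 1 ∈ D) :
    ∃ h ∈ D, IsSelfAdjoint h ∧ ∀ i < Module.finrank ℂ D, ((i : ℝ) + 1) ∈ spectrum ℝ h := by
  let S := D.toStarSubalgebra h1
  have hcl : IsClosed (S : Set E) :=
    Submodule.closed_of_finiteDimensional (Subalgebra.toSubmodule S.toSubalgebra)
  let _ : CommCStarAlgebra S :=
    { StarSubalgebra.cstarAlgebra S with
      mul_comm := fun x y => Subtype.ext (hD x x.2 y y.2) }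
  have : FiniteDimensional ℂ S :=
    inferInstanceAs (FiniteDimensional ℂ (Subalgebra.toSubmodule S.toSubalgebra))
  obtain ⟨h, hh, hspec⟩ := exists_isSelfAdjoint_forall_mem_spectrum (D := S)
  refine ⟨h, h.2, congrArg Subtype.val hh, fun i hi => ?_⟩
  have hi' := hspec i hi
  rw [StarSubalgebra.spectrum_eq] at hi'
  rw [← spectrum.algebraMap_mem_iff ℂ]
  simpa using hi'

section Matrix

variable {m ι : Type*} [Fintype m] [Fintype ι]

theorem exists_eq_vecMulVec {P : Matrix m m ℂ} (hP : P ≠ 0) (h : ∀ Y, ∃ c : ℂ, P * Y * P = c • P) :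
    ∃ u v : m → ℂ, P = Matrix.vecMulVec u v := by
  classical
  obtain ⟨i, a, hia⟩ : ∃ i a, P i a ≠ 0 := by
    by_contra! hc
    exact hP (Matrix.ext hc)
  obtain ⟨c, hc⟩ := h (Matrix.single a i 1)
  have hmul (x y) : P x a * P i y = c * P x y := by
    rw [← mul_single_one_mul_apply, hc, Matrix.smul_apply, smul_eq_mul]
  have hc0 : c ≠ 0 := by
    rintro rfl
    exact mul_ne_zero hia hia ((hmul i a).trans (zero_mul _))
  refine ⟨fun x => c⁻¹ * P x a, fun y => P i y, Matrix.ext fun x y => ?_⟩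
  rw [Matrix.vecMulVec_apply, mul_assoc, hmul, inv_mul_cancel_left₀ hc0]

theorem card_le_card_of_one_mem_span [DecidableEq m] {P : ι → Matrix m m ℂ} (hP : ∀ i, P i ≠ 0)
    (h : ∀ i Y, ∃ c : ℂ, P i * Y * P i = c • P i) (h1 : 1 ∈ Submodule.span ℂ (Set.range P)) :
    Fintype.card m ≤ Fintype.card ι := by
  choose u v huv using fun i => exists_eq_vecMulVec (hP i) (h i)
  obtain ⟨c, hc⟩ := (Submodule.mem_span_range_iff_exists_fun ℂ).1 h1
  have htop : Submodule.span ℂ (Set.range u) = ⊤ := by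
    refine eq_top_iff.2 fun x _ => (Submodule.mem_span_range_iff_exists_fun ℂ).2
      ⟨fun i => c i * (v i ⬝ᵥ x), ?_⟩
    conv_rhs => rw [← Matrix.one_mulVec x, ← hc, Matrix.sum_mulVec]
    refine Finset.sum_congr rfl fun i _ => ?_
    rw [Matrix.smul_mulVec, huv i, Matrix.vecMulVec_mulVec, mul_smul, op_smul_eq_smul]
  have hcard := finrank_range_le_card (R := ℂ) u
  rwa [Set.finrank, htop, finrank_top, Module.finrank_fintype_fun_eq_card] at hcard

end Matrix

variable {E ι : Type*} [NonUnitalCStarAlgebra E] {P : ι → E}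
  (hs : ∀ i, star (P i) = P i) (ho : ∀ i j, i ≠ j → P i * P j = 0)

include hs ho

theorem linearIndependent_of_orthogonal (h0 : ∀ i, P i ≠ 0) : LinearIndependent ℂ P := by
  refine linearIndependent_iff'.2 fun s c hc i hi => ?_
  have hmul : (∑ j ∈ s, c j • P j) * P i = c i • (star (P i) * P i) := by
    rw [Finset.sum_mul, Finset.sum_eq_single i, smul_mul_assoc, hs]
    · intro j _ hj
      rw [smul_mul_assoc, ho j i hj, smul_zero]
    · exact absurd hi
  rw [hc, zero_mul, eq_comm, smul_eq_zero, CStarRing.star_mul_self_eq_zero_iff] at hmul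
  exact hmul.resolve_right (h0 i)

theorem exists_eq_smul_of_mul_eq_zero [Finite ι] {i : ι} {x : E}
    (hx : x ∈ Submodule.span ℂ (Set.range P)) (h : ∀ j, j ≠ i → P j * x = 0) :
    ∃ c : ℂ, x = c • P i := by
  have := Fintype.ofFinite ι
  obtain ⟨c, rfl⟩ := (Submodule.mem_span_range_iff_exists_fun ℂ).1 hx
  refine ⟨c i, Finset.sum_eq_single i (fun j _ hj => ?_) (by simp)⟩
  have hmul : P j * ∑ l, c l • P l = c j • (star (P j) * P j) := by
    rw [Finset.mul_sum, Finset.sum_eq_single j, mul_smul_comm, hs]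
    · intro l _ hl
      rw [mul_smul_comm, ho j l hl.symm, smul_zero]
    · simp
  rw [h j hj, eq_comm, smul_eq_zero, CStarRing.star_mul_self_eq_zero_iff] at hmul
  rcases hmul with hc | hP
  · rw [hc, zero_smul]
  · rw [hP, smul_zero]

end OrthogonalElements

section Projections

open Filter

theorem eventually_finrank_eq_of_tendsto {E ι : Type*} [NormedAddCommGroup E] [NormedSpace ℂ E]
    [FiniteDimensional ℂ E] {l : Filter ι} {F : ι → E →ₗ[ℂ] E} {F₀ : E →ₗ[ℂ] E}
    {S : ι → Submodule ℂ E} {S₀ : Submodule ℂ E} (hF : ∀ i, LinearMap.IsProj (S i) (F i))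
    (hF₀ : LinearMap.IsProj S₀ F₀) (h : ∀ x, Tendsto (fun i => F i x) l (𝓝 (F₀ x))) :
    ∀ᶠ i in l, Module.finrank ℂ (S i) = Module.finrank ℂ S₀ := by
  have htrace : Tendsto (fun i => LinearMap.trace ℂ E (F i)) l (𝓝 (LinearMap.trace ℂ E F₀)) := by
    let b := Module.finBasis ℂ E
    simp only [LinearMap.trace_eq_matrix_trace ℂ b, Matrix.trace, Matrix.diag_apply,
      LinearMap.toMatrix_apply]
    exact tendsto_finsetSum _ fun i _ =>
      ((LinearMap.continuous_of_finiteDimensional (b.coord i)).tendsto _).comp (h (b i))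
  simp only [(hF _).trace, hF₀.trace] at htrace
  have hre := (Complex.continuous_re.tendsto _).comp htrace
  simp only [Function.comp_def, Complex.natCast_re] at hre
  have hnat := Nat.isClosedEmbedding_coe_real.isInducing.tendsto_nhds_iff.2 hre
  rwa [nhds_discrete, tendsto_pure] at hnat

end Projections

section Fibres

open scoped Matrix.Norms.L2Operator

open PrimitiveIdeal Filter

variable {n : ℕ} {A : Type u} [NonUnitalCStarAlgebra A]

/-- The image in `M_n` of the fibre of `B` over the base point of the frame `w`. -/
noncomputable def fibreImage (B : NonUnitalStarSubalgebra ℂ A) (w : FrameSpace n A) :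
    NonUnitalStarSubalgebra ℂ (Mat n) :=
  B.map w.coord

theorem coord_mem_fibreImage {B : NonUnitalStarSubalgebra ℂ A} (w : FrameSpace n A) {b : A}
    (hb : b ∈ B) : w.coord b ∈ fibreImage B w :=
  ⟨b, hb, rfl⟩

theorem finrank_fibreImage_eq (B : NonUnitalStarSubalgebra ℂ A) {w w' : FrameSpace n A}
    (h : w.base = w'.base) :
    Module.finrank ℂ (fibreImage B w) = Module.finrank ℂ (fibreImage B w') := by
  let e : Mat n ≃ₗ[ℂ] Mat n := (FrameSpace.diff w w' h).toAlgEquiv.toLinearEquiv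
  have hmap : (fibreImage B w).toSubmodule = (fibreImage B w').toSubmodule.map e.toLinearMap := by
    ext x
    constructor
    · rintro ⟨b, hb, rfl⟩
      exact ⟨_, coord_mem_fibreImage w' hb, FrameSpace.diff_coord w w' h b⟩
    · rintro ⟨_, ⟨b, hb, rfl⟩, rfl⟩
      exact ⟨b, hb, (FrameSpace.diff_coord w w' h b).symm⟩
  exact (congrArg (fun S : Submodule ℂ (Mat n) => Module.finrank ℂ S) hmap).trans
    (LinearEquiv.finrank_map_eq e _)

theorem exists_isSelfAdjoint_of_mem_fibreImage {B : NonUnitalStarSubalgebra ℂ A}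
    {w : FrameSpace n A} {x : Mat n} (hx : x ∈ fibreImage B w) (hxs : IsSelfAdjoint x) :
    ∃ h ∈ B, IsSelfAdjoint h ∧ w.coord h = x := by
  obtain ⟨a, ha, rfl⟩ := hx
  refine ⟨realPart a, ?_, (realPart a).2, ?_⟩
  · rw [realPart_apply_coe, ← Complex.coe_smul]
    exact SMulMemClass.smul_mem _ (add_mem ha (star_mem ha))
  · change w.coord _ = w.coord a
    rw [map_realPart]
    exact hxs.coe_realPart

namespace IsCartanSubalgebra

variable {B : NonUnitalStarSubalgebra ℂ A} (hB : IsCartanSubalgebra B)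

include hB

theorem isClosed : IsClosed (B : Set A) := hB.maximal_abelian.1.1

theorem mul_comm {x y : A} (hx : x ∈ B) (hy : y ∈ B) : x * y = y * x :=
  hB.maximal_abelian.1.2 x hx y hy

theorem mem_of_isSelfAdjoint_of_commute {x : A} (hx : IsSelfAdjoint x)
    (h : ∀ b ∈ B, Commute b x) : x ∈ B := by
  let S : Set A := insert x B
  let C := NonUnitalStarSubalgebra.centralizer ℂ
    (NonUnitalStarSubalgebra.centralizer ℂ S : Set A)
  have hstar : star S = S := by
    rw [← Set.image_star, Set.image_insert_eq, Set.image_star, hx.star_eq, StarMemClass.star_coe_eq]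
  have hC : (C : Set A) = S.centralizer.centralizer := by
    rw [NonUnitalStarSubalgebra.coe_centralizer_centralizer, hstar, Set.union_self]
  have hcomm : ∀ a ∈ S, ∀ b ∈ S, a * b = b * a := by
    rintro a (rfl | ha) b (rfl | hb)
    exacts [rfl, (h b hb).symm, h a ha, hB.mul_comm ha hb]
  have hSC : S ⊆ C := hC ▸ Set.subset_centralizer_centralizer
  refine hB.maximal_abelian.2 (y := C) ⟨hC ▸ Set.isClosed_centralizer _, fun a ha b hb => ?_⟩
    (fun b hb => hSC (Set.mem_insert_of_mem x hb)) (hSC (Set.mem_insert x _))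
  rw [← SetLike.mem_coe, hC] at ha hb
  exact Set.centralizer_centralizer_comm_of_comm hcomm a ha b hb

theorem mem_of_commute {x : A} (h : ∀ b ∈ B, Commute b x) : x ∈ B := by
  have hstar : ∀ b ∈ B, Commute b (star x) := fun b hb => by
    simpa using (h _ (star_mem hb)).star_star
  rw [← realPart_add_I_smul_imaginaryPart x]
  refine add_mem (hB.mem_of_isSelfAdjoint_of_commute (realPart x).2 fun b hb => ?_)
    (SMulMemClass.smul_mem _
      (hB.mem_of_isSelfAdjoint_of_commute (imaginaryPart x).2 fun b hb => ?_))
  · rw [realPart_apply_coe]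
    exact ((h b hb).add_right (hstar b hb)).smul_right _
  · rw [imaginaryPart_apply_coe]
    exact (((h b hb).sub_right (hstar b hb)).smul_right _).smul_right _

open scoped CStarAlgebra in
theorem one_mem_fibreImage (w : FrameSpace n A) : 1 ∈ fibreImage B w := by
  obtain ⟨l, hl, hlB⟩ := hB.approximate_unit
  have := hl.neBot
  obtain ⟨a, ha⟩ := w.coord_surjective 1
  have hlim : Tendsto (fun e => w.coord e) l (𝓝 1) := by
    have hea := ((map_continuous w.coord).tendsto a).comp (hl.tendsto_mul_right a)
    rw [ha] at hea
    refine hea.congr fun e => ?_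
    rw [Function.comp_apply, map_mul, ha, mul_one]
  exact (Submodule.closed_of_finiteDimensional (fibreImage B w).toSubmodule).mem_of_tendsto hlim
    (hlB.mono fun e he => coord_mem_fibreImage w he)

theorem fibreImage_mul_comm (w : FrameSpace n A) {x y : Mat n} (hx : x ∈ fibreImage B w)
    (hy : y ∈ fibreImage B w) : x * y = y * x := by
  obtain ⟨a, ha, rfl⟩ := hx
  obtain ⟨b, hb, rfl⟩ := hy
  exact (map_mul w.coord a b).symm.trans
    ((congrArg w.coord (hB.mul_comm ha hb)).trans (map_mul w.coord b a))

variable (hn : 1 ≤ n) (hA : IsHomogeneous n A)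

include hn hA

theorem isScalar_mem {z : A} {ζ : PrimitiveIdeal A → ℝ} (hz : IsScalar n z ζ) : z ∈ B :=
  hB.mem_of_commute fun b _ => (hz.mul_comm hn hA b).symm

theorem coord_condExp_eq_zero {E : A →ₗ[ℂ] B} (hE : IsFaithfulCondExp B E) {w : FrameSpace n A}
    {a : A} (ha : w.coord a = 0) : w.coord (E a) = 0 := by
  refine norm_le_zero_iff.1 (le_of_forall_pos_le_add fun ε hε => ?_)
  have := hA.t1Space hn
  obtain ⟨z, ζ, hz, hζ, hza⟩ := exists_isScalar_mul_approx hn hA a hε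
    (isOpen_compl_singleton (x := w.base)) (by
      rintro t ht rfl
      rw [FrameSpace.norm_value, ha, norm_zero] at ht
      exact ht.not_gt hε)
  have hEz : (E (a - z * a) : A) = E a - z * (E a : A) := by
    rw [map_sub, hE.map_mul_left ⟨z, hB.isScalar_mem hn hA hz⟩ a]
    rfl
  calc ‖w.coord (E a)‖ = ‖w.coord (E (a - z * a))‖ := by
        rw [hEz, map_sub, hz.coord_mul, hζ _ (fun h => h rfl), Complex.ofReal_zero, zero_smul,
          sub_zero]
    _ ≤ ‖a - z * a‖ := (NonUnitalStarAlgHom.norm_apply_le w.coord _).trans (hE.norm_le _)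
    _ ≤ 0 + ε := by rwa [zero_add]

theorem exists_isProj_fibreImage {E : A →ₗ[ℂ] B} (hE : IsFaithfulCondExp B E)
    (w : FrameSpace n A) :
    ∃ F : Mat n →ₗ[ℂ] Mat n, (∀ a, F (w.coord a) = w.coord (E a)) ∧ (∀ x, ‖F x‖ ≤ ‖x‖) ∧
      LinearMap.IsProj (fibreImage B w).toSubmodule F := by
  obtain ⟨s, hs⟩ := LinearMap.exists_rightInverse_of_surjective (w.coord : A →ₗ[ℂ] Mat n)
    (LinearMap.range_eq_top.2 w.coord_surjective)
  let F : Mat n →ₗ[ℂ] Mat n := (w.coord : A →ₗ[ℂ] Mat n) ∘ₗ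
    (NonUnitalStarSubalgebraClass.subtype B : B →ₗ[ℂ] A) ∘ₗ E ∘ₗ s
  have hF (a : A) : F (w.coord a) = w.coord (E a) := by
    have hsa : w.coord (s (w.coord a) - a) = 0 := by
      rw [map_sub, sub_eq_zero]
      exact LinearMap.congr_fun hs (w.coord a)
    have hE0 := hB.coord_condExp_eq_zero hn hA hE hsa
    rw [map_sub] at hE0
    exact sub_eq_zero.1 ((map_sub w.coord _ _).symm.trans hE0)
  refine ⟨F, hF, fun x => ?_, fun x => coord_mem_fibreImage w (E (s x)).2, ?_⟩
  · obtain ⟨a, rfl⟩ := w.coord_surjective x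
    obtain ⟨a', haa', ha'⟩ := exists_map_eq_norm_le w.coord a
    rw [← haa', hF]
    exact (NonUnitalStarAlgHom.norm_apply_le w.coord _).trans ((hE.norm_le _).trans (haa' ▸ ha'))
  · rintro _ ⟨b, hb, rfl⟩
    exact (hF b).trans (congrArg (fun c : B => w.coord c) (hE.map_coe ⟨b, hb⟩))

theorem eventually_finrank_fibreImage_eq (w₀ : FrameSpace n A) :
    ∀ᶠ t in 𝓝 w₀.base, ∀ w : FrameSpace n A, w.base = t →
      Module.finrank ℂ (fibreImage B w) = Module.finrank ℂ (fibreImage B w₀) := by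
  obtain ⟨E, hE⟩ := hB.expectation
  choose F hF hFn hFp using hB.exists_isProj_fibreImage hn hA hE
  choose w hw using hA.exists_base_eq hn
  refine mem_iff_ultrafilter.2 fun 𝒰 h𝒰 => ?_
  obtain ⟨w₁, hb₁, hlim⟩ := FrameSpace.exists_tendsto hn hA 𝒰 w (t := w₀.base) (by
    simp only [hw]
    exact h𝒰)
  have hFt (x : Mat n) : Tendsto (fun t => F (w t) x) 𝒰 (𝓝 (F w₁ x)) := by
    obtain ⟨a, rfl⟩ := w₁.coord_surjective x
    rw [FrameSpace.tendsto_nhds_iff] at hlim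
    have hsmall : Tendsto (fun t => F (w t) (w₁.coord a - (w t).coord a)) 𝒰 (𝓝 0) := by
      refine squeeze_zero_norm (fun t => hFn _ _) ?_
      simpa using ((hlim a).const_sub (w₁.coord a)).norm
    have hsum := hsmall.add (hlim (E a))
    rw [zero_add, ← hF] at hsum
    refine hsum.congr fun t => ?_
    rw [map_sub, hF (w t), sub_add_cancel]
  filter_upwards [eventually_finrank_eq_of_tendsto (fun t => hFp (w t)) (hFp w₁) hFt]
    with t ht w' hw'
  exact (finrank_fibreImage_eq B (hw'.trans (hw t).symm)).trans
    (ht.trans (finrank_fibreImage_eq B hb₁))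

end IsCartanSubalgebra

end Fibres

section OrthogonalBases

open scoped Matrix.Norms.L2Operator

open PrimitiveIdeal Filter

variable {n : ℕ} {A : Type u} [NonUnitalCStarAlgebra A]

/-- `p` is a family of mutually orthogonal self-adjoint elements of `B` whose values at each point
of `V` form a basis of the fibre of `B`. -/
structure IsOrthogonalBasisOn (n : ℕ) (B : NonUnitalStarSubalgebra ℂ A)
    (V : Set (PrimitiveIdeal A)) {ι : Type*} (p : ι → A) : Prop where
  mem : ∀ i, p i ∈ B
  star_eq : ∀ i, star (p i) = p i
  mul_eq_zero : ∀ i j, i ≠ j → p i * p j = 0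
  coord_ne_zero : ∀ w : FrameSpace n A, w.base ∈ V → ∀ i, w.coord (p i) ≠ 0
  span_eq : ∀ w : FrameSpace n A, w.base ∈ V →
    Submodule.span ℂ (Set.range fun i => w.coord (p i)) = (fibreImage B w).toSubmodule

namespace IsOrthogonalBasisOn

variable {B : NonUnitalStarSubalgebra ℂ A} {V : Set (PrimitiveIdeal A)} {ι : Type*} {p : ι → A}

theorem of_finrank_eq [Fintype ι] (hp : ∀ i, p i ∈ B) (hs : ∀ i, star (p i) = p i)
    (ho : ∀ i j, i ≠ j → p i * p j = 0)
    (h0 : ∀ w : FrameSpace n A, w.base ∈ V → ∀ i, w.coord (p i) ≠ 0)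
    (hcard : ∀ w : FrameSpace n A, w.base ∈ V →
      Module.finrank ℂ (fibreImage B w) = Fintype.card ι) :
    IsOrthogonalBasisOn n B V p := by
  refine ⟨hp, hs, ho, h0, fun w hw => Submodule.eq_of_le_of_finrank_eq ?_ ?_⟩
  · rw [Submodule.span_le]
    rintro _ ⟨i, rfl⟩
    exact coord_mem_fibreImage w (hp i)
  · have hli : LinearIndependent ℂ fun i => w.coord (p i) :=
      linearIndependent_of_orthogonal (fun i => by rw [← map_star, hs])
        (fun i j hij => by rw [← map_mul, ho i j hij, map_zero]) (h0 w hw)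
    exact (finrank_span_eq_card hli).trans (hcard w hw).symm

variable (hp : IsOrthogonalBasisOn n B V p) [Finite ι]

include hp

theorem exists_eq_smul {w : FrameSpace n A} (hw : w.base ∈ V) {i : ι} {x : Mat n}
    (hx : x ∈ fibreImage B w) (h : ∀ j, j ≠ i → w.coord (p j) * x = 0) :
    ∃ c : ℂ, x = c • w.coord (p i) :=
  exists_eq_smul_of_mul_eq_zero (P := fun i => w.coord (p i))
    (fun i => by rw [← map_star, hp.star_eq])
    (fun i j hij => by rw [← map_mul, hp.mul_eq_zero i j hij, map_zero])
    (by rw [hp.span_eq w hw]; exact hx) h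

variable (hB : IsCartanSubalgebra B)

include hB

theorem exists_mul_coord_eq_smul {w : FrameSpace n A} (hw : w.base ∈ V) (i : ι) {x : Mat n}
    (hx : x ∈ fibreImage B w) : ∃ c : ℂ, x * w.coord (p i) = c • w.coord (p i) := by
  have hpi (j : ι) : w.coord (p j) ∈ fibreImage B w := coord_mem_fibreImage w (hp.mem j)
  refine hp.exists_eq_smul hw (mul_mem hx (hpi i)) fun j hj => ?_
  rw [← mul_assoc, hB.fibreImage_mul_comm w (hpi j) hx, mul_assoc, ← map_mul,
    hp.mul_eq_zero j i hj, map_zero, mul_zero]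

variable (hn : 1 ≤ n) (hA : IsHomogeneous n A)

include hn hA

/-- `B` acts by scalars on the corner of `p i`, so that the corner, cut down to `V`, commutes with
`B`. -/
theorem mul_mul_mul_mem (i : ι) (y : A) {z : A} {ζ : PrimitiveIdeal A → ℝ}
    (hz : IsScalar n z ζ) (hζV : ∀ t ∉ V, ζ t = 0) : z * (p i * y * p i) ∈ B := by
  refine hB.mem_of_commute fun b hb => eq_of_forall_coord hn hA fun w => ?_
  by_cases hw : w.base ∈ V
  · obtain ⟨c, hc⟩ := hp.exists_mul_coord_eq_smul hB hw i (coord_mem_fibreImage w hb)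
    have hc' : w.coord (p i) * w.coord b = c • w.coord (p i) := by
      rw [← map_mul, hB.mul_comm (hp.mem i) hb, map_mul, hc]
    rw [map_mul, map_mul _ _ b, hz.coord_mul, map_mul, map_mul, mul_smul_comm, smul_mul_assoc,
      mul_assoc _ _ (w.coord b), hc', ← mul_assoc, ← mul_assoc, hc, mul_smul_comm, smul_mul_assoc,
      smul_mul_assoc]
  · rw [map_mul, map_mul _ _ b, hz.coord_mul, hζV _ hw, Complex.ofReal_zero, zero_smul, mul_zero,
      zero_mul]

theorem coord_mul_mul_coord_mem (hV : IsOpen V) {w : FrameSpace n A} (hw : w.base ∈ V) (i : ι)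
    (Y : Mat n) : w.coord (p i) * Y * w.coord (p i) ∈ fibreImage B w := by
  obtain ⟨z, ζ, hz, -, hζ0, hζV⟩ := exists_isScalar hn hA hV hw
  obtain ⟨y, rfl⟩ := w.coord_surjective Y
  have hmem := coord_mem_fibreImage w (hp.mul_mul_mul_mem hB hn hA i y hz hζV)
  rw [hz.coord_mul, map_mul, map_mul] at hmem
  exact (Submodule.smul_mem_iff (fibreImage B w).toSubmodule
    (Complex.ofReal_ne_zero.2 hζ0.ne')).1 hmem

end IsOrthogonalBasisOn

theorem IsOrthogonalBasisOn.le_card {B : NonUnitalStarSubalgebra ℂ A} {V : Set (PrimitiveIdeal A)}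
    {ι : Type*} [Fintype ι] {p : ι → A} (hp : IsOrthogonalBasisOn n B V p)
    (hB : IsCartanSubalgebra B) (hn : 1 ≤ n) (hA : IsHomogeneous n A) (hV : IsOpen V)
    (hne : V.Nonempty) : n ≤ Fintype.card ι := by
  obtain ⟨t, ht⟩ := hne
  obtain ⟨w, rfl⟩ := hA.exists_base_eq hn t
  rw [← Fintype.card_fin n]
  refine card_le_card_of_one_mem_span (hp.coord_ne_zero w ht) (fun i Y => ?_)
    (by rw [hp.span_eq w ht]; exact hB.one_mem_fibreImage w)
  refine hp.exists_eq_smul ht (hp.coord_mul_mul_coord_mem hB hn hA hV ht i Y) fun j hj => ?_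
  rw [← mul_assoc, ← mul_assoc, ← map_mul, hp.mul_eq_zero j i hj, map_zero, zero_mul, zero_mul]

namespace IsCartanSubalgebra

variable {B : NonUnitalStarSubalgebra ℂ A} (hB : IsCartanSubalgebra B) (hn : 1 ≤ n)
  (hA : IsHomogeneous n A)

include hB hn hA

theorem exists_isOrthogonalBasisOn (t : PrimitiveIdeal A) :
    ∃ (k : ℕ) (p : Fin k → A) (V : Set (PrimitiveIdeal A)), IsOpen V ∧ t ∈ V ∧
      IsOrthogonalBasisOn n B V p := by
  obtain ⟨w₀, rfl⟩ := hA.exists_base_eq hn t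
  obtain ⟨x, hx, hxs, hspec⟩ := exists_mem_isSelfAdjoint_forall_mem_spectrum
    (fun _ hx _ hy => hB.fibreImage_mul_comm w₀ hx hy) (hB.one_mem_fibreImage w₀)
  obtain ⟨h, hhB, hh, rfl⟩ := exists_isSelfAdjoint_of_mem_fibreImage hx hxs
  let p (i : Fin (Module.finrank ℂ (fibreImage B w₀))) : A := bump i h
  have hp₀ (i) : p i ∉ w₀.base.toSubmodule := by
    rw [← FrameSpace.coord_eq_zero_iff, map_bump w₀.coord i hh]
    exact bump_ne_zero (hh.map w₀.coord) (hspec i i.2)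
  have hev : ∀ᶠ t in 𝓝 w₀.base, ∀ i, p i ∉ t.toSubmodule :=
    eventually_all.2 fun i =>
      (isOpen_setOf_notMem (p i)).mem_nhds (hp₀ i)
  obtain ⟨V, hV, hVo, htV⟩ :=
    eventually_nhds_iff.1 (hev.and (hB.eventually_finrank_fibreImage_eq hn hA w₀))
  have hcl := hB.isClosed
  refine ⟨_, p, V, hVo, htV, .of_finrank_eq (fun i => cfcₙ_mem (𝕜' := ℂ) _ hhB)
    (fun i => star_bump _ _) (fun i j hij => bump_mul_bump h (Fin.val_ne_of_ne hij))
    (fun w hw i => ?_) fun w hw => ?_⟩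
  · rw [Ne, FrameSpace.coord_eq_zero_iff]
    exact (hV _ hw).1 i
  · rw [Fintype.card_fin]
    exact (hV _ hw).2 w rfl

theorem exists_orthogonal_notMem (t : PrimitiveIdeal A) :
    ∃ p : Fin n → A, (∀ i, p i ∈ B) ∧ (∀ i, star (p i) = p i) ∧
      (∀ i j, i ≠ j → p i * p j = 0) ∧ ∀ i, p i ∉ t.toSubmodule := by
  obtain ⟨k, p, V, hV, htV, hp⟩ := hB.exists_isOrthogonalBasisOn hn hA t
  have hnk : n ≤ k := by simpa using hp.le_card hB hn hA hV ⟨t, htV⟩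
  obtain ⟨w, rfl⟩ := hA.exists_base_eq hn t
  exact ⟨fun i => p (Fin.castLE hnk i), fun i => hp.mem _, fun i => hp.star_eq _,
    fun i j hij => hp.mul_eq_zero _ _ ((Fin.castLE_injective hnk).ne hij),
    fun i hi => hp.coord_ne_zero w htV _ ((FrameSpace.coord_eq_zero_iff w _).2 hi)⟩

end IsCartanSubalgebra

end OrthogonalBases

/-! ### The reduction given by a Cartan subalgebra -/

section NormalizedFrames

open scoped Matrix.Norms.L2Operator ComplexOrder

open PrimitiveIdeal Filter

section Matrix

variable {m : Type*} [Fintype m] [DecidableEq m]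

theorem norm_matrix_single {𝕜 : Type*} [RCLike 𝕜] (i j : m) (c : 𝕜) :
    ‖Matrix.single i j c‖ = ‖c‖ := by
  have h := CStarRing.norm_self_mul_star (x := Matrix.single i j c)
  rw [Matrix.star_eq_conjTranspose, Matrix.conjTranspose_single, Matrix.single_mul_single_same,
    ← Matrix.diagonal_single, Matrix.l2_opNorm_diagonal, Pi.norm_single,
    CStarRing.norm_self_mul_star] at h
  exact (mul_self_inj (norm_nonneg _) (norm_nonneg _)).1 h.symm

end Matrix

variable {n : ℕ}

theorem exists_symm_single_eq (u : Fin n → unitary ℂ) : ∃ g : AutMat n, ∀ i j (x : ℂ),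
    g.symm (Matrix.single i j x) = Matrix.single i j (star (u i : ℂ) * x * u j) := by
  have hU : Matrix.diagonal (fun i => (u i : ℂ)) ∈ unitary (Mat n) := by
    rw [Unitary.mem_iff, Matrix.star_eq_conjTranspose, Matrix.diagonal_conjTranspose,
      Matrix.diagonal_mul_diagonal, Matrix.diagonal_mul_diagonal, ← Matrix.diagonal_one]
    exact ⟨congrArg _ (funext fun i => Unitary.coe_star_mul_self (u i)),
      congrArg _ (funext fun i => Unitary.coe_mul_star_self (u i))⟩
  refine ⟨Unitary.conjStarAlgAut ℂ (Mat n) ⟨_, hU⟩, fun i j x => ?_⟩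
  change star (Matrix.diagonal fun i => (u i : ℂ)) * Matrix.single i j x *
    Matrix.diagonal (fun i => (u i : ℂ)) = _
  rw [Matrix.star_eq_conjTranspose, Matrix.diagonal_conjTranspose]
  ext k l
  rw [Matrix.mul_diagonal, Matrix.diagonal_mul]
  by_cases hk : i = k ∧ j = l
  · obtain ⟨rfl, rfl⟩ := hk
    simp
  · simp [hk]

theorem autMat_eq_one_of_map_single {g : AutMat n} {i₀ : Fin n}
    (h : ∀ i, g (Matrix.single i i₀ 1) = Matrix.single i i₀ 1) : g = 1 := by
  have hunit (i j : Fin n) : g (Matrix.single i j 1) = Matrix.single i j 1 := by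
    have e : (Matrix.single i j 1 : Mat n) =
        Matrix.single i i₀ 1 * star (Matrix.single j i₀ 1) := by
      rw [Matrix.star_eq_conjTranspose, Matrix.conjTranspose_single, star_one,
        Matrix.single_mul_single_same, mul_one]
    rw [e, map_mul, map_star, h, h]
  refine StarAlgEquiv.ext fun x => ?_
  have e : x = ∑ i, ∑ j, x i j • (Matrix.single i j 1 : Mat n) := by
    simpa only [Matrix.smul_single, smul_eq_mul, mul_one] using Matrix.matrix_eq_sum_single x
  rw [e]
  simp only [map_sum, map_smul, hunit]
  rfl

variable {A : Type u} [NonUnitalCStarAlgebra A] {v : Fin n → A} {i₀ : Fin n}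

/-- The frames in which the elements `v i` are nonnegative multiples of the matrix units
`e_{i i₀}`. -/
def IsNormalizedFrame (v : Fin n → A) (i₀ : Fin n) (w : FrameSpace n A) : Prop :=
  ∀ i, w.coord (v i) = (‖w.coord (v i)‖ : ℂ) • Matrix.single i i₀ 1

theorem IsNormalizedFrame.eq {w w' : FrameSpace n A} (hw : IsNormalizedFrame v i₀ w)
    (hw' : IsNormalizedFrame v i₀ w') (h : w.base = w'.base)
    (hv : ∀ i, v i ∉ w.base.toSubmodule) : w = w' := by
  have hdiff : FrameSpace.diff w w' h = 1 := by
    refine autMat_eq_one_of_map_single (i₀ := i₀) fun i => ?_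
    have hne : (‖w.coord (v i)‖ : ℂ) ≠ 0 := by
      rw [Complex.ofReal_ne_zero, norm_ne_zero_iff, Ne, FrameSpace.coord_eq_zero_iff]
      exact hv i
    have hnorm : ‖w'.coord (v i)‖ = ‖w.coord (v i)‖ := by
      rw [← FrameSpace.norm_value, ← FrameSpace.norm_value, h]
    have hi := FrameSpace.diff_coord w w' h (v i)
    rw [hw i, hw' i, hnorm, map_smul] at hi
    exact smul_right_injective _ hne hi
  rw [← FrameSpace.smul_diff w w' h, hdiff, MulOpposite.op_one, one_smul]

theorem isClosed_isNormalizedFrame : IsClosed {w : FrameSpace n A | IsNormalizedFrame v i₀ w} := by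
  have hc (i : Fin n) := FrameSpace.continuous_coord (n := n) (v i)
  simp only [IsNormalizedFrame, Set.ofPred_forall]
  exact isClosed_iInter fun i => isClosed_eq (hc i)
    ((Complex.continuous_ofReal.comp (hc i).norm).smul continuous_const)

/-- The frame is conjugated by the diagonal unitary formed by the phases of `γ`. -/
theorem FrameSpace.exists_isNormalizedFrame {w : FrameSpace n A} {γ : Fin n → ℂ}
    (hv : ∀ i, w.coord (v i) = Matrix.single i i₀ (γ i)) (hγ : ∀ i, γ i ≠ 0) (hγ₀ : 0 ≤ γ i₀) :
    ∃ w' : FrameSpace n A, w'.base = w.base ∧ IsNormalizedFrame v i₀ w' ∧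
      ∀ a i c, w.coord a = Matrix.single i i c → w'.coord a = Matrix.single i i c := by
  have hu (i) : γ i / ‖γ i‖ ∈ unitary ℂ := by
    rw [Unitary.mem_iff_self_mul_star, Complex.star_def, Complex.mul_conj', norm_div,
      Complex.norm_real, norm_norm, div_self (norm_ne_zero_iff.2 (hγ i)), Complex.ofReal_one,
      one_pow]
  let u (i : Fin n) : unitary ℂ := ⟨γ i / ‖γ i‖, hu i⟩
  have hu₀ : (u i₀ : ℂ) = 1 := by
    simp only [u]
    rw [Complex.norm_of_nonneg' hγ₀, div_self (hγ i₀)]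
  have huγ (i) : star (u i : ℂ) * γ i = ‖γ i‖ := by
    have h : γ i = u i * ‖γ i‖ := (div_mul_cancel₀ _ (by simpa using hγ i)).symm
    rw [h, ← mul_assoc, Unitary.coe_star_mul_self, one_mul, ← h]
  obtain ⟨g, hg⟩ := exists_symm_single_eq u
  refine ⟨MulOpposite.op g • w, rfl, fun i => ?_, fun a i c ha => ?_⟩
  · rw [FrameSpace.coord_smul, hv, hg, huγ, hu₀, mul_one, norm_matrix_single, Complex.norm_real,
      norm_norm, Matrix.smul_single, smul_eq_mul, mul_one]
  · rw [FrameSpace.coord_smul, ha, hg, mul_right_comm, Unitary.coe_star_mul_self, one_mul]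

theorem FrameSpace.exists_isNormalizedFrame_of_orthogonal {p a : Fin n → A}
    (hs : ∀ i, star (p i) = p i) (ho : ∀ i j, i ≠ j → p i * p j = 0)
    (ha : a i₀ = p i₀ * p i₀) (w : FrameSpace n A)
    (h0 : ∀ i, p i * a i * p i₀ ∉ w.base.toSubmodule) :
    ∃ w' : FrameSpace n A, w'.base = w.base ∧
      IsNormalizedFrame (fun i => p i * a i * p i₀) i₀ w' ∧
      ∃ c : Fin n → ℂ, (∀ i, c i ≠ 0) ∧ ∀ i, w'.coord (p i) = Matrix.single i i (c i) := by
  obtain ⟨w₁, hb, c, hc, hw₁⟩ := w.exists_coord_eq_single hs ho fun i hi =>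
    h0 i (w.base.mul_mem_right _ (w.base.mul_mem_right _ ((w.coord_eq_zero_iff _).1 hi)))
  let γ (i : Fin n) : ℂ := c i * w₁.coord (a i) i i₀ * c i₀
  have hv (i) : w₁.coord (p i * a i * p i₀) = Matrix.single i i₀ (γ i) := by
    rw [map_mul, map_mul, hw₁, hw₁, Matrix.single_mul_mul_single]
  have hγ (i) : γ i ≠ 0 := fun hi => by
    refine h0 i ?_
    rw [← hb, ← FrameSpace.coord_eq_zero_iff, hv, hi, Matrix.single_zero]
  have hγ₀ : 0 ≤ γ i₀ := by
    have hstar : p i₀ * a i₀ * p i₀ = star (p i₀ * p i₀) * (p i₀ * p i₀) := by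
      rw [ha, star_mul, hs, mul_assoc, mul_assoc, mul_assoc]
    rw [← Matrix.single_apply_same i₀ i₀ (γ i₀), ← hv, hstar, map_mul, map_star]
    exact (Matrix.posSemidef_conjTranspose_mul_self _).diag_nonneg
  obtain ⟨w', hb', hw', hdiag⟩ := FrameSpace.exists_isNormalizedFrame hv hγ hγ₀
  exact ⟨w', hb'.trans hb, hw', c, hc, fun i => hdiag _ _ _ (hw₁ i)⟩

variable (hn : 1 ≤ n) (hA : IsHomogeneous n A)

include hn hA

theorem continuousOn_of_isNormalizedFrame {V : Set (PrimitiveIdeal A)} (hV : IsOpen V)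
    (hvV : ∀ t ∈ V, ∀ i, v i ∉ t.toSubmodule) {σ : PrimitiveIdeal A → FrameSpace n A}
    (hσ : ∀ t, (σ t).base = t) (hσv : ∀ t ∈ V, IsNormalizedFrame v i₀ (σ t)) :
    ContinuousOn σ V := by
  refine fun t ht => ContinuousAt.continuousWithinAt ?_
  refine (tendsto_iff_ultrafilter _ _ _).2 fun 𝒰 h𝒰 => ?_
  obtain ⟨w, rfl, hw⟩ := FrameSpace.exists_tendsto hn hA 𝒰 σ (t := t) (by
    simp only [hσ]
    exact h𝒰)
  have hnormalized : IsNormalizedFrame v i₀ w :=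
    isClosed_isNormalizedFrame.mem_of_tendsto hw <|
      mem_of_superset (h𝒰 (hV.mem_nhds ht)) fun s hs => hσv s hs
  have hwσ : w = σ w.base := hnormalized.eq (hσv _ ht) (hσ _).symm (hvV _ ht)
  exact hwσ ▸ hw

theorem mul_self_notMem {t : PrimitiveIdeal A} {q : A} (hq : star q = q)
    (hqt : q ∉ t.toSubmodule) : q * q ∉ t.toSubmodule := by
  obtain ⟨w, rfl⟩ := hA.exists_base_eq hn t
  rw [← FrameSpace.coord_eq_zero_iff] at hqt ⊢
  nth_rw 1 [← hq]
  rwa [map_mul, map_star, CStarRing.star_mul_self_eq_zero_iff]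

theorem exists_mul_mul_notMem_of_star_eq {t : PrimitiveIdeal A} {p : Fin n → A}
    (hs : ∀ i, star (p i) = p i) (hp : ∀ i, p i ∉ t.toSubmodule) (i₀ : Fin n) :
    ∃ a : Fin n → A, a i₀ = p i₀ * p i₀ ∧ ∀ i, p i * a i * p i₀ ∉ t.toSubmodule := by
  choose a ha using fun i => exists_mul_mul_notMem hn hA t (hp i) (hp i₀)
  refine ⟨Function.update a i₀ (p i₀ * p i₀), Function.update_self _ _ _, fun i => ?_⟩
  rcases eq_or_ne i i₀ with rfl | hi
  · have hsq : star (p i * p i) = p i * p i := by rw [star_mul, hs]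
    rw [Function.update_self, ← mul_assoc, mul_assoc]
    exact mul_self_notMem hn hA hsq (mul_self_notMem hn hA (hs i) (hp i))
  · rw [Function.update_of_ne hi]
    exact ha i

end NormalizedFrames

section OfCartan

open PrimitiveIdeal

variable {n : ℕ} {A : Type u} [NonUnitalCStarAlgebra A] {B : NonUnitalStarSubalgebra ℂ A}

/-- The frames which carry the diagonal matrices onto the fibre of `B`. -/
def adaptedFrames (n : ℕ) (B : NonUnitalStarSubalgebra ℂ A) : Set (FrameSpace n A) :=
  {w | ∀ x : Mat n, x.IsDiag ↔ x ∈ fibreImage B w}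

theorem smul_mem_adaptedFrames {w : FrameSpace n A} (hw : w ∈ adaptedFrames n B) {g : AutMat n}
    (hg : g ∈ autDiag n) : MulOpposite.op g • w ∈ adaptedFrames n B := by
  intro x
  have hdiag : x.IsDiag ↔ (g x).IsDiag :=
    ⟨isDiag_map hg, fun h => g.symm_apply_apply x ▸ isDiag_map (inv_mem hg) h⟩
  rw [hdiag, hw]
  exact exists_congr fun b => and_congr_right fun _ => g.symm_apply_eq.symm

theorem diff_mem_autDiag {w w' : FrameSpace n A} (hw : w ∈ adaptedFrames n B)
    (hw' : w' ∈ adaptedFrames n B) (h : w.base = w'.base) :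
    FrameSpace.diff w w' h ∈ autDiag n := by
  change (fun x => FrameSpace.diff w w' h x) '' diagMat n = diagMat n
  ext y
  constructor
  · rintro ⟨x, hx, rfl⟩
    obtain ⟨b, hb, rfl⟩ := (hw' x).1 hx
    exact (hw _).2 ⟨b, hb, (FrameSpace.diff_coord w w' h b).symm⟩
  · intro hy
    obtain ⟨b, hb, rfl⟩ := (hw y).1 hy
    exact ⟨w'.coord b, (hw' _).2 ⟨b, hb, rfl⟩, FrameSpace.diff_coord w w' h b⟩

theorem mem_adaptedFrames_of_coord {w : FrameSpace n A}
    (hB : ∀ x ∈ fibreImage B w, ∀ y ∈ fibreImage B w, x * y = y * x) {p : Fin n → A}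
    (hp : ∀ i, p i ∈ B) {c : Fin n → ℂ} (hc : ∀ i, c i ≠ 0)
    (h : ∀ i, w.coord (p i) = Matrix.single i i (c i)) : w ∈ adaptedFrames n B := by
  have hsingle (i : Fin n) (a : ℂ) : Matrix.single i i a ∈ fibreImage B w := by
    have e : Matrix.single i i a = (a * (c i)⁻¹) • w.coord (p i) := by
      rw [h, Matrix.smul_single, smul_eq_mul, inv_mul_cancel_right₀ (hc i)]
    exact e ▸ SMulMemClass.smul_mem _ (coord_mem_fibreImage w (hp i))
  refine fun x => ⟨fun hx => ?_, fun hx => isDiag_of_commute_single fun i =>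
    hB _ hx _ (hsingle i 1)⟩
  rw [← hx.diagonal_diag, ← Matrix.sum_single_eq_diagonal]
  exact sum_mem fun i _ => hsingle i _

namespace IsCartanSubalgebra

variable (hB : IsCartanSubalgebra B) (hn : 1 ≤ n) (hA : IsHomogeneous n A)

include hB hn hA

theorem exists_section_adaptedFrames (t : PrimitiveIdeal A) :
    ∃ (V : Set (PrimitiveIdeal A)) (σ : PrimitiveIdeal A → FrameSpace n A), IsOpen V ∧ t ∈ V ∧
      ContinuousOn σ V ∧ ∀ s ∈ V, σ s ∈ adaptedFrames n B ∧ (σ s).base = s := by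
  obtain ⟨p, hpB, hs, ho, hp⟩ := hB.exists_orthogonal_notMem hn hA t
  let i₀ : Fin n := ⟨0, hn⟩
  obtain ⟨a, ha, hat⟩ := exists_mul_mul_notMem_of_star_eq hn hA hs hp i₀
  let v (i : Fin n) : A := p i * a i * p i₀
  let V : Set (PrimitiveIdeal A) := {t | ∀ i, v i ∉ t.toSubmodule}
  have hV : IsOpen V := by
    simp only [V, Set.ofPred_forall]
    exact isOpen_iInter_of_finite fun i => isOpen_setOf_notMem (v i)
  have hex (s : PrimitiveIdeal A) : ∃ w : FrameSpace n A, w.base = s ∧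
      (s ∈ V → IsNormalizedFrame v i₀ w ∧ w ∈ adaptedFrames n B) := by
    obtain ⟨w, rfl⟩ := hA.exists_base_eq hn s
    by_cases hw : w.base ∈ V
    · obtain ⟨w', hb, hw', c, hc, hwc⟩ :=
        FrameSpace.exists_isNormalizedFrame_of_orthogonal hs ho ha w hw
      exact ⟨w', hb, fun _ => ⟨hw', mem_adaptedFrames_of_coord
        (fun _ hx _ hy => hB.fibreImage_mul_comm w' hx hy) hpB hc hwc⟩⟩
    · exact ⟨w, rfl, fun h => absurd h hw⟩
  choose σ hσb hσV using hex
  exact ⟨V, σ, hV, hat, continuousOn_of_isNormalizedFrame hn hA hV (fun _ hs => hs) hσb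
    fun s hs => (hσV s hs).1, fun s hs => ⟨(hσV s hs).2, hσb s⟩⟩

theorem isReduction : IsReduction (autDiag n) FrameSpace.base (adaptedFrames n B) where
  smul_mem _ hw _ hg := smul_mem_adaptedFrames hw hg
  exists_smul w hw w' hw' h := ⟨_, diff_mem_autDiag hw hw' h, FrameSpace.smul_diff w w' h⟩
  exists_section := hB.exists_section_adaptedFrames hn hA

end IsCartanSubalgebra

end OfCartan

theorem proposition2p2 {A : Type u} [NonUnitalCStarAlgebra A] (n : ℕ) (hn : 1 ≤ n)
    (hA : IsHomogeneous n A) :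
    (∃ B : NonUnitalStarSubalgebra ℂ A, IsCartanSubalgebra B) ↔
      ReducesTo (autDiag n) (FrameSpace.base : FrameSpace n A → PrimitiveIdeal A) := by
  rw [frameSpace_reducesTo_iff]
  constructor
  · rintro ⟨B, hB⟩
    exact ⟨adaptedFrames n B, hB.isReduction hn hA⟩
  · rintro ⟨R, hR⟩
    exact ⟨adaptedSubalgebra R, hR.isCartanSubalgebra hn hA⟩
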